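/- Let $\hat{\mathbb C}=\mathbb C\cup\{\infty\}$ and let $\chi$ be the chordal metric on $\hat{\mathbb C}$, i.e. $\chi(z,w)=\frac{|z-w|}{\sqrt{1+|z|^2}\sqrt{1+|w|^2}}$ and $\chi(z,\infty)=\chi(\infty,z)=\frac1{\sqrt{1+|z|^2}}$ for $z,w\in\mathbb C$, and $\chi(\infty,\infty)=0$. A meromorphic function $f$ on an open set $U\subseteq\mathbb C$ is called locally univalent on $U$ if all its poles in $U$ are simple and $f'(z)\ne 0$ for all $z\in U$ with $f(z)\neq\infty$; in particular, a holomorphic function $f$ on $U$ is locally univalent if $f'$ has no zeros in $U$. For $M\subseteq\mathbb C$ let $\mathcal H_{l.u.}(M)$, respectively $\mathcal M_{l.u.}(M)$, be the set of all functions that are holomorphic, respectively meromorphic, and locally univalent on some open neighbourhood of $M$ in $\mathbb C$ (which may depend on the function). Let $\Omega$ be a domain in $\mathbb C$ and let $K\subseteq\Omega$ be a compact set such that no connected component of $\Omega\setminus K$ is relatively compact in $\Omega$. Then: (a) for every $f\in\mathcal H_{l.u.}(K)$ and every $\varepsilon>0$ there is $g\in\mathcal H_{l.u.}(\Omega)$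 with $|g(z)-f(z)|<\varepsilon$ for all $z\in K$; (b) if $\mathbb C\setminus K$ is connected, then for every $f\in\mathcal M_{l.u.}(K)$ and every $\varepsilon>0$ there is $g\in\mathcal M_{l.u.}(\mathbb C)$ with $\chi(g(z),f(z))<\varepsilon$ for all $z\in K$. -/

import Mathlib

open Set Filter Topology

noncomputable section

namespace LocUniv

/-- The Riemann sphere `ℂ ∪ {∞}`, with its usual topology. -/
abbrev Sphere : Type := OnePoint ℂ

/-- The chordal metric on the Riemann sphere. -/
def chordal : Sphere → Sphere → ℝ
  | OnePoint.some z, OnePoint.some w => ‖z - w‖ / (√(1 + ‖z‖ ^ 2) * √(1 + ‖w‖ ^ 2))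
  | OnePoint.some z, OnePoint.infty => 1 / √(1 + ‖z‖ ^ 2)
  | OnePoint.infty, OnePoint.some w => 1 / √(1 + ‖w‖ ^ 2)
  | OnePoint.infty, OnePoint.infty => 0

/-- The complex-valued representative of a sphere-valued function; the value at the poles is `0`,
an arbitrary choice. -/
def finitePart (f : ℂ → Sphere) (z : ℂ) : ℂ :=
  (f z).elim 0 id

/-- `f` is meromorphic on `U`, as a map into the Riemann sphere: the poles are isolated, `f` is
meromorphic as a complex-valued function away from them, and the value of `f` at each
point of `U` is the limit of `f` there (in particular `∞` exactly at the poles). -/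
def MeroOn (f : ℂ → Sphere) (U : Set ℂ) : Prop :=
  ∀ z ∈ U, (∀ᶠ w in 𝓝[≠] z, f w ≠ OnePoint.infty) ∧
    MeromorphicAt (finitePart f) z ∧ ContinuousAt f z

/-- `f` is a locally univalent meromorphic function on the open set `U`: it has at most simple
poles, and its derivative does not vanish at the points that are not poles. -/
def MeroLocUnivOn (f : ℂ → Sphere) (U : Set ℂ) : Prop :=
  MeroOn f U ∧
    (∀ z ∈ U, f z = OnePoint.infty →
      ((-1 : ℤ) : WithTop ℤ) ≤ meromorphicOrderAt (finitePart f) z) ∧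
    ∀ z ∈ U, f z ≠ OnePoint.infty → deriv (finitePart f) z ≠ 0

/-- `f` is a locally univalent holomorphic function on the open set `U`. -/
def HolLocUnivOn (f : ℂ → ℂ) (U : Set ℂ) : Prop :=
  DifferentiableOn ℂ f U ∧ ∀ z ∈ U, deriv f z ≠ 0

/-- The functions that are holomorphic and locally univalent on some open neighbourhood of `M`. -/
def HLU (M : Set ℂ) : Set (ℂ → ℂ) :=
  {f | ∃ U : Set ℂ, IsOpen U ∧ M ⊆ U ∧ HolLocUnivOn f U}

/-- The functions that are meromorphic and locally univalent on some open neighbourhood of `M`. -/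
def MLU (M : Set ℂ) : Set (ℂ → Sphere) :=
  {f | ∃ U : Set ℂ, IsOpen U ∧ M ⊆ U ∧ MeroLocUnivOn f U}

/-- `A` is relatively compact in `Ω`. -/
def RelCompactIn (A Ω : Set ℂ) : Prop :=
  IsCompact (closure A) ∧ closure A ⊆ Ω

end LocUniv

end

/-!
The derivative of a locally univalent holomorphic function has no zeros near `K`, so it factors as
`f' = R * exp s`, with `R` holomorphic and zero-free on all of `Ω`. Approximating `f` thus means
approximating a solution `(s, f)` of `f' = R * exp s` by solutions on `Ω`. The pair is extended
across one square of a fine grid at a time. Along three sides of a new square, `s` is extended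
continuously with prescribed integrals of `R * exp s`. The old squares and these three sides do not
separate the plane more than the old squares do, so by the Hartogs–Rosenthal theorem and pole
pushing `s` is there a uniform limit of holomorphic functions. The approximants are corrected by
the inverse function theorem so that the integrals over all the sides are exact, and then the
primitives on discs around the squares fit together, because they agree at the lattice points.

A meromorphic `f` with simple poles at the zeros of a polynomial `q` is `φ / q` with `φ`
holomorphic, and `f` is locally univalent iff the numerator `q φ' - q' φ` of its derivative has no
zeros. Near `K` this numerator is `r * exp (q² s)` with `r` entire and zero-free. There is an
entire `Φ` whose numerator is `r`, and `φ = Φ + q g` with `g' = r * (exp (q² s) - 1) / q²`, whose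
right-hand side is holomorphic in `(z, s)`. This is again an equation for a pair `(s, g)`, to
which the same approximation argument applies.
-/

noncomputable section

namespace LocUniv

open MeasureTheory Complex

section CauchyPompeiu

variable {F : Type*} [NormedAddCommGroup F] [NormedSpace ℂ F] {φ : ℂ → F}

/-- The Wirtinger derivative `∂φ/∂z̄`. -/
def dbar (φ : ℂ → F) (z : ℂ) : F :=
  (2 : ℂ)⁻¹ • (fderiv ℝ φ z 1 + I • fderiv ℝ φ z I)

theorem dbar_eq_zero_of_differentiableAt {z : ℂ} (h : DifferentiableAt ℂ φ z) :
    dbar φ z = 0 := by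
  have hI : fderiv ℂ φ z I = I • fderiv ℂ φ z 1 := by
    rw [← map_smul, smul_eq_mul, mul_one]
  simp only [dbar, h.fderiv_restrictScalars ℝ, ContinuousLinearMap.coe_restrictScalars', hI,
    smul_smul, I_mul_I, neg_smul, one_smul, add_neg_cancel, smul_zero]

theorem continuous_dbar (hφ : ContDiff ℝ 1 φ) : Continuous (dbar φ) := by
  have := hφ.continuous_fderiv one_ne_zero
  unfold dbar
  fun_prop

theorem tsupport_dbar_subset (φ : ℂ → F) : tsupport (dbar φ) ⊆ tsupport φ := by
  refine (closure_mono fun z hz => ?_).trans (tsupport_fderiv_subset ℝ)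
  rw [Function.mem_support] at hz ⊢
  contrapose! hz
  simp [dbar, hz]

theorem hasCompactSupport_dbar (hc : HasCompactSupport φ) : HasCompactSupport (dbar φ) :=
  hc.of_isClosed_subset (isClosed_tsupport _) (tsupport_dbar_subset φ)

theorem dbar_comp_const_add (φ : ℂ → F) (z w : ℂ) :
    dbar (fun x => φ (z + x)) w = dbar φ (z + w) := by
  simp only [dbar, fderiv_comp_add_left z]

theorem conj_smul_dbar (φ : ℂ → F) (z v : ℂ) :
    (starRingEnd ℂ v) • dbar φ z =
      (2 : ℂ)⁻¹ • (fderiv ℝ φ z v + I • fderiv ℝ φ z (I * v)) := by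
  have hv : v = v.re • (1 : ℂ) + v.im • I := by simp
  have hIv : I * v = (-v.im) • (1 : ℂ) + v.re • I := by
    apply Complex.ext <;> simp
  rw [hIv, show fderiv ℝ φ z v = v.re • fderiv ℝ φ z 1 + v.im • fderiv ℝ φ z I by
    conv_lhs => rw [hv, map_add, map_smul, map_smul], map_add, map_smul, map_smul]
  have hconj : starRingEnd ℂ v = v.re - v.im * I := by
    apply Complex.ext <;> simp
  simp only [dbar, hconj, ← Complex.coe_smul (_ : ℝ) (_ : F)]
  push_cast
  match_scalars
  · ring
  · linear_combination (-(v.im : ℂ) / 2) * I_mul_I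

theorem integrableOn_polarCoord_target {E : Type*} [NormedAddCommGroup E]
    {f : ℝ × ℝ → E} (hf : Continuous f) {R : ℝ} (h0 : ∀ p : ℝ × ℝ, R < p.1 → f p = 0) :
    IntegrableOn f polarCoord.target := by
  have hk : IntegrableOn f (Icc 0 R ×ˢ Icc (-Real.pi) Real.pi) :=
    hf.continuousOn.integrableOn_compact (isCompact_Icc.prod isCompact_Icc)
  refine hk.of_forall_sdiff_eq_zero polarCoord.open_target.measurableSet ?_
  rintro ⟨r, θ⟩ ⟨⟨hr, hθ⟩, hn⟩
  exact h0 _ (not_le.mp fun hrR => hn ⟨⟨le_of_lt hr, hrR⟩, Ioo_subset_Icc_self hθ⟩)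

theorem integral_Ioi_fderiv_ray [CompleteSpace F] (hφ : ContDiff ℝ 1 φ)
    (hc : HasCompactSupport φ) {v : ℂ} (hv : v ≠ 0) :
    ∫ r in Ioi (0 : ℝ), fderiv ℝ φ (r • v) v = -φ 0 := by
  have hline : ContDiff ℝ 1 fun r : ℝ => φ (r • v) := hφ.comp (contDiff_id.smul contDiff_const)
  have hderiv (r : ℝ) : deriv (fun r : ℝ => φ (r • v)) r = fderiv ℝ φ (r • v) v := by
    have h := ((hφ.differentiable one_ne_zero _).hasFDerivAt (x := r • v)).comp_hasDerivAt r
      ((hasDerivAt_id r).smul_const v)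
    simpa [Function.comp_def] using h.deriv
  have hsupp : HasCompactSupport fun r : ℝ => φ (r • v) :=
    hc.comp_isClosedEmbedding (isClosedEmbedding_smul_left hv)
  simpa only [hderiv, zero_smul] using hsupp.integral_Ioi_deriv_eq hline 0

theorem integral_fderiv_circle [CompleteSpace F] (hφ : ContDiff ℝ 1 φ) {r : ℝ} (hr : r ≠ 0) :
    ∫ θ in (-Real.pi)..Real.pi, fderiv ℝ φ (r • exp (θ * I)) (I * exp (θ * I)) = 0 := by
  have := hφ.continuous_fderiv one_ne_zero
  have hder (θ : ℝ) : HasDerivAt (fun θ : ℝ => r⁻¹ • φ (r • exp (θ * I)))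
      (fderiv ℝ φ (r • exp (θ * I)) (I * exp (θ * I))) θ := by
    have hcircle : HasDerivAt (fun θ : ℝ => r • exp (θ * I)) (r • (exp (θ * I) * I)) θ := by
      simpa using (((hasDerivAt_id θ).ofReal_comp.mul_const I).cexp).fun_const_smul r
    have h := (((hφ.differentiable one_ne_zero _).hasFDerivAt
      (x := r • exp (θ * I))).comp_hasDerivAt θ hcircle).fun_const_smul r⁻¹
    rwa [map_smul, smul_smul, inv_mul_cancel₀ hr, one_smul, mul_comm (exp _) I] at h
  rw [intervalIntegral.integral_eq_sub_of_hasDerivAt (fun θ _ => hder θ)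
    ((Continuous.clm_apply (by fun_prop) (by fun_prop)).intervalIntegrable _ _)]
  simp [exp_neg]

theorem polarCoord_symm_eq_smul_exp (p : ℝ × ℝ) :
    Complex.polarCoord.symm p = p.1 • exp (p.2 * I) := by
  rw [Complex.polarCoord_symm_apply, exp_mul_I, real_smul]
  simp

theorem integrableOn_fderiv_polar (hφ : ContDiff ℝ 1 φ) (hc : HasCompactSupport φ) {c : ℝ → ℂ}
    (hcont : Continuous c) :
    IntegrableOn (fun p : ℝ × ℝ => fderiv ℝ φ (p.1 • exp (p.2 * I)) (c p.2))
      polarCoord.target := by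
  have := hφ.continuous_fderiv one_ne_zero
  obtain ⟨R, hR⟩ := hc.isCompact.isBounded.subset_closedBall (0 : ℂ)
  refine integrableOn_polarCoord_target (R := R)
    (Continuous.clm_apply (by fun_prop) (by fun_prop)) fun p hp => ?_
  have hout : p.1 • exp (p.2 * I) ∉ tsupport φ := fun h => by
    have hle := mem_closedBall_zero_iff.mp (hR h)
    rw [norm_smul, norm_exp_ofReal_mul_I, mul_one] at hle
    exact (hp.trans_le (le_abs_self p.1)).not_ge hle
  rw [image_eq_zero_of_notMem_tsupport fun h => hout (tsupport_fderiv_subset ℝ h),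
    zero_apply]

theorem integral_polar_fderiv_radial [CompleteSpace F] (hφ : ContDiff ℝ 1 φ)
    (hc : HasCompactSupport φ) :
    ∫ p in polarCoord.target, fderiv ℝ φ (p.1 • exp (p.2 * I)) (exp (p.2 * I)) =
      -((2 * Real.pi) • φ 0) := by
  have hint := integrableOn_fderiv_polar hφ hc (c := fun θ => exp (θ * I)) (by fun_prop)
  change ∫ p in Ioi 0 ×ˢ Ioo (-Real.pi) Real.pi, _ = _
  rw [Measure.volume_eq_prod, ← setIntegral_prod_swap]
  refine (setIntegral_prod _ hint.swap).trans ?_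
  simp only [Function.comp_apply, Prod.swap_prod_mk,
    integral_Ioi_fderiv_ray hφ hc (exp_ne_zero _)]
  rw [setIntegral_const, measureReal_def, Real.volume_Ioo,
    ENNReal.toReal_ofReal (by linarith [Real.pi_pos]), smul_neg]
  congr 2
  ring

theorem integral_polar_fderiv_angular [CompleteSpace F] (hφ : ContDiff ℝ 1 φ)
    (hc : HasCompactSupport φ) :
    ∫ p in polarCoord.target, fderiv ℝ φ (p.1 • exp (p.2 * I)) (I * exp (p.2 * I)) = 0 := by
  have hint := integrableOn_fderiv_polar hφ hc (c := fun θ => I * exp (θ * I)) (by fun_prop)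
  change ∫ p in Ioi 0 ×ˢ Ioo (-Real.pi) Real.pi, _ = _
  rw [Measure.volume_eq_prod, setIntegral_prod _ hint]
  refine setIntegral_eq_zero_of_forall_eq_zero fun r hr => ?_
  rw [← integral_Ioc_eq_integral_Ioo,
    ← intervalIntegral.integral_of_le (by linarith [Real.pi_pos]),
    integral_fderiv_circle hφ (ne_of_gt hr)]

theorem integral_inv_smul_dbar_zero [CompleteSpace F] (hφ : ContDiff ℝ 1 φ)
    (hc : HasCompactSupport φ) : ∫ ζ, ζ⁻¹ • dbar φ ζ = -(Real.pi • φ 0) := by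
  rw [← Complex.integral_comp_polarCoord_symm]
  have hpolar : ∀ p ∈ polarCoord.target,
      p.1 • (Complex.polarCoord.symm p)⁻¹ • dbar φ (Complex.polarCoord.symm p) =
        (2 : ℂ)⁻¹ • (fderiv ℝ φ (p.1 • exp (p.2 * I)) (exp (p.2 * I)) +
          I • fderiv ℝ φ (p.1 • exp (p.2 * I)) (I * exp (p.2 * I))) := by
    intro p hp
    have hr : (p.1 : ℂ) ≠ 0 := ofReal_ne_zero.mpr (ne_of_gt hp.1)
    rw [polarCoord_symm_eq_smul_exp, ← conj_smul_dbar, ← exp_conj, map_mul, conj_ofReal, conj_I,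
      mul_neg, exp_neg, ← Complex.coe_smul p.1 (_ : F), smul_smul, real_smul, mul_inv,
      mul_inv_cancel_left₀ hr]
  have hradial := integrableOn_fderiv_polar hφ hc (c := fun θ => exp (θ * I)) (by fun_prop)
  have hangular := integrableOn_fderiv_polar hφ hc (c := fun θ => I * exp (θ * I)) (by fun_prop)
  rw [setIntegral_congr_fun polarCoord.open_target.measurableSet hpolar, integral_smul,
    integral_add hradial (Integrable.fun_smul I hangular),
    integral_smul, integral_polar_fderiv_radial hφ hc, integral_polar_fderiv_angular hφ hc,
    smul_zero, add_zero, smul_neg, ← Complex.coe_smul (2 * Real.pi), smul_smul,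
    ← Complex.coe_smul Real.pi]
  congr 2
  push_cast
  ring

/-- **Cauchy–Pompeiu formula** for compactly supported functions. -/
theorem integral_inv_smul_dbar [CompleteSpace F] (hφ : ContDiff ℝ 1 φ)
    (hc : HasCompactSupport φ) (z : ℂ) :
    ∫ ζ, (z - ζ)⁻¹ • dbar φ ζ = Real.pi • φ z := by
  have h := integral_inv_smul_dbar_zero (φ := fun x => φ (z + x)) (hφ.comp (by fun_prop))
    (hc.comp_homeomorph (Homeomorph.addLeft z))
  simp only [dbar_comp_const_add, add_zero] at h
  rw [← integral_add_left_eq_self (μ := volume) _ z]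
  simp only [sub_add_cancel_left, inv_neg, neg_smul, integral_neg, h, neg_neg]

end CauchyPompeiu

section HartogsRosenthal

theorem lintegral_inv_norm_ball_le {ρ : ℝ} (hρ : 0 ≤ ρ) :
    ∫⁻ ζ in Metric.ball (0 : ℂ) ρ, ENNReal.ofReal ‖ζ‖⁻¹ ≤ ENNReal.ofReal (2 * Real.pi * ρ) := by
  rw [← lintegral_indicator Metric.isOpen_ball.measurableSet,
    ← Complex.lintegral_comp_polarCoord_symm]
  have hle : ∀ p ∈ polarCoord.target, ENNReal.ofReal p.1 •
      (Metric.ball (0 : ℂ) ρ).indicator (fun ζ => ENNReal.ofReal ‖ζ‖⁻¹)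
        (Complex.polarCoord.symm p) ≤ (Ioo 0 ρ ×ˢ Ioo (-Real.pi) Real.pi).indicator 1 p := by
    rintro ⟨r, θ⟩ hp
    have hr : 0 < r := hp.1
    by_cases h : r < ρ
    · rw [indicator_of_mem (show (r, θ) ∈ Ioo 0 ρ ×ˢ Ioo (-Real.pi) Real.pi from ⟨⟨hr, h⟩, hp.2⟩)]
      refine (mul_le_mul_right (indicator_le_self _ _ _) _).trans ?_
      rw [Complex.norm_polarCoord_symm, ← ENNReal.ofReal_mul hr.le, abs_of_pos hr,
        mul_inv_cancel₀ hr.ne', ENNReal.ofReal_one, Pi.one_apply]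
    · rw [indicator_of_notMem (by simpa [abs_of_pos hr] using h), smul_zero]
      exact zero_le
  refine (setLIntegral_mono' polarCoord.open_target.measurableSet hle).trans ?_
  refine (setLIntegral_le_lintegral _ _).trans ?_
  rw [lintegral_indicator_one (measurableSet_Ioo.prod measurableSet_Ioo), Measure.volume_eq_prod,
    Measure.prod_prod, Real.volume_Ioo, Real.volume_Ioo, ← ENNReal.ofReal_mul (by linarith)]
  exact ENNReal.ofReal_le_ofReal (by linarith)

theorem setLIntegral_inv_norm_sub_le (S : Set ℂ) (z : ℂ) {ρ : ℝ} (hρ : 0 < ρ) :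
    ∫⁻ ζ in S, ENNReal.ofReal ‖z - ζ‖⁻¹ ≤
      ENNReal.ofReal (2 * Real.pi * ρ) + ENNReal.ofReal ρ⁻¹ * volume S := by
  have hsplit : ∀ ζ, ENNReal.ofReal ‖z - ζ‖⁻¹ ≤
      (Metric.ball z ρ).indicator (fun ζ => ENNReal.ofReal ‖z - ζ‖⁻¹) ζ + ENNReal.ofReal ρ⁻¹ := by
    intro ζ
    by_cases h : ζ ∈ Metric.ball z ρ
    · rw [indicator_of_mem h]; exact le_self_add
    · rw [indicator_of_notMem h, zero_add]
      rw [Metric.mem_ball, dist_comm, dist_eq_norm, not_lt] at h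
      exact ENNReal.ofReal_le_ofReal (inv_anti₀ hρ h)
  refine (lintegral_mono hsplit).trans ?_
  rw [lintegral_add_right _ measurable_const, setLIntegral_const]
  gcongr
  refine (setLIntegral_le_lintegral _ _).trans
    (le_of_eq_of_le ?_ (lintegral_inv_norm_ball_le hρ.le))
  rw [← lintegral_indicator Metric.isOpen_ball.measurableSet,
    ← lintegral_add_left_eq_self (μ := volume) _ z]
  congr 1
  ext ζ
  by_cases h : ‖ζ‖ < ρ <;> simp [indicator, h]

variable {F : Type*} [NormedAddCommGroup F] [NormedSpace ℂ F] {b : ℂ → F} {M : ℝ}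

theorem setLIntegral_enorm_inv_sub_smul_le (hM : ∀ ζ, ‖b ζ‖ ≤ M) (S : Set ℂ) (z : ℂ) {ρ : ℝ}
    (hρ : 0 < ρ) :
    ∫⁻ ζ in S, ‖(z - ζ)⁻¹ • b ζ‖ₑ ≤
      ENNReal.ofReal M * (ENNReal.ofReal (2 * Real.pi * ρ) + ENNReal.ofReal ρ⁻¹ * volume S) := by
  refine le_trans ?_ (mul_le_mul_right (setLIntegral_inv_norm_sub_le S z hρ) _)
  rw [← lintegral_const_mul' _ _ ENNReal.ofReal_ne_top]
  refine lintegral_mono fun ζ => ?_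
  rw [← ENNReal.ofReal_mul ((norm_nonneg _).trans (hM ζ)), ← ofReal_norm, norm_smul, norm_inv,
    mul_comm]
  exact ENNReal.ofReal_le_ofReal (mul_le_mul_of_nonneg_right (hM ζ) (by positivity))

theorem exists_forall_norm_setIntegral_inv_sub_smul_le (M : ℝ) {ε : ℝ} (hε : 0 < ε) :
    ∃ δ > 0, ∀ b : ℂ → F, (∀ ζ, ‖b ζ‖ ≤ M) → ∀ S : Set ℂ, volume S ≤ ENNReal.ofReal δ →
      ∀ z : ℂ, ‖∫ ζ in S, (z - ζ)⁻¹ • b ζ‖ ≤ ε := by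
  set N := max M 1
  have hN : 0 < N := by positivity
  set ρ := ε / (4 * Real.pi * N)
  have hρ : 0 < ρ := by positivity
  refine ⟨ρ * ε / (2 * N), by positivity, fun b hb S hS z => ?_⟩
  refine (norm_integral_le_lintegral_norm _).trans (ENNReal.toReal_le_of_le_ofReal hε.le ?_)
  simp only [ofReal_norm]
  refine (setLIntegral_enorm_inv_sub_smul_le (fun ζ => (hb ζ).trans (le_max_left M 1)) S z
    hρ).trans ?_
  calc ENNReal.ofReal N * (ENNReal.ofReal (2 * Real.pi * ρ) + ENNReal.ofReal ρ⁻¹ * volume S)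
      ≤ ENNReal.ofReal N * (ENNReal.ofReal (2 * Real.pi * ρ) +
          ENNReal.ofReal ρ⁻¹ * ENNReal.ofReal (ρ * ε / (2 * N))) := by gcongr
    _ = ENNReal.ofReal ε := by
      rw [← ENNReal.ofReal_mul (by positivity),
        ← ENNReal.ofReal_add (by positivity) (by positivity), ← ENNReal.ofReal_mul hN.le]
      congr 1
      simp only [ρ]
      field_simp
      norm_num

theorem integrable_inv_sub_smul (hb : Continuous b) (hc : HasCompactSupport b) (z : ℂ) :
    Integrable fun ζ => (z - ζ)⁻¹ • b ζ := by
  obtain ⟨M, hM⟩ := hb.bounded_above_of_compact_support hc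
  refine IntegrableOn.integrable_of_forall_notMem_eq_zero (s := tsupport b) ⟨?_, ?_⟩ fun ζ hζ => by
    rw [image_eq_zero_of_notMem_tsupport hζ, smul_zero]
  · exact ((measurable_const.sub measurable_id).inv.aestronglyMeasurable).smul
      hb.aestronglyMeasurable
  · refine (setLIntegral_enorm_inv_sub_smul_le hM _ z one_pos).trans_lt
      (ENNReal.mul_lt_top ENNReal.ofReal_lt_top (ENNReal.add_lt_top.mpr ⟨ENNReal.ofReal_lt_top,
        ENNReal.mul_lt_top ENNReal.ofReal_lt_top hc.isCompact.measure_lt_top⟩))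

theorem integral_mem_of_isClosed {α E : Type*} [MeasurableSpace α] {μ : Measure α}
    [NormedAddCommGroup E] [NormedSpace ℂ E] [CompleteSpace E] (X : Submodule ℂ E)
    (hX : IsClosed (X : Set E)) {f : α → E} (hf : Integrable f μ) (hfX : ∀ x, f x ∈ X) :
    ∫ x, f x ∂μ ∈ X := by
  have : IsClosed (X : Set E) := hX
  rw [← Submodule.Quotient.mk_eq_zero]
  change X.mkQL _ = 0
  rw [← X.mkQL.integral_comp_comm hf]
  exact integral_eq_zero_of_ae
    (Eventually.of_forall fun x => (Submodule.Quotient.mk_eq_zero X).mpr (hfX x))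

/-- The Cauchy kernels `z ↦ (z - ζ)⁻¹` on `E`, as a continuous family in `ζ ∉ E`. -/
def cauchyKernel (E : Set ℂ) : C(↥Eᶜ, C(E, ℂ)) :=
  ContinuousMap.curry ⟨fun p => ((p.2 : ℂ) - p.1)⁻¹, by
    refine Continuous.inv₀ (by fun_prop) fun p h => p.1.2 ?_
    rw [← sub_eq_zero.mp h]
    exact p.2.2⟩

@[simp]
theorem cauchyKernel_apply (E : Set ℂ) (ζ : ↥Eᶜ) (z : E) :
    cauchyKernel E ζ z = ((z : ℂ) - ζ)⁻¹ := rfl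

variable {E : Set ℂ} [CompactSpace E]

theorem exists_mem_eq_setIntegral_inv_sub (X : Submodule ℂ C(E, ℂ))
    (hX : IsClosed (X : Set C(E, ℂ))) (hk : ∀ ζ : ↥Eᶜ, cauchyKernel E ζ ∈ X) {b : ℂ → ℂ}
    (hb : Continuous b) {T : Set ℂ} (hT : IsCompact T) (hTE : T ⊆ Eᶜ) :
    ∃ Φ ∈ X, ∀ z : E, Φ z = ∫ ζ in T, ((z : ℂ) - ζ)⁻¹ • b ζ := by
  have : CompactSpace T := isCompact_iff_compactSpace.mp hT
  let μ : Measure T := Measure.comap (Subtype.val : T → ℂ) volume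
  have : IsFiniteMeasure μ := ⟨by
    rw [comap_subtype_coe_apply hT.measurableSet, image_univ, Subtype.range_coe]
    exact hT.measure_lt_top⟩
  let g : C(T, C(E, ℂ)) :=
    ⟨fun ζ => b ζ • cauchyKernel E (inclusion hTE ζ), by fun_prop⟩
  have hg : Integrable g μ :=
    g.continuous.integrable_of_hasCompactSupport (HasCompactSupport.of_compactSpace g)
  refine ⟨∫ ζ, g ζ ∂μ, integral_mem_of_isClosed X hX hg fun ζ => X.smul_mem _ (hk _), fun z => ?_⟩
  rw [← integral_subtype_comap hT.measurableSet]
  refine ((ContinuousMap.evalCLM ℂ z).integral_comp_comm hg).symm.trans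
    (integral_congr_ae (Eventually.of_forall fun ζ => mul_comm _ _))

/-- **Hartogs–Rosenthal theorem**. -/
theorem mem_of_volume_inter_tsupport_dbar_eq_zero (X : Submodule ℂ C(E, ℂ))
    (hX : IsClosed (X : Set C(E, ℂ))) (hk : ∀ ζ : ↥Eᶜ, cauchyKernel E ζ ∈ X) (ψ : C(E, ℂ))
    {φ : ℂ → ℂ} (hφ : ContDiff ℝ 1 φ) (hc : HasCompactSupport φ) (hψ : ∀ z, ψ z = φ z)
    (hnull : volume (E ∩ tsupport (dbar φ)) = 0) : ψ ∈ X := by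
  have hb := continuous_dbar hφ
  have hbc := hasCompactSupport_dbar hc
  set T := tsupport (dbar φ)
  obtain ⟨M, hM⟩ := hb.bounded_above_of_compact_support hbc
  suffices hdense : ∀ ε > 0, ∃ Φ ∈ X, ‖Real.pi • ψ - Φ‖ ≤ ε by
    have hmem : Real.pi • ψ ∈ X := by
      rw [← SetLike.mem_coe, ← hX.closure_eq, Metric.mem_closure_iff]
      intro ε hε
      obtain ⟨Φ, hΦ, hle⟩ := hdense (ε / 2) (half_pos hε)
      exact ⟨Φ, hΦ, by rw [dist_eq_norm]; linarith⟩
    rw [← Complex.coe_smul] at hmem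
    exact (X.smul_mem_iff (ofReal_ne_zero.mpr Real.pi_ne_zero)).mp hmem
  intro ε hε
  obtain ⟨δ, hδ, hsmall⟩ := exists_forall_norm_setIntegral_inv_sub_smul_le (F := ℂ) M hε
  obtain ⟨V, hEV, hV, hvol⟩ := (E ∩ T).exists_isOpen_lt_of_lt (μ := volume) (ENNReal.ofReal δ)
    (by rw [hnull]; exact ENNReal.ofReal_pos.mpr hδ)
  obtain ⟨Φ, hΦX, hΦ⟩ := exists_mem_eq_setIntegral_inv_sub X hX hk hb (hbc.isCompact.diff hV)
    fun ζ hζ hE => hζ.2 (hEV ⟨hE, hζ.1⟩)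
  refine ⟨Φ, hΦX, (ContinuousMap.norm_le _ hε.le).mpr fun z => ?_⟩
  have hpompeiu : Real.pi • φ z = ∫ ζ in T, ((z : ℂ) - ζ)⁻¹ • dbar φ ζ := by
    rw [setIntegral_eq_integral_of_forall_compl_eq_zero, integral_inv_smul_dbar hφ hc]
    intro ζ hζ
    rw [image_eq_zero_of_notMem_tsupport hζ, smul_zero]
  rw [ContinuousMap.sub_apply, ContinuousMap.smul_apply, hψ, hΦ, hpompeiu,
    ← integral_inter_add_sdiff hV.measurableSet (integrable_inv_sub_smul hb hbc z).integrableOn,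
    add_sub_cancel_right]
  exact hsmall _ hM _ ((measure_mono inter_subset_right).trans hvol.le) z

end HartogsRosenthal

section Cutoff

variable {V F : Type*} [NormedAddCommGroup V] [NormedSpace ℝ V] [FiniteDimensional ℝ V]
  [NormedAddCommGroup F] [NormedSpace ℝ F]

theorem exists_contDiff_hasCompactSupport_eventuallyEq {n : ℕ∞} {L U : Set V} (hL : IsCompact L)
    (hU : IsOpen U) (hLU : L ⊆ U) {u : V → F} (hu : ContDiffOn ℝ n u U) :
    ∃ w : V → F, ContDiff ℝ n w ∧ HasCompactSupport w ∧ w =ᶠ[𝓝ˢ L] u := by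
  obtain ⟨t, ht, hLt, htU⟩ := exists_compact_between hL hU hLU
  obtain ⟨χ, hχL, hχt, -⟩ := exists_contMDiffMap_one_nhds_of_subset_interior
    (modelWithCornersSelf ℝ V) (n := n) hL.isClosed hLt
  have hsupp : tsupport (fun x => χ x • u x) ⊆ t :=
    closure_minimal (fun x hx => by_contra fun hxt => hx (by simp [hχt x hxt])) ht.isClosed
  refine ⟨fun x => χ x • u x, contDiff_iff_contDiffAt.mpr fun x => ?_,
    ht.of_isClosed_subset (isClosed_tsupport _) hsupp, ?_⟩
  · by_cases hx : x ∈ U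
    · exact χ.contMDiff.contDiff.contDiffAt.smul (hu.contDiffAt (hU.mem_nhds hx))
    · exact contDiffAt_const.congr_of_eventuallyEq
        (notMem_tsupport_iff_eventuallyEq.mp fun h => hx (htU (hsupp h)))
  · filter_upwards [hχL] with x hx
    rw [hx, one_smul]

theorem exists_contDiff_approx_support_subset {v : V → F} (hv : Continuous v) (n : ℕ∞) {δ : ℝ}
    (hδ : 0 < δ) :
    ∃ s : V → F, ContDiff ℝ n s ∧ (∀ x, ‖s x - v x‖ < 2 * δ) ∧
      Function.support s ⊆ {x | δ < ‖v x‖} := by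
  set c : V → ℝ := fun x => δ / max δ ‖v x‖
  have hpos : ∀ x, 0 < max δ ‖v x‖ := fun x => lt_max_of_lt_left hδ
  have hc : Continuous c := continuous_const.div (by fun_prop) fun x => (hpos x).ne'
  have hcv : ∀ x, ‖c x • v x‖ ≤ δ := fun x => by
    rw [norm_smul, Real.norm_of_nonneg (div_nonneg hδ.le (hpos x).le), div_mul_eq_mul_div]
    exact div_le_of_le_mul₀ (hpos x).le hδ.le
      (mul_le_mul_of_nonneg_left (le_max_right _ _) hδ.le)
  obtain ⟨s, hs, hsd, hss⟩ := Continuous.exists_contDiff_approx (f := fun x => v x - c x • v x)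
    (ε := fun _ => δ) n (by fun_prop) continuous_const fun _ => hδ
  refine ⟨s, hs, fun x => ?_, fun x hx => ?_⟩
  · have h := norm_sub_le (s x - (v x - c x • v x)) (c x • v x)
    rw [sub_sub, sub_add_cancel, ← dist_eq_norm (s x) (v x - _)] at h
    linarith [hsd x, hcv x]
  · by_contra hle
    refine hss hx ?_
    rw [mem_ofPred_eq, not_lt] at hle
    simp only [c, max_eq_left hle, div_self hδ.ne', one_smul, sub_self]

theorem exists_continuous_hasCompactSupport_extension {E : Set ℂ} (hE : IsCompact E)
    (f : C(E, ℂ)) : ∃ v : ℂ → ℂ, Continuous v ∧ HasCompactSupport v ∧ ∀ z : E, v z = f z := by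
  obtain ⟨g, hg⟩ := f.exists_restrict_eq hE.isClosed
  obtain ⟨χ, hχ, hχc, hχE⟩ := exists_contDiff_hasCompactSupport_eventuallyEq (n := 0) hE
    isOpen_univ (subset_univ _) (contDiffOn_const (c := (1 : ℂ)))
  refine ⟨fun z => χ z * g z, hχ.continuous.mul g.continuous, hχc.mul_right, fun z => ?_⟩
  simpa [hχE.self_of_nhdsSet z.2] using DFunLike.congr_fun hg z

end Cutoff

section ClosedSubspaces

variable {E : Set ℂ}

theorem cauchyKernel_mul_one_sub_smul (ζ₁ ζ₂ : ↥Eᶜ) :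
    cauchyKernel E ζ₂ * (1 - ((ζ₂ : ℂ) - ζ₁) • cauchyKernel E ζ₁) = cauchyKernel E ζ₁ := by
  ext z
  have hz₁ : (z : ℂ) - ζ₁ ≠ 0 := fun h => ζ₁.2 (sub_eq_zero.mp h ▸ z.2)
  have hz₂ : (z : ℂ) - ζ₂ ≠ 0 := fun h => ζ₂.2 (sub_eq_zero.mp h ▸ z.2)
  simp only [ContinuousMap.mul_apply, ContinuousMap.sub_apply, ContinuousMap.one_apply,
    ContinuousMap.smul_apply, cauchyKernel_apply, smul_eq_mul]
  field_simp
  ring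

theorem volume_inter_tsupport_dbar_eq_zero {L : Set ℂ} {φ : ℂ → ℂ} (hnull : volume (E \ L) = 0)
    (hφ : ∀ᶠ z in 𝓝ˢ L, DifferentiableAt ℂ φ z) : volume (E ∩ tsupport (dbar φ)) = 0 := by
  refine measure_mono_null (t := E \ L) (fun z hz => ⟨hz.1, fun hzL => ?_⟩) hnull
  refine notMem_tsupport_iff_eventuallyEq.mpr ?_ hz.2
  exact (eventually_nhdsSet_iff_forall.mp hφ z hzL).mono fun _ =>
    dbar_eq_zero_of_differentiableAt

variable [CompactSpace E]

theorem mem_of_eqOn_differentiableOn {L U : Set ℂ} (hL : IsCompact L) (hLE : L ⊆ E)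
    (hU : IsOpen U) (hLU : L ⊆ U) {u : ℂ → ℂ} (hu : DifferentiableOn ℂ u U)
    (hnull : volume (E \ L) = 0) (X : Submodule ℂ C(E, ℂ))
    (hX : IsClosed (X : Set C(E, ℂ))) (hk : ∀ ζ : ↥Eᶜ, cauchyKernel E ζ ∈ X)
    (ψ : C(E, ℂ)) (hψ : ∀ z : E, (z : ℂ) ∈ L → ψ z = u z) : ψ ∈ X := by
  obtain ⟨w, hw, hwc, hwu⟩ := exists_contDiff_hasCompactSupport_eventuallyEq (n := 1) hL hU hLU
    ((hu.contDiffOn hU).restrict_scalars ℝ)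
  obtain ⟨v, hv, hvc, hvE⟩ := exists_continuous_hasCompactSupport_extension
    (isCompact_iff_compactSpace.mpr ‹_›)
    (ψ - ⟨fun z : E => w z, hw.continuous.comp continuous_subtype_val⟩)
  have hvL : ∀ z ∈ L, v z = 0 := fun z hz => by
    rw [hvE ⟨z, hLE hz⟩, ContinuousMap.sub_apply, hψ _ hz, sub_eq_zero]
    exact (hwu.self_of_nhdsSet hz).symm
  rw [← SetLike.mem_coe, ← hX.closure_eq, Metric.mem_closure_iff]
  intro ε hε
  obtain ⟨s, hs, hsv, hss⟩ := exists_contDiff_approx_support_subset hv 1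
    (δ := ε / 4) (by positivity)
  have hsc : HasCompactSupport s := hvc.mono fun z hz =>
    norm_pos_iff.mp (lt_trans (by positivity) (hss hz))
  have hholo : ∀ᶠ z in 𝓝ˢ L, w z + s z = u z ∧ z ∈ U := by
    have hsmall : ∀ᶠ z in 𝓝ˢ L, ‖v z‖ < ε / 4 :=
      (isOpen_lt hv.norm continuous_const).mem_nhdsSet.mpr fun z hz => by
        simpa [hvL z hz] using hε
    filter_upwards [hwu, hsmall, hU.mem_nhdsSet.mpr hLU] with z hwz hz hzU
    have hsz : s z = 0 := by_contra fun h => lt_asymm hz (hss h)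
    exact ⟨by rw [hwz, hsz, add_zero], hzU⟩
  have hnull' : volume (E ∩ tsupport (dbar fun z => w z + s z)) = 0 :=
    volume_inter_tsupport_dbar_eq_zero hnull (hholo.eventually_nhdsSet.mono fun z hz =>
      (hu.differentiableAt (hU.mem_nhds hz.self_of_nhds.2)).congr_of_eventuallyEq
        (hz.mono fun _ h => h.1))
  let Φ : C(E, ℂ) := ⟨fun z => w z + s z, by
    have := hw.continuous; have := hs.continuous; fun_prop⟩
  refine ⟨Φ, mem_of_volume_inter_tsupport_dbar_eq_zero X hX hk Φ (hw.add hs) (hwc.add hsc)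
    (fun _ => rfl) hnull', ?_⟩
  rw [dist_comm, dist_eq_norm, ContinuousMap.norm_lt_iff _ hε]
  intro z
  have hdiff : (Φ - ψ) z = s z - v z := by
    rw [hvE]
    change w z + s z - ψ z = s z - (ψ z - w z)
    ring
  rw [hdiff]
  linarith [hsv z]

theorem cauchyKernel_mem_of_norm_lt_one (X : Subalgebra ℂ C(E, ℂ))
    (hX : IsClosed (X : Set C(E, ℂ))) {ζ₁ ζ₂ : ↥Eᶜ} (h₁ : cauchyKernel E ζ₁ ∈ X)
    (hlt : ‖((ζ₂ : ℂ) - ζ₁) • cauchyKernel E ζ₁‖ < 1) : cauchyKernel E ζ₂ ∈ X := by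
  set x := ((ζ₂ : ℂ) - ζ₁) • cauchyKernel E ζ₁
  have hgeom : ∑' n : ℕ, x ^ n ∈ X :=
    hX.mem_of_tendsto (summable_geometric_of_norm_lt_one hlt).hasSum
      (Eventually.of_forall fun t => X.sum_mem fun n _ => X.pow_mem (X.smul_mem h₁ _) n)
  have hseries : cauchyKernel E ζ₂ = cauchyKernel E ζ₁ * ∑' n : ℕ, x ^ n := by
    rw [← cauchyKernel_mul_one_sub_smul ζ₁ ζ₂, mul_assoc, mul_neg_geom_series x hlt, mul_one]
  exact hseries ▸ X.mul_mem h₁ hgeom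

theorem isOpen_cauchyKernel_preimage (X : Subalgebra ℂ C(E, ℂ))
    (hX : IsClosed (X : Set C(E, ℂ))) : IsOpen (cauchyKernel E ⁻¹' (X : Set C(E, ℂ))) := by
  refine isOpen_iff_mem_nhds.mpr fun ζ₁ h₁ => ?_
  have hcont : ContinuousAt (fun ζ₂ : ↥Eᶜ => ‖((ζ₂ : ℂ) - ζ₁) • cauchyKernel E ζ₁‖) ζ₁ := by
    fun_prop
  filter_upwards [hcont.eventually_lt continuousAt_const
    (show ‖((ζ₁ : ℂ) - ζ₁) • cauchyKernel E ζ₁‖ < 1 by simp)] with ζ₂ hlt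
  exact cauchyKernel_mem_of_norm_lt_one X hX h₁ hlt

theorem cauchyKernel_mem_of_isPreconnected (X : Subalgebra ℂ C(E, ℂ))
    (hX : IsClosed (X : Set C(E, ℂ))) {S : Set ℂ} (hS : IsPreconnected S) (hSE : S ⊆ Eᶜ)
    {ζ₀ ζ : ↥Eᶜ} (h₀ : (ζ₀ : ℂ) ∈ S) (h : (ζ : ℂ) ∈ S) (hk : cauchyKernel E ζ₀ ∈ X) :
    cauchyKernel E ζ ∈ X := by
  have hclopen : IsClopen (cauchyKernel E ⁻¹' (X : Set C(E, ℂ))) :=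
    ⟨hX.preimage (cauchyKernel E).continuous, isOpen_cauchyKernel_preimage X hX⟩
  have hS' : IsPreconnected ((↑) ⁻¹' S : Set ↥Eᶜ) :=
    hS.preimage_of_isOpenMap Subtype.val_injective
      (isCompact_iff_compactSpace.mpr ‹_›).isClosed.isOpen_compl.isOpenMap_subtype_val
      (by rwa [Subtype.range_coe])
  exact hS'.subset_isClopen hclopen ⟨ζ₀, h₀, hk⟩ h

end ClosedSubspaces

section ExpFactorization

variable {K Ω : Set ℂ} {W W₁ W₂ : ℂ → ℂ}

/-- `K` is Runge in `Ω`: every component of the complement of `K` is unbounded or meets the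
complement of `Ω`, so that a pole off `K` can be pushed out of `Ω` or to infinity. -/
def IsRungeIn (K Ω : Set ℂ) : Prop :=
  ∀ b ∉ K, (connectedComponentIn Kᶜ b ∩ Ωᶜ).Nonempty ∨
    ¬ Bornology.IsBounded (connectedComponentIn Kᶜ b)

theorem IsRungeIn.of_forall_exists_isPreconnected
    (h : ∀ b ∉ K, ∃ S : Set ℂ, IsPreconnected S ∧ b ∈ S ∧ S ⊆ Kᶜ ∧
      ((S ∩ Ωᶜ).Nonempty ∨ ¬ Bornology.IsBounded S)) : IsRungeIn K Ω := by
  intro b hb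
  obtain ⟨S, hS, hbS, hSK, hS'⟩ := h b hb
  have hsub := hS.subset_connectedComponentIn hbS hSK
  exact hS'.imp (fun hne => hne.mono (inter_subset_inter_left _ hsub))
    (mt fun hbdd => hbdd.subset hsub)

theorem exists_eventually_eq_mul_exp (h₁ : ∀ᶠ z in 𝓝ˢ K, DifferentiableAt ℂ W₁ z)
    (h₂ : ∀ᶠ z in 𝓝ˢ K, DifferentiableAt ℂ W₂ z) (hlt : ∀ z ∈ K, ‖W₂ z - W₁ z‖ < ‖W₁ z‖) :
    ∃ u : ℂ → ℂ, ∀ᶠ z in 𝓝ˢ K, DifferentiableAt ℂ u z ∧ W₂ z = W₁ z * exp (u z) := by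
  rw [eventually_nhdsSet_iff_forall] at h₁ h₂
  refine ⟨fun z => log (W₂ z / W₁ z), eventually_nhdsSet_iff_forall.mpr fun x hx => ?_⟩
  have hc₁ : ContinuousAt W₁ x := (h₁ x hx).self_of_nhds.continuousAt
  have hc₂ : ContinuousAt W₂ x := (h₂ x hx).self_of_nhds.continuousAt
  filter_upwards [h₁ x hx, h₂ x hx, (hc₂.sub hc₁).norm.eventually_lt hc₁.norm (hlt x hx)]
    with z hz₁ hz₂ hlt
  have hz0 : W₁ z ≠ 0 := norm_pos_iff.mp ((norm_nonneg _).trans_lt hlt)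
  have hslit : W₂ z / W₁ z ∈ slitPlane := by
    rw [← add_sub_cancel 1 (W₂ z / W₁ z)]
    refine mem_slitPlane_of_norm_lt_one ?_
    rwa [div_sub_one hz0, norm_div, div_lt_one (norm_pos_iff.mpr hz0)]
  exact ⟨(hz₂.div hz₁ hz0).clog hslit,
    by rw [exp_log (slitPlane_ne_zero hslit), mul_div_cancel₀ _ hz0]⟩

/-- Near `K`, the function `W` is `R * exp u` with `u` holomorphic near `K` and `R` holomorphic
without zeros in the whole of `Ω`. -/
def HasExpFactorization (K Ω : Set ℂ) (W : ℂ → ℂ) : Prop :=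
  ∃ R u : ℂ → ℂ, DifferentiableOn ℂ R Ω ∧ (∀ z ∈ Ω, R z ≠ 0) ∧
    ∀ᶠ z in 𝓝ˢ K, DifferentiableAt ℂ u z ∧ W z = R z * exp (u z)

namespace HasExpFactorization

theorem of_ne_zero (hW : DifferentiableOn ℂ W Ω) (h0 : ∀ z ∈ Ω, W z ≠ 0) :
    HasExpFactorization K Ω W :=
  ⟨W, fun _ => 0, hW, h0, Eventually.of_forall fun _ => ⟨differentiableAt_const _, by simp⟩⟩

theorem mul (h₁ : HasExpFactorization K Ω W₁) (h₂ : HasExpFactorization K Ω W₂) :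
    HasExpFactorization K Ω (fun z => W₁ z * W₂ z) := by
  obtain ⟨R₁, u₁, hR₁, hn₁, he₁⟩ := h₁
  obtain ⟨R₂, u₂, hR₂, hn₂, he₂⟩ := h₂
  refine ⟨fun z => R₁ z * R₂ z, fun z => u₁ z + u₂ z, hR₁.mul hR₂,
    fun z hz => mul_ne_zero (hn₁ z hz) (hn₂ z hz), ?_⟩
  filter_upwards [he₁, he₂] with z h h'
  exact ⟨h.1.add h'.1, by rw [h.2, h'.2, exp_add, mul_mul_mul_comm]⟩

theorem inv (h : HasExpFactorization K Ω W) : HasExpFactorization K Ω (fun z => (W z)⁻¹) := by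
  obtain ⟨R, u, hR, hn, he⟩ := h
  refine ⟨fun z => (R z)⁻¹, fun z => -u z, hR.inv hn, fun z hz => inv_ne_zero (hn z hz), ?_⟩
  filter_upwards [he] with z h
  exact ⟨h.1.neg, by rw [h.2, exp_neg, mul_inv]⟩

theorem of_eq_mul_exp (h₁ : HasExpFactorization K Ω W₁)
    (h : ∃ u : ℂ → ℂ, ∀ᶠ z in 𝓝ˢ K, DifferentiableAt ℂ u z ∧ W₂ z = W₁ z * exp (u z)) :
    HasExpFactorization K Ω W₂ := by
  obtain ⟨R, v, hR, hn, he⟩ := h₁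
  obtain ⟨u, hu⟩ := h
  refine ⟨R, fun z => v z + u z, hR, hn, ?_⟩
  filter_upwards [he, hu] with z h h'
  exact ⟨h.1.add h'.1, by rw [h'.2, h.2, exp_add, mul_assoc]⟩

theorem of_mul_exp_eq (h₂ : HasExpFactorization K Ω W₂)
    (h : ∃ u : ℂ → ℂ, ∀ᶠ z in 𝓝ˢ K, DifferentiableAt ℂ u z ∧ W₂ z = W₁ z * exp (u z)) :
    HasExpFactorization K Ω W₁ := by
  obtain ⟨u, hu⟩ := h
  refine h₂.of_eq_mul_exp ⟨fun z => -u z, ?_⟩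
  filter_upwards [hu] with z hz
  exact ⟨hz.1.neg, by rw [hz.2, mul_assoc, ← exp_add, add_neg_cancel, exp_zero, mul_one]⟩

theorem sub_const_congr {S : Set ℂ} (hK : IsClosed K) (hS : IsPreconnected S) (hSK : S ⊆ Kᶜ)
    {b b' : ℂ} (hb : b ∈ S) (hb' : b' ∈ S) :
    HasExpFactorization K Ω (fun z => z - b) ↔ HasExpFactorization K Ω (fun z => z - b') := by
  refine hS.induction₂ (fun b b' => HasExpFactorization K Ω (fun z => z - b) ↔
    HasExpFactorization K Ω (fun z => z - b')) (fun b hb => ?_) (fun _ _ _ _ _ _ => Iff.trans)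
    (fun _ _ _ _ => Iff.symm) hb hb'
  obtain ⟨r, hr, hrK⟩ := Metric.isOpen_iff.mp hK.isOpen_compl b (hSK hb)
  filter_upwards [mem_nhdsWithin_of_mem_nhds (Metric.ball_mem_nhds b hr)] with b' hb'
  have hquot := exists_eventually_eq_mul_exp (K := K) (W₁ := fun z => z - b)
    (W₂ := fun z => z - b') (Eventually.of_forall fun z => by fun_prop)
    (Eventually.of_forall fun z => by fun_prop) fun z hz => by
      have hzr : r ≤ dist z b := not_lt.mp fun h => hrK h hz
      rw [sub_sub_sub_cancel_left, ← dist_eq_norm, ← dist_eq_norm, dist_comm]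
      exact (Metric.mem_ball.mp hb').trans_le hzr
  exact ⟨fun h => h.of_eq_mul_exp hquot, fun h => h.of_mul_exp_eq hquot⟩

theorem sub_const (hK : IsCompact K) (hKΩ : IsRungeIn K Ω) {b : ℂ} (hb : b ∉ K) :
    HasExpFactorization K Ω (fun z => z - b) := by
  suffices h : ∃ a ∈ connectedComponentIn Kᶜ b, HasExpFactorization K Ω (fun z => z - a) by
    obtain ⟨a, ha, hfac⟩ := h
    exact (sub_const_congr hK.isClosed isPreconnected_connectedComponentIn
      (connectedComponentIn_subset _ _) ha (mem_connectedComponentIn hb)).mp hfac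
  rcases hKΩ b hb with ⟨a, ha, haΩ⟩ | hub
  · exact ⟨a, ha, of_ne_zero (by fun_prop) fun z hz h => haΩ (sub_eq_zero.mp h ▸ hz)⟩
  · obtain ⟨r, hr⟩ := hK.isBounded.subset_ball (0 : ℂ)
    obtain ⟨a, ha, har⟩ : ∃ a ∈ connectedComponentIn Kᶜ b, a ∉ Metric.ball (0 : ℂ) (max r 1) := by
      by_contra! h
      exact hub (Metric.isBounded_ball.subset h)
    rw [mem_ball_zero_iff, not_lt, max_le_iff] at har
    have ha0 : a ≠ 0 := norm_pos_iff.mp (one_pos.trans_le har.2)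
    refine ⟨a, ha, (of_ne_zero (W := fun _ => -a) (by fun_prop)
      fun _ _ => neg_ne_zero.mpr ha0).of_eq_mul_exp (exists_eventually_eq_mul_exp
        (Eventually.of_forall fun z => by fun_prop) (Eventually.of_forall fun z => by fun_prop)
        fun z hz => ?_)⟩
    rw [sub_neg_eq_add, sub_add_cancel, norm_neg]
    exact (mem_ball_zero_iff.mp (hr hz)).trans_le har.1

theorem polynomial_eval (hK : IsCompact K) (hKΩ : IsRungeIn K Ω) {P : Polynomial ℂ} (hP0 : P ≠ 0)
    (hP : ∀ z ∈ K, P.eval z ≠ 0) : HasExpFactorization K Ω (fun z => P.eval z) := by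
  have hconst {c : ℂ} (hc : c ≠ 0) : HasExpFactorization K Ω fun _ => c :=
    of_ne_zero (differentiableOn_const c) fun _ _ => hc
  have hprod : ∀ s : Multiset ℂ, (∀ b ∈ s, b ∉ K) → HasExpFactorization K Ω
      (fun z => ((s.map fun a => Polynomial.X - Polynomial.C a).prod).eval z) := by
    intro s
    induction s using Multiset.induction_on with
    | empty => simpa using hconst one_ne_zero
    | cons b s ih =>
      intro h
      simpa using (sub_const hK hKΩ (h b (Multiset.mem_cons_self b s))).mul
        (ih fun b' hb' => h b' (Multiset.mem_cons_of_mem hb'))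
  rw [(IsAlgClosed.splits P).eq_prod_roots]
  simpa using (hconst (Polynomial.leadingCoeff_ne_zero.mpr hP0)).mul
    (hprod _ fun b hb hbK => hP b hbK (Polynomial.isRoot_of_mem_roots hb))

end HasExpFactorization

/-- The restrictions to `K` of the rational functions without poles on `K`. -/
def rationalOn (K : Set ℂ) : Submodule ℂ C(K, ℂ) where
  carrier := {ψ | ∃ P Q : Polynomial ℂ, (∀ z ∈ K, Q.eval z ≠ 0) ∧
    ∀ z : K, ψ z = P.eval (z : ℂ) / Q.eval (z : ℂ)}
  add_mem' := by
    rintro ψ₁ ψ₂ ⟨P₁, Q₁, h₁, e₁⟩ ⟨P₂, Q₂, h₂, e₂⟩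
    refine ⟨P₁ * Q₂ + Q₁ * P₂, Q₁ * Q₂, fun z hz => ?_, fun z => ?_⟩
    · simpa using ⟨h₁ z hz, h₂ z hz⟩
    · simp only [ContinuousMap.add_apply, e₁, e₂, Polynomial.eval_add, Polynomial.eval_mul]
      exact div_add_div _ _ (h₁ z z.2) (h₂ z z.2)
  zero_mem' := ⟨0, 1, by simp, by simp⟩
  smul_mem' := by
    rintro c ψ ⟨P, Q, h, e⟩
    exact ⟨Polynomial.C c * P, Q, h, fun z => by simp [e, mul_div_assoc]⟩

theorem cauchyKernel_mem_rationalOn (ζ : ↥Kᶜ) : cauchyKernel K ζ ∈ rationalOn K := by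
  refine ⟨1, Polynomial.X - Polynomial.C (ζ : ℂ), fun z hz h => ζ.2 ?_, fun z => by simp⟩
  rw [Polynomial.eval_sub, Polynomial.eval_X, Polynomial.eval_C, sub_eq_zero] at h
  exact h ▸ hz

theorem exists_polynomial_div_near (hK : IsCompact K)
    (hW : ∀ᶠ z in 𝓝ˢ K, DifferentiableAt ℂ W z) {ε : ℝ} (hε : 0 < ε) :
    ∃ P Q : Polynomial ℂ, (∀ z ∈ K, Q.eval z ≠ 0) ∧
      ∀ z ∈ K, ‖P.eval z / Q.eval z - W z‖ < ε := by
  obtain ⟨U, hU, hKU, hUW⟩ := eventually_nhdsSet_iff_exists.mp hW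
  have hWU : DifferentiableOn ℂ W U := fun z hz => (hUW z hz).differentiableWithinAt
  have : CompactSpace K := isCompact_iff_compactSpace.mp hK
  let ψ₀ : C(K, ℂ) := ⟨fun z => W z, hWU.continuousOn.comp_continuous continuous_subtype_val
    fun z => hKU z.2⟩
  have hmem : ψ₀ ∈ (rationalOn K).topologicalClosure :=
    mem_of_eqOn_differentiableOn hK subset_rfl hU hKU hWU (by simp) _
      (Submodule.isClosed_topologicalClosure _)
      (fun ζ => Submodule.le_topologicalClosure _ (cauchyKernel_mem_rationalOn ζ)) ψ₀
      fun _ _ => rfl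
  rw [← SetLike.mem_coe, Submodule.topologicalClosure_coe, Metric.mem_closure_iff] at hmem
  obtain ⟨ψ, ⟨P, Q, hQ, hψ⟩, hd⟩ := hmem ε hε
  refine ⟨P, Q, hQ, fun z hz => ?_⟩
  rw [dist_comm] at hd
  rw [← hψ ⟨z, hz⟩, ← dist_eq_norm]
  exact (ContinuousMap.dist_apply_le_dist (g := ψ₀) ⟨z, hz⟩).trans_lt hd

theorem hasExpFactorization_of_forall_ne_zero (hK : IsCompact K) (hKΩ : IsRungeIn K Ω)
    (hW : ∀ᶠ z in 𝓝ˢ K, DifferentiableAt ℂ W z) (hW0 : ∀ z ∈ K, W z ≠ 0) :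
    HasExpFactorization K Ω W := by
  rcases K.eq_empty_or_nonempty with rfl | hne
  · exact (HasExpFactorization.of_ne_zero (W := fun _ => 1) (by fun_prop) (by simp)).of_eq_mul_exp
      ⟨0, by simp⟩
  have hWc : ContinuousOn W K := fun z hz =>
    (hW.self_of_nhdsSet z hz).continuousAt.continuousWithinAt
  obtain ⟨x, hx, hxm⟩ := hK.exists_isMinOn hne hWc.norm
  obtain ⟨P, Q, hQ, hPQ⟩ := exists_polynomial_div_near hK hW (norm_pos_iff.mpr (hW0 x hx))
  have hlt : ∀ z ∈ K, ‖P.eval z / Q.eval z - W z‖ < ‖W z‖ := fun z hz =>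
    (hPQ z hz).trans_le (hxm hz)
  have hP : ∀ z ∈ K, P.eval z ≠ 0 := fun z hz h => by simpa [h] using hlt z hz
  have hfac : HasExpFactorization K Ω fun z => P.eval z / Q.eval z :=
    (HasExpFactorization.polynomial_eval hK hKΩ (fun h => hP x hx (by simp [h])) hP).mul
      (HasExpFactorization.polynomial_eval hK hKΩ (fun h => hQ x hx (by simp [h])) hQ).inv
  refine hfac.of_mul_exp_eq (exists_eventually_eq_mul_exp hW ?_ hlt)
  refine eventually_nhdsSet_iff_forall.mpr fun z hz => ?_
  filter_upwards [Q.continuous.continuousAt.eventually_ne (hQ z hz)] with y hy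
  exact P.differentiableAt.div Q.differentiableAt hy

end ExpFactorization

section ExpField

/-- The entire function `(exp x - 1) / x`. -/
def expSlope (x : ℂ) : ℂ := dslope exp 0 x

theorem mul_expSlope (x : ℂ) : x * expSlope x = exp x - 1 := by
  simpa [expSlope] using sub_smul_dslope exp 0 x

theorem differentiable_expSlope : Differentiable ℂ expSlope := by
  rw [← differentiableOn_univ]
  exact (differentiableOn_dslope univ_mem).mpr differentiable_exp.differentiableOn

theorem hasDerivAt_mul_expSlope (c s : ℂ) :
    HasDerivAt (fun s => s * expSlope (c * s)) (exp (c * s)) s := by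
  obtain rfl | hc := eq_or_ne c 0
  · simpa [expSlope] using hasDerivAt_id' s
  · have heq : (fun s => s * expSlope (c * s)) = fun s => c⁻¹ * (exp (c * s) - 1) := by
      ext s
      rw [← mul_expSlope]
      field_simp
    rw [heq]
    refine ((((hasDerivAt_id' s).const_mul c).cexp.sub_const 1).const_mul c⁻¹).congr_deriv ?_
    field_simp

/-- The right-hand side of the equation `f' = expField a r q z s` that encodes local univalence.
Off the zeros of `q` it equals `a + r (exp (q² s) - 1) / q²`; it is written so as to be entire
in `s` also at these zeros. -/
def expField (a r q : ℂ → ℂ) (z s : ℂ) : ℂ := a z + r z * (s * expSlope (q z ^ 2 * s))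

variable {a r q s : ℂ → ℂ}

theorem expField_of_ne_zero (a r : ℂ → ℂ) {z : ℂ} (hz : q z ≠ 0) (s : ℂ) :
    expField a r q z s = a z + r z * ((exp (q z ^ 2 * s) - 1) / q z ^ 2) := by
  rw [expField, ← mul_expSlope]
  field_simp

theorem hasDerivAt_expField (a r q : ℂ → ℂ) (z s : ℂ) :
    HasDerivAt (expField a r q z) (r z * exp (q z ^ 2 * s)) s :=
  ((hasDerivAt_mul_expSlope (q z ^ 2) s).const_mul (r z)).const_add (a z)

theorem differentiableOn_expField {U : Set ℂ} (ha : DifferentiableOn ℂ a U)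
    (hr : DifferentiableOn ℂ r U) (hq : DifferentiableOn ℂ q U) (hs : DifferentiableOn ℂ s U) :
    DifferentiableOn ℂ (fun z => expField a r q z (s z)) U :=
  ha.add (hr.mul (hs.mul (differentiable_expSlope.comp_differentiableOn ((hq.pow 2).mul hs))))

end ExpField

section Superposition

variable {E : Type*} [TopologicalSpace E]

/-- The superposition (Nemytskii) operator `s ↦ θ (·, s ·)`. -/
def superposition (θ : C(E × ℂ, ℂ)) (s : C(E, ℂ)) : C(E, ℂ) :=
  θ.comp ((ContinuousMap.id E).prodMk s)

@[simp]
theorem superposition_apply (θ : C(E × ℂ, ℂ)) (s : C(E, ℂ)) (z : E) :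
    superposition θ s z = θ (z, s z) := rfl

variable [CompactSpace E]

theorem exists_forall_norm_sub_lt_norm_apply_sub_le (θ : C(E × ℂ, ℂ)) (s : C(E, ℂ)) {c : ℝ}
    (hc : 0 < c) : ∃ δ > 0, ∀ z x, ‖x - s z‖ < δ → ‖θ (z, x) - θ (z, s z)‖ ≤ c := by
  let F : C(ℂ, C(E, ℂ)) := ContinuousMap.curry ⟨fun p => θ (p.2, s p.2 + p.1), by fun_prop⟩
  have hF_apply (w : ℂ) (z : E) : F w z = θ (z, s z + w) := rfl
  obtain ⟨δ, hδ, hF⟩ := Metric.continuousAt_iff.mp (F.continuous.continuousAt (x := 0)) c hc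
  refine ⟨δ, hδ, fun z x hx => ?_⟩
  have hdist := (ContinuousMap.dist_apply_le_dist z).trans
    (hF (x := x - s z) (by simpa [dist_eq_norm] using hx)).le
  simpa [hF_apply, dist_eq_norm] using hdist

theorem hasStrictFDerivAt_superposition (θ θ' : C(E × ℂ, ℂ))
    (h : ∀ z x, HasDerivAt (fun x => θ (z, x)) (θ' (z, x)) x) (s : C(E, ℂ)) :
    HasStrictFDerivAt (superposition θ)
      (ContinuousLinearMap.mul ℂ C(E, ℂ) (superposition θ' s)) s := by
  rw [hasStrictFDerivAt_iff_isLittleO, Asymptotics.isLittleO_iff]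
  intro c hc
  obtain ⟨δ, hδ, hθ'⟩ := exists_forall_norm_sub_lt_norm_apply_sub_le θ' s hc
  filter_upwards [prod_mem_nhds (Metric.ball_mem_nhds s hδ) (Metric.ball_mem_nhds s hδ)]
    with p hp
  rw [ContinuousMap.norm_le _ (by positivity)]
  intro z
  have hball : ∀ g ∈ Metric.ball s δ, g z ∈ Metric.ball (s z) δ := fun g hg =>
    (ContinuousMap.dist_apply_le_dist z).trans_lt hg
  have hmvt := (convex_ball (s z) δ).norm_image_sub_le_of_norm_hasDerivWithin_le
    (f := fun x => θ (z, x) - θ' (z, s z) * x) (f' := fun x => θ' (z, x) - θ' (z, s z)) (C := c)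
    (fun x _ => ((h z x).sub
      (by simpa using (hasDerivAt_id x).const_mul (θ' (z, s z)))).hasDerivWithinAt)
    (fun x hx => hθ' z x (by simpa [dist_eq_norm] using hx)) (hball p.2 hp.2) (hball p.1 hp.1)
  calc
    _ = ‖θ (z, p.1 z) - θ' (z, s z) * p.1 z - (θ (z, p.2 z) - θ' (z, s z) * p.2 z)‖ := by
        congr 1
        simp only [ContinuousMap.sub_apply, superposition_apply, ContinuousLinearMap.mul_apply',
          ContinuousMap.mul_apply]
        ring
    _ ≤ c * ‖p.1 z - p.2 z‖ := hmvt
    _ ≤ c * ‖p.1 - p.2‖ := by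
        gcongr
        exact (p.1 - p.2).norm_coe_le_norm z

end Superposition

section SolveInDenseSubspace

variable {X Z : Type*} [NormedAddCommGroup X] [NormedSpace ℂ X] [NormedAddCommGroup Z]
  [NormedSpace ℂ Z] [FiniteDimensional ℂ Z] {V : Submodule ℂ X} {F : X → Z} {F' : X →L[ℂ] Z}
  {u : X}

theorem exists_continuousLinearMap_rightInverse_mem (h : V.map (F' : X →ₗ[ℂ] Z) = ⊤) :
    ∃ σ : Z →L[ℂ] X, (∀ y, σ y ∈ V) ∧ ∀ y, F' (σ y) = y := by
  obtain ⟨σ, hσ⟩ := LinearMap.exists_rightInverse_of_surjective ((F' : X →ₗ[ℂ] Z) ∘ₗ V.subtype)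
    (by rw [LinearMap.range_comp, Submodule.range_subtype, h])
  exact ⟨LinearMap.toContinuousLinearMap (V.subtype ∘ₗ σ), fun y => (σ y).2,
    LinearMap.congr_fun hσ⟩

theorem exists_continuousLinearMap_leftInverse_subtype (B : Submodule ℂ Z) :
    ∃ π : Z →L[ℂ] B, ∀ y : B, π y = y := by
  obtain ⟨π, hπ⟩ := LinearMap.exists_leftInverse_of_injective B.subtype (Submodule.ker_subtype B)
  exact ⟨LinearMap.toContinuousLinearMap π, LinearMap.congr_fun hπ⟩

variable [CompleteSpace X]

theorem exists_mem_apply_eq_zero_of_map_eq_top (hF : HasStrictFDerivAt F F' u)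
    (hu : u ∈ V.topologicalClosure) (hV : V.map (F' : X →ₗ[ℂ] Z) = ⊤) (h0 : F u = 0) {ε : ℝ}
    (hε : 0 < ε) : ∃ w ∈ V, ‖w - u‖ < ε ∧ F w = 0 := by
  obtain ⟨σ, hσV, hσ⟩ := exists_continuousLinearMap_rightInverse_mem hV
  let j : X × Z →L[ℂ] X :=
    ContinuousLinearMap.fst ℂ X Z + σ ∘L ContinuousLinearMap.snd ℂ X Z
  let Φ : X × Z → X × Z := fun p => (p.1, F (j p))
  have hj (x : X) (y : Z) : j (x, y) = x + σ y := rfl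
  have hΦ : HasStrictFDerivAt Φ ((ContinuousLinearMap.fst ℂ X Z).prod (F' ∘L j)) (u, 0) := by
    refine hasStrictFDerivAt_fst.prodMk (HasStrictFDerivAt.comp _ ?_ j.hasStrictFDerivAt)
    simpa [hj] using hF
  have hsurj : ((ContinuousLinearMap.fst ℂ X Z).prod (F' ∘L j)).range = ⊤ := by
    refine LinearMap.range_eq_top.mpr fun ⟨x, y⟩ => ⟨(x, y - F' x), Prod.ext rfl ?_⟩
    simp [hj, hσ]
  set S : Set (X × Z) := {p | ‖j p - u‖ < ε}
  have hmap : Φ '' S ∈ 𝓝 (u, (0 : Z)) := by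
    have hΦu : Φ (u, 0) = (u, 0) := by simp [Φ, hj, h0]
    rw [← hΦu, ← hΦ.map_nhds_eq_of_surj hsurj]
    exact image_mem_map ((isOpen_lt (by fun_prop) continuous_const).mem_nhds (by simpa [hj]))
  obtain ⟨v, ⟨⟨_, y⟩, hp, hpv⟩, hvV⟩ := mem_closure_iff_nhds.mp hu _
    ((Continuous.prodMk_left (0 : Z)).continuousAt.preimage_mem_nhds hmap)
  obtain ⟨rfl, hFv⟩ := Prod.mk.inj hpv
  exact ⟨_, V.add_mem hvV (hσV y), hp, hFv⟩

/-- Newton's method inside a dense subspace: finitely many equations solved by `u` are solved by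
some element of `V` near `u`, provided that `F` takes no values on `V` that the derivative cannot
reach from `V`. -/
theorem exists_mem_apply_eq_zero_of_hasStrictFDerivAt (hF : HasStrictFDerivAt F F' u)
    (hu : u ∈ V.topologicalClosure) (hFV : ∀ w ∈ V, F w ∈ V.map (F' : X →ₗ[ℂ] Z)) (h0 : F u = 0)
    {ε : ℝ} (hε : 0 < ε) : ∃ w ∈ V, ‖w - u‖ < ε ∧ F w = 0 := by
  obtain ⟨π, hπ⟩ := exists_continuousLinearMap_leftInverse_subtype (V.map (F' : X →ₗ[ℂ] Z))
  have hV : V.map ((π ∘L F' : X →L[ℂ] V.map (F' : X →ₗ[ℂ] Z)) :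
      X →ₗ[ℂ] V.map (F' : X →ₗ[ℂ] Z)) = ⊤ := by
    refine Submodule.eq_top_iff'.mpr fun ⟨y, v, hv, hvy⟩ => ⟨v, hv, ?_⟩
    subst hvy
    exact hπ ⟨F' v, v, hv, rfl⟩
  obtain ⟨w, hwV, hwu, hw⟩ := exists_mem_apply_eq_zero_of_map_eq_top
    (π.hasStrictFDerivAt.comp u hF) hu hV (by simp [h0]) hε
  have hFw : π (F w) = (⟨F w, hFV w hwV⟩ : V.map (F' : X →ₗ[ℂ] Z)) := hπ ⟨F w, hFV w hwV⟩
  rw [hFw, Submodule.mk_eq_zero] at hw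
  exact ⟨w, hwV, hwu, hw⟩

end SolveInDenseSubspace

section SolveInSubalgebra

variable {E : Type*} [TopologicalSpace E] [CompactSpace E] {A : Subalgebra ℂ C(E, ℂ)}
  {Y : Type*} [NormedAddCommGroup Y] [NormedSpace ℂ Y] [FiniteDimensional ℂ Y]

theorem apply_mem_map_mul {m m' : C(E, ℂ)} (hm' : m' ∈ A.topologicalClosure) (hmm : m * m' = 1)
    (Λ : C(E, ℂ) →L[ℂ] Y) {s : C(E, ℂ)} (hs : s ∈ A) :
    Λ s ∈ A.toSubmodule.map
      ((Λ ∘L ContinuousLinearMap.mul ℂ C(E, ℂ) m : C(E, ℂ) →L[ℂ] Y) : C(E, ℂ) →ₗ[ℂ] Y) := by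
  set Λm : C(E, ℂ) →L[ℂ] Y := Λ ∘L ContinuousLinearMap.mul ℂ C(E, ℂ) m with hΛm
  have hclosed : IsClosed (A.toSubmodule.map (Λm : C(E, ℂ) →ₗ[ℂ] Y) : Set Y) :=
    Submodule.closed_of_finiteDimensional _
  have hmem : m' * s ∈ closure (A : Set C(E, ℂ)) := mul_mem hm' (A.le_topologicalClosure hs)
  have hΛ : Λm (m' * s) = Λ s := by simp [hΛm, ← mul_assoc, hmm]
  rw [← hΛ]
  have hmaps : MapsTo Λm A (A.toSubmodule.map (Λm : C(E, ℂ) →ₗ[ℂ] Y)) := fun y hy => ⟨y, hy, rfl⟩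
  exact closure_minimal hmaps (hclosed.preimage Λm.continuous) hmem

theorem exists_mem_near_apply_mem {Θ : C(E, ℂ) → C(E, ℂ)}
    {m m' u : C(E, ℂ)} (hΘ : HasStrictFDerivAt Θ (ContinuousLinearMap.mul ℂ C(E, ℂ) m) u)
    (hΘA : ∀ w ∈ A, Θ w ∈ A) (hu : u ∈ A.topologicalClosure)
    (hm' : m' ∈ A.topologicalClosure) (hmm : m * m' = 1)
    (Λ : C(E, ℂ) →L[ℂ] Y) (N : Submodule ℂ Y) (h0 : Λ (Θ u) ∈ N) {ε : ℝ} (hε : 0 < ε) :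
    ∃ w ∈ A, ‖w - u‖ < ε ∧ Λ (Θ w) ∈ N := by
  let p : Y →L[ℂ] Fin (Module.finrank ℂ (Y ⧸ N)) → ℂ := LinearMap.toContinuousLinearMap
    ((Module.finBasis ℂ (Y ⧸ N)).equivFun.toLinearMap ∘ₗ N.mkQ)
  have hp (y : Y) : p y = 0 ↔ y ∈ N := by simp [p, Submodule.Quotient.mk_eq_zero]
  obtain ⟨w, hw, hwu, h⟩ := exists_mem_apply_eq_zero_of_hasStrictFDerivAt (V := A.toSubmodule)
    ((p ∘L Λ).hasStrictFDerivAt.comp u hΘ) hu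
    (fun w hw => apply_mem_map_mul hm' hmm (p ∘L Λ) (hΘA w hw)) ((hp _).mpr h0) hε
  exact ⟨w, hw, hwu, (hp _).mp h⟩

end SolveInSubalgebra

section PrescribedIntegral

theorem exists_continuous_interpolating_four (α β x y : ℂ) :
    ∃ u : ℝ → ℂ, Continuous u ∧ u 0 = α ∧ u 1 = β ∧ u (1 / 3) = x ∧ u (2 / 3) = y := by
  refine ⟨fun t => α * (1 - t) * (1 - 3 * t) * (1 - 3 / 2 * t) +
    β * t * (3 * t - 1) * (3 / 2 * t - 1) + x * (27 / 2) * (t * (1 - t) * (2 / 3 - t)) +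
    y * (27 / 2) * (t * (1 - t) * (t - 1 / 3)), by fun_prop, ?_, ?_, ?_, ?_⟩ <;>
  · push_cast
    ring

theorem exists_clm_pos_of_ne_zero {D : ℂ} (hD : D ≠ 0) :
    ∃ ℓ : ℂ →L[ℝ] ℝ, 0 < ℓ D ∧ (0 < ℓ 1 ∨ 0 < ℓ (-1)) := by
  rcases lt_or_ge D.re 0 with hre | hre
  · exact ⟨-reCLM, by simpa using hre, by simp⟩
  · refine ⟨reCLM + D.im • imCLM, ?_, by simp⟩
    simp only [add_apply, smul_apply, reCLM_apply,
      imCLM_apply, smul_eq_mul]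
    rcases hre.eq_or_lt with h | h
    · have him : D.im ≠ 0 := fun him => hD (Complex.ext h.symm him)
      have := mul_self_pos.mpr him
      linarith
    · nlinarith [mul_self_nonneg D.im]

theorem div_mem_slitPlane {ℓ : ℂ →L[ℝ] ℝ} {x y : ℂ} (hx : 0 < ℓ x) (hy : 0 < ℓ y) :
    x / y ∈ slitPlane := by
  by_contra h
  obtain ⟨t, ht, htxy⟩ : ∃ t : ℝ, t ≤ 0 ∧ x / y = t := by
    simp only [mem_slitPlane_iff, not_or, not_lt, not_not] at h
    exact ⟨(x / y).re, h.1, Complex.ext rfl (by simpa using h.2)⟩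
  have hy0 : y ≠ 0 := fun h => by simp [h] at hy
  have hxy : x = t • y := by rw [real_smul, ← htxy, div_mul_cancel₀ _ hy0]
  rw [hxy, map_smul, smul_eq_mul] at hx
  exact hx.not_ge (mul_nonpos_of_nonpos_of_nonneg ht hy.le)

theorem one_add_mul_ofReal_mem_slitPlane {c : ℂ} (hc : c ∈ slitPlane) {t : ℝ} (ht : 0 ≤ t) :
    1 + c * t ∈ slitPlane := by
  rw [mem_slitPlane_iff] at hc ⊢
  rcases hc with h | h
  · left
    simp only [add_re, one_re, re_mul_ofReal]
    positivity
  · rcases ht.eq_or_lt with rfl | ht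
    · simp
    · right
      simpa using ⟨h, ht.ne'⟩

theorem exists_nonneg_apply_integral_pos {g : ℝ → ℂ} (hg : Continuous g) {ℓ : ℂ →L[ℝ] ℝ}
    {t₀ : ℝ} (ht₀ : t₀ ∈ Ioo (0 : ℝ) 1) (hℓ : 0 < ℓ (g t₀)) :
    ∃ k : ℝ → ℝ, Continuous k ∧ (∀ t, 0 ≤ k t) ∧ k 0 = 0 ∧ k 1 = 0 ∧
      0 < ℓ (∫ t in (0 : ℝ)..1, g t * k t) := by
  set k : ℝ → ℝ := fun t => max 0 (t * (1 - t)) * max 0 (ℓ (g t)) with hk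
  have hkc : Continuous k := by fun_prop
  have hk0 (t : ℝ) : 0 ≤ k t := mul_nonneg (le_max_left _ _) (le_max_left _ _)
  refine ⟨k, hkc, hk0, by simp [hk], by simp [hk], ?_⟩
  have hgk (t : ℝ) : ℓ (g t * k t) = k t * ℓ (g t) := by
    rw [mul_comm, ← real_smul, map_smul, smul_eq_mul]
  rw [← ℓ.intervalIntegral_comp_comm (Continuous.intervalIntegrable (by fun_prop) _ _)]
  simp only [hgk]
  have hcont : Continuous fun t => k t * ℓ (g t) := by fun_prop
  refine intervalIntegral.integral_pos zero_lt_one hcont.continuousOn (fun t _ => ?_)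
    ⟨t₀, Ioo_subset_Icc_self ht₀, ?_⟩
  · rcases le_total (ℓ (g t)) 0 with h | h
    · simp [hk, h]
    · exact mul_nonneg (hk0 t) h
  · have : 0 < t₀ * (1 - t₀) := mul_pos ht₀.1 (sub_pos.mpr ht₀.2)
    simp only [hk]
    positivity

theorem exists_continuous_slitPlane_integral_mul_eq {g : ℝ → ℂ} (hg : Continuous g) {t₁ t₂ : ℝ}
    (ht₁ : t₁ ∈ Ioo (0 : ℝ) 1) (ht₂ : t₂ ∈ Ioo (0 : ℝ) 1) (hg₁ : g t₁ = 1) (hg₂ : g t₂ = -1)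
    (τ : ℂ) : ∃ κ : ℝ → ℂ, Continuous κ ∧ (∀ t, κ t ∈ slitPlane) ∧ κ 0 = 1 ∧ κ 1 = 1 ∧
      ∫ t in (0 : ℝ)..1, g t * κ t = τ := by
  set D : ℂ := τ - ∫ t in (0 : ℝ)..1, g t with hD
  obtain hD0 | hD0 := eq_or_ne D 0
  · exact ⟨fun _ => 1, continuous_const, fun _ => one_mem_slitPlane, rfl, rfl, by
      simpa using (sub_eq_zero.mp hD0).symm⟩
  obtain ⟨ℓ, hℓD, hℓ⟩ := exists_clm_pos_of_ne_zero hD0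
  obtain ⟨t₀, ht₀, hℓg⟩ : ∃ t₀ ∈ Ioo (0 : ℝ) 1, 0 < ℓ (g t₀) :=
    hℓ.elim (fun h => ⟨t₁, ht₁, hg₁ ▸ h⟩) fun h => ⟨t₂, ht₂, hg₂ ▸ h⟩
  obtain ⟨k, hk, hk0, hk₀, hk₁, hJ⟩ := exists_nonneg_apply_integral_pos hg ht₀ hℓg
  set J : ℂ := ∫ t in (0 : ℝ)..1, g t * k t with hJ_def
  have hJ0 : J ≠ 0 := fun h => by simp [h] at hJ
  refine ⟨fun t => 1 + D / J * k t, by fun_prop,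
    fun t => one_add_mul_ofReal_mem_slitPlane (div_mem_slitPlane hℓD hJ) (hk0 t),
    by simp [hk₀], by simp [hk₁], ?_⟩
  have hexpand (t : ℝ) : g t * (1 + D / J * k t) = g t + D / J * (g t * k t) := by ring
  simp only [hexpand]
  rw [intervalIntegral.integral_add (hg.intervalIntegrable _ _)
    (Continuous.intervalIntegrable (by fun_prop) _ _), intervalIntegral.integral_const_mul,
    ← hJ_def, div_mul_cancel₀ _ hJ0, hD, add_sub_cancel]

theorem exists_continuous_integral_mul_exp_of_continuous {ρ : ℝ → ℂ} (hρ : Continuous ρ)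
    (h₁ : ρ (1 / 3) ≠ 0) (h₂ : ρ (2 / 3) ≠ 0) (α β τ : ℂ) :
    ∃ u : ℝ → ℂ, Continuous u ∧ u 0 = α ∧ u 1 = β ∧ ∫ t in (0 : ℝ)..1, ρ t * exp (u t) = τ := by
  obtain ⟨u, hu, hu0, hu1, hu₁, hu₂⟩ := exists_continuous_interpolating_four α β
    (log (ρ (1 / 3))⁻¹) (log (-(ρ (2 / 3))⁻¹))
  obtain ⟨κ, hκ, hκs, hκ0, hκ1, hint⟩ := exists_continuous_slitPlane_integral_mul_eq
    (g := fun t => ρ t * exp (u t)) (by fun_prop) (t₁ := 1 / 3) (t₂ := 2 / 3)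
    ⟨by norm_num, by norm_num⟩ ⟨by norm_num, by norm_num⟩
    (by rw [hu₁, exp_log (inv_ne_zero h₁), mul_inv_cancel₀ h₁])
    (by rw [hu₂, exp_log (neg_ne_zero.mpr (inv_ne_zero h₂)), mul_neg, mul_inv_cancel₀ h₂]) τ
  refine ⟨fun t => u t + log (κ t), hu.add (hκ.clog hκs), by simp [hu0, hκ0],
    by simp [hu1, hκ1], ?_⟩
  rw [← hint]
  congr 1 with t
  rw [exp_add, exp_log (slitPlane_ne_zero (hκs t)), mul_assoc]

theorem exists_continuous_integral_mul_exp {ρ : ℝ → ℂ} (hρ : ContinuousOn ρ (Icc 0 1))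
    (hρ0 : ∀ t ∈ Icc (0 : ℝ) 1, ρ t ≠ 0) (α β τ : ℂ) :
    ∃ u : ℝ → ℂ, Continuous u ∧ u 0 = α ∧ u 1 = β ∧ ∫ t in (0 : ℝ)..1, ρ t * exp (u t) = τ := by
  have hext : EqOn (IccExtend zero_le_one ((Icc 0 1).domRestrict ρ)) ρ (Icc 0 1) := fun t ht =>
    IccExtend_of_mem _ _ ht
  have hne : ∀ t ∈ Icc (0 : ℝ) 1, IccExtend zero_le_one ((Icc 0 1).domRestrict ρ) t ≠ 0 :=
    fun t ht => by rw [hext ht]; exact hρ0 t ht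
  obtain ⟨u, hu, hu0, hu1, hint⟩ := exists_continuous_integral_mul_exp_of_continuous
    hρ.domRestrict.Icc_extend' (hne _ ⟨by norm_num, by norm_num⟩)
    (hne _ ⟨by norm_num, by norm_num⟩) α β τ
  refine ⟨u, hu, hu0, hu1, ?_⟩
  rw [← hint]
  refine intervalIntegral.integral_congr fun t ht => ?_
  rw [uIcc_of_le zero_le_one] at ht
  exact congrArg (· * exp (u t)) (hext ht).symm

end PrescribedIntegral

section SegmentIntegral

open AffineMap

/-- The integral of `h` along the segment from `a` to `b`. -/
def segmentIntegral (h : ℂ → ℂ) (a b : ℂ) : ℂ :=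
  ∫ t in (0 : ℝ)..1, (b - a) * h (lineMap a b t)

theorem isCompact_segment (a b : ℂ) : IsCompact (segment ℝ a b) := by
  rw [segment_eq_image_lineMap]
  exact isCompact_Icc.image lineMap_continuous

theorem lineMap_mem_segment {a b : ℂ} {t : ℝ} (ht : t ∈ uIcc (0 : ℝ) 1) :
    lineMap a b t ∈ segment ℝ a b := by
  rw [uIcc_of_le zero_le_one] at ht
  exact segment_eq_image_lineMap ℝ a b ▸ mem_image_of_mem _ ht

theorem continuousOn_comp_lineMap {X : Type*} [TopologicalSpace X] {h : ℂ → X} {a b : ℂ}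
    (hh : ContinuousOn h (segment ℝ a b)) :
    ContinuousOn (fun t : ℝ => h (lineMap a b t)) (uIcc 0 1) :=
  hh.comp lineMap_continuous.continuousOn fun _ => lineMap_mem_segment

theorem segmentIntegral_congr {h₁ h₂ : ℂ → ℂ} {a b : ℂ} (h : EqOn h₁ h₂ (segment ℝ a b)) :
    segmentIntegral h₁ a b = segmentIntegral h₂ a b :=
  intervalIntegral.integral_congr fun t ht => by simp only [h (lineMap_mem_segment ht)]

theorem segmentIntegral_add {h₁ h₂ : ℂ → ℂ} {a b : ℂ} (hh₁ : ContinuousOn h₁ (segment ℝ a b))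
    (hh₂ : ContinuousOn h₂ (segment ℝ a b)) :
    segmentIntegral (fun z => h₁ z + h₂ z) a b =
      segmentIntegral h₁ a b + segmentIntegral h₂ a b := by
  simp only [segmentIntegral, mul_add]
  exact intervalIntegral.integral_add
    (continuousOn_const.mul (continuousOn_comp_lineMap hh₁)).intervalIntegrable
    (continuousOn_const.mul (continuousOn_comp_lineMap hh₂)).intervalIntegrable

theorem segmentIntegral_eq_sub {f h : ℂ → ℂ} {a b : ℂ}
    (hf : ∀ z ∈ segment ℝ a b, HasDerivAt f (h z) z) (hh : ContinuousOn h (segment ℝ a b)) :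
    segmentIntegral h a b = f b - f a := by
  have hderiv : ∀ t ∈ uIcc (0 : ℝ) 1,
      HasDerivAt (fun t : ℝ => f (lineMap a b t)) ((b - a) * h (lineMap a b t)) t := fun t ht =>
    (hf _ (lineMap_mem_segment ht)).scomp t hasDerivAt_lineMap
  rw [segmentIntegral, intervalIntegral.integral_eq_sub_of_hasDerivAt hderiv
    (continuousOn_const.mul (continuousOn_comp_lineMap hh)).intervalIntegrable, lineMap_apply_one,
    lineMap_apply_zero]

variable {a r q : ℂ → ℂ} {x y : ℂ}

theorem exists_continuous_segmentIntegral_mul_exp (hxy : x ≠ y) {ρ : ℂ → ℂ}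
    (hρ : ContinuousOn ρ (segment ℝ x y)) (hρ0 : ∀ z ∈ segment ℝ x y, ρ z ≠ 0) (α β τ : ℂ) :
    ∃ w : ℂ → ℂ, Continuous w ∧ w x = α ∧ w y = β ∧
      segmentIntegral (fun z => ρ z * exp (w z)) x y = τ := by
  have hyx : y - x ≠ 0 := sub_ne_zero.mpr hxy.symm
  have hI : uIcc (0 : ℝ) 1 = Icc 0 1 := uIcc_of_le zero_le_one
  obtain ⟨u, hu, hu0, hu1, hint⟩ := exists_continuous_integral_mul_exp
    (ρ := fun t => (y - x) * ρ (lineMap x y t))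
    (hI ▸ continuousOn_const.mul (continuousOn_comp_lineMap hρ))
    (fun t ht => mul_ne_zero hyx (hρ0 _ (lineMap_mem_segment (hI ▸ ht)))) α β τ
  refine ⟨fun z => u ((z - x) / (y - x)).re, by fun_prop, by simp [hu0],
    by simp [hu1, div_self hyx], ?_⟩
  have hparam (t : ℝ) : ((lineMap x y t - x) / (y - x)).re = t := by
    rw [lineMap_apply, vsub_eq_sub, vadd_eq_add, real_smul, add_sub_cancel_right,
      mul_div_cancel_right₀ _ hyx, ofReal_re]
  simp only [segmentIntegral, hparam, ← hint, mul_assoc]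

theorem segmentIntegral_expField_div (ha : ContinuousOn a (segment ℝ x y))
    (hr : ContinuousOn r (segment ℝ x y)) (hq : ContinuousOn q (segment ℝ x y))
    (hq0 : ∀ z ∈ segment ℝ x y, q z ≠ 0) {w : ℂ → ℂ} (hw : ContinuousOn w (segment ℝ x y)) :
    segmentIntegral (fun z => expField a r q z (w z / q z ^ 2)) x y =
      segmentIntegral (fun z => a z - r z / q z ^ 2) x y +
        segmentIntegral (fun z => r z / q z ^ 2 * exp (w z)) x y := by
  have hrq : ContinuousOn (fun z => r z / q z ^ 2) (segment ℝ x y) :=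
    hr.div (hq.pow 2) fun z hz => pow_ne_zero 2 (hq0 z hz)
  have hsum : EqOn (fun z => expField a r q z (w z / q z ^ 2))
      (fun z => a z - r z / q z ^ 2 + r z / q z ^ 2 * exp (w z)) (segment ℝ x y) := fun z hz => by
    simp only [expField_of_ne_zero _ _ (hq0 z hz)]
    rw [mul_div_cancel₀ _ (pow_ne_zero 2 (hq0 z hz))]
    ring
  rw [segmentIntegral_congr hsum]
  exact segmentIntegral_add (ha.sub hrq) (hrq.mul hw.cexp)

theorem exists_continuousOn_segmentIntegral_expField_eq (hxy : x ≠ y)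
    (ha : ContinuousOn a (segment ℝ x y)) (hr : ContinuousOn r (segment ℝ x y))
    (hq : ContinuousOn q (segment ℝ x y)) (hr0 : ∀ z ∈ segment ℝ x y, r z ≠ 0)
    (hq0 : ∀ z ∈ segment ℝ x y, q z ≠ 0) (α β τ : ℂ) :
    ∃ s : ℂ → ℂ, ContinuousOn s (segment ℝ x y) ∧ s x = α ∧ s y = β ∧
      segmentIntegral (fun z => expField a r q z (s z)) x y = τ := by
  have hq2 : ∀ z ∈ segment ℝ x y, q z ^ 2 ≠ 0 := fun z hz => pow_ne_zero 2 (hq0 z hz)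
  obtain ⟨w, hw, hwx, hwy, hint⟩ := exists_continuous_segmentIntegral_mul_exp hxy
    (ρ := fun z => r z / q z ^ 2) (hr.div (hq.pow 2) hq2)
    (fun z hz => div_ne_zero (hr0 z hz) (hq2 z hz))
    (q x ^ 2 * α) (q y ^ 2 * β) (τ - segmentIntegral (fun z => a z - r z / q z ^ 2) x y)
  refine ⟨fun z => w z / q z ^ 2, hw.continuousOn.div (hq.pow 2) hq2, ?_, ?_, ?_⟩
  · simp only [hwx, mul_div_cancel_left₀ _ (hq2 x (left_mem_segment ℝ x y))]
  · simp only [hwy, mul_div_cancel_left₀ _ (hq2 y (right_mem_segment ℝ x y))]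
  · rw [segmentIntegral_expField_div ha hr hq hq0 hw.continuousOn, hint, add_sub_cancel]

theorem exists_continuousOn_union_eqOn {X Y : Type*} [TopologicalSpace X] [TopologicalSpace Y]
    {A B : Set X} {f g : X → Y} (hA : IsClosed A) (hB : IsClosed B) (hf : ContinuousOn f A)
    (hg : ContinuousOn g B) (hfg : EqOn f g (A ∩ B)) :
    ∃ h : X → Y, ContinuousOn h (A ∪ B) ∧ EqOn h f A ∧ EqOn h g B := by
  classical
  have hfA : EqOn (A.piecewise f g) f A := A.piecewise_eqOn f g
  have hgB : EqOn (A.piecewise f g) g B := fun z hz => by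
    by_cases hzA : z ∈ A
    · exact (hfA hzA).trans (hfg ⟨hzA, hz⟩)
    · exact A.piecewise_eq_of_notMem f g hzA
  exact ⟨_, (hf.congr hfA).union_of_isClosed (hg.congr hgB) hA hB, hfA, hgB⟩

theorem exists_continuousOn_union_segment {E : Set ℂ} (hE : IsClosed E) {s : ℂ → ℂ}
    (hs : ContinuousOn s E) (hxy : x ≠ y) (hEs : ∀ z ∈ E ∩ segment ℝ x y, z = x ∨ z = y)
    (ha : ContinuousOn a (segment ℝ x y)) (hr : ContinuousOn r (segment ℝ x y))
    (hq : ContinuousOn q (segment ℝ x y)) (hr0 : ∀ z ∈ segment ℝ x y, r z ≠ 0)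
    (hq0 : ∀ z ∈ segment ℝ x y, q z ≠ 0) (τ : ℂ) :
    ∃ s' : ℂ → ℂ, ContinuousOn s' (E ∪ segment ℝ x y) ∧ EqOn s' s E ∧
      segmentIntegral (fun z => expField a r q z (s' z)) x y = τ := by
  obtain ⟨e, he, hex, hey, hint⟩ :=
    exists_continuousOn_segmentIntegral_expField_eq hxy ha hr hq hr0 hq0 (s x) (s y) τ
  have hse : EqOn s e (E ∩ segment ℝ x y) := fun z hz => by
    rcases hEs z hz with rfl | rfl
    exacts [hex.symm, hey.symm]
  obtain ⟨s', hs', hs'E, hs'e⟩ :=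
    exists_continuousOn_union_eqOn hE (isCompact_segment x y).isClosed hs he hse
  refine ⟨s', hs', hs'E, ?_⟩
  rw [← hint]
  exact segmentIntegral_congr fun z hz => by simp only [hs'e hz]

end SegmentIntegral

section Grid

/-- The closed square of side `1` in the integer grid whose lower left corner is `S`. -/
def gridSquare (S : ℤ × ℤ) : Set ℂ := Icc (S.1 : ℝ) (S.1 + 1) ×ℂ Icc (S.2 : ℝ) (S.2 + 1)

/-- The interior of `gridSquare S`. -/
def openGridSquare (S : ℤ × ℤ) : Set ℂ := Ioo (S.1 : ℝ) (S.1 + 1) ×ℂ Ioo (S.2 : ℝ) (S.2 + 1)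

/-- The centre of `gridSquare S`. -/
def gridCenter (S : ℤ × ℤ) : ℂ := ⟨S.1 + 1 / 2, S.2 + 1 / 2⟩

/-- A lattice point, as a complex number. -/
def gridPoint (v : ℤ × ℤ) : ℂ := ⟨v.1, v.2⟩

/-- The corners of a square, relative to the lower left one, in counterclockwise order. -/
def cornerOffset : Fin 4 → ℤ × ℤ := ![(0, 0), (1, 0), (1, 1), (0, 1)]

/-- The neighbour of a square across its side number `k`, relative to the square; side `k` runs
from corner `k` to corner `k + 1`. -/
def nbrOffset : Fin 4 → ℤ × ℤ := ![(0, -1), (1, 0), (0, 1), (-1, 0)]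

/-- Corner number `k` of `gridSquare S`. -/
def gridCorner (S : ℤ × ℤ) (k : Fin 4) : ℂ := gridPoint (S + cornerOffset k)

/-- Side number `k` of `gridSquare S`. -/
def gridSide (S : ℤ × ℤ) (k : Fin 4) : Set ℂ := segment ℝ (gridCorner S k) (gridCorner S (k + 1))

/-- A disc around `gridSquare S` that does not contain the centres of the other squares. -/
def gridDisc (S : ℤ × ℤ) : Set ℂ := Metric.ball (gridCenter S) (3 / 4)

/-- The union of a finite family of grid squares. -/
def gridRegion (Q : Finset (ℤ × ℤ)) : Set ℂ := ⋃ S ∈ Q, gridSquare S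

variable {S T v : ℤ × ℤ} {j k : Fin 4} {z w : ℂ} {Q : Finset (ℤ × ℤ)}

theorem mem_gridSquare :
    z ∈ gridSquare S ↔ (S.1 ≤ z.re ∧ z.re ≤ S.1 + 1) ∧ (S.2 ≤ z.im ∧ z.im ≤ S.2 + 1) := Iff.rfl

theorem mem_openGridSquare :
    z ∈ openGridSquare S ↔ (S.1 < z.re ∧ z.re < S.1 + 1) ∧ (S.2 < z.im ∧ z.im < S.2 + 1) :=
  Iff.rfl

theorem mem_gridRegion : z ∈ gridRegion Q ↔ ∃ S ∈ Q, z ∈ gridSquare S := by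
  simp [gridRegion]

theorem eq_gridCorner_iff : z = gridCorner S k ↔
    z.re = S.1 + (cornerOffset k).1 ∧ z.im = S.2 + (cornerOffset k).2 := by
  simp [Complex.ext_iff, gridCorner, gridPoint]

theorem convex_gridSquare (S : ℤ × ℤ) : Convex ℝ (gridSquare S) :=
  ((convex_Icc _ _).linear_preimage reLm).inter ((convex_Icc _ _).linear_preimage imLm)

theorem isCompact_gridSquare (S : ℤ × ℤ) : IsCompact (gridSquare S) :=
  isCompact_Icc.reProdIm isCompact_Icc

theorem isCompact_gridRegion (Q : Finset (ℤ × ℤ)) : IsCompact (gridRegion Q) :=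
  Q.isCompact_biUnion fun S _ => isCompact_gridSquare S

theorem mem_gridSquare_floor (z : ℂ) : z ∈ gridSquare (⌊z.re⌋, ⌊z.im⌋) :=
  ⟨⟨Int.floor_le _, (Int.lt_floor_add_one _).le⟩, ⟨Int.floor_le _, (Int.lt_floor_add_one _).le⟩⟩

theorem norm_sub_le_two_of_mem_gridSquare (hz : z ∈ gridSquare S) (hw : w ∈ gridSquare S) :
    ‖z - w‖ ≤ 2 := by
  obtain ⟨⟨_, _⟩, _, _⟩ := mem_gridSquare.mp hz
  obtain ⟨⟨_, _⟩, _, _⟩ := mem_gridSquare.mp hw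
  have hre : |(z - w).re| ≤ 1 := abs_le.mpr ⟨by rw [sub_re]; linarith, by rw [sub_re]; linarith⟩
  have him : |(z - w).im| ≤ 1 := abs_le.mpr ⟨by rw [sub_im]; linarith, by rw [sub_im]; linarith⟩
  linarith [norm_le_abs_re_add_abs_im (z - w)]

theorem gridSquare_subset_gridDisc (S : ℤ × ℤ) : gridSquare S ⊆ gridDisc S := by
  intro z hz
  obtain ⟨⟨_, _⟩, _, _⟩ := mem_gridSquare.mp hz
  rw [gridDisc, Metric.mem_ball, dist_eq_norm]
  refine lt_of_pow_lt_pow_left₀ 2 (by norm_num) ?_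
  rw [Complex.sq_norm, normSq_apply, sub_re, sub_im]
  simp only [gridCenter]
  nlinarith

theorem gridPoint_mem_gridSquare : gridPoint v ∈ gridSquare S ↔
    (S.1 ≤ v.1 ∧ v.1 ≤ S.1 + 1) ∧ (S.2 ≤ v.2 ∧ v.2 ≤ S.2 + 1) := by
  simp only [mem_gridSquare, gridPoint]
  norm_cast

theorem gridCorner_mem_gridSquare (S : ℤ × ℤ) (k : Fin 4) : gridCorner S k ∈ gridSquare S := by
  rw [gridCorner, gridPoint_mem_gridSquare]
  fin_cases k <;> simp [cornerOffset]

theorem exists_eq_cornerOffset_of_mem_gridSquare (h : gridPoint v ∈ gridSquare S) :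
    ∃ k, v = S + cornerOffset k := by
  rw [gridPoint_mem_gridSquare] at h
  obtain h₁ | h₁ : v.1 = S.1 ∨ v.1 = S.1 + 1 := by lia
  all_goals obtain h₂ | h₂ : v.2 = S.2 ∨ v.2 = S.2 + 1 := by lia
  · exact ⟨0, Prod.ext (by simp [cornerOffset, h₁]) (by simp [cornerOffset, h₂])⟩
  · exact ⟨3, Prod.ext (by simp [cornerOffset, h₁]) (by simp [cornerOffset, h₂])⟩
  · exact ⟨1, Prod.ext (by simp [cornerOffset, h₁]) (by simp [cornerOffset, h₂])⟩
  · exact ⟨2, Prod.ext (by simp [cornerOffset, h₁]) (by simp [cornerOffset, h₂])⟩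

theorem gridSide_subset_gridSquare (S : ℤ × ℤ) (k : Fin 4) : gridSide S k ⊆ gridSquare S :=
  (convex_gridSquare S).segment_subset (gridCorner_mem_gridSquare S k)
    (gridCorner_mem_gridSquare S (k + 1))

theorem gridSide_subset_gridSquare_nbr (S : ℤ × ℤ) (k : Fin 4) :
    gridSide S k ⊆ gridSquare (S + nbrOffset k) := by
  refine (convex_gridSquare _).segment_subset ?_ ?_ <;>
  · rw [gridCorner, gridPoint_mem_gridSquare]
    fin_cases k <;> simp [cornerOffset, nbrOffset]

theorem gridCorner_ne_succ (S : ℤ × ℤ) (k : Fin 4) : gridCorner S k ≠ gridCorner S (k + 1) := by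
  rw [Ne, eq_gridCorner_iff]
  fin_cases k <;> simp [gridCorner, gridPoint, cornerOffset]

theorem eq_of_mem_openGridSquare (hS : z ∈ openGridSquare S) (hT : z ∈ gridSquare T) : T = S := by
  obtain ⟨⟨_, _⟩, _, _⟩ := mem_openGridSquare.mp hS
  obtain ⟨⟨_, _⟩, _, _⟩ := mem_gridSquare.mp hT
  have h₁ : (S.1 : ℝ) < T.1 + 1 := by linarith
  have h₂ : (T.1 : ℝ) < S.1 + 1 := by linarith
  have h₃ : (S.2 : ℝ) < T.2 + 1 := by linarith
  have h₄ : (T.2 : ℝ) < S.2 + 1 := by linarith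
  norm_cast at h₁ h₂ h₃ h₄
  exact Prod.ext (by lia) (by lia)

theorem re_eq_or_im_eq_of_mem_gridSide (h : z ∈ gridSide S k) :
    (k = 0 ∧ z.im = S.2) ∨ (k = 1 ∧ z.re = S.1 + 1) ∨ (k = 2 ∧ z.im = S.2 + 1) ∨
      (k = 3 ∧ z.re = S.1) := by
  rw [gridSide, segment_eq_image_lineMap] at h
  obtain ⟨t, -, rfl⟩ := h
  fin_cases k <;> simp [AffineMap.lineMap_apply, gridCorner, gridPoint, cornerOffset]

theorem notMem_gridSide_of_mem_openGridSquare (hS : z ∈ openGridSquare S) : z ∉ gridSide T k := by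
  intro h
  obtain rfl := eq_of_mem_openGridSquare hS (gridSide_subset_gridSquare _ _ h)
  obtain ⟨⟨_, _⟩, _, _⟩ := mem_openGridSquare.mp hS
  rcases re_eq_or_im_eq_of_mem_gridSide h with ⟨-, h⟩ | ⟨-, h⟩ | ⟨-, h⟩ | ⟨-, h⟩ <;> linarith

theorem volume_gridSide (S : ℤ × ℤ) (k : Fin 4) : volume (gridSide S k) = 0 := by
  refine measure_mono_null (fun z hz => ?_) ((convex_gridSquare S).addHaar_frontier volume)
  refine ⟨subset_closure (gridSide_subset_gridSquare S k hz), fun hi => ?_⟩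
  rw [gridSquare, interior_reProdIm, interior_Icc, interior_Icc] at hi
  exact notMem_gridSide_of_mem_openGridSquare (S := S) hi hz

theorem eq_or_eq_sub_one_or_eq_add_one_of_mem_Icc {x : ℝ} {m n : ℤ}
    (hm : x ∈ Icc (m : ℝ) (m + 1)) (hn : x ∈ Icc (n : ℝ) (n + 1)) :
    n = m ∨ (n = m - 1 ∧ x = m) ∨ (n = m + 1 ∧ x = m + 1) := by
  have hmn : (m : ℝ) ≤ n + 1 := hm.1.trans hn.2
  have hnm : (n : ℝ) ≤ m + 1 := hn.1.trans hm.2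
  norm_cast at hmn hnm
  obtain rfl | rfl | rfl : n = m ∨ n = m - 1 ∨ n = m + 1 := by lia
  · exact Or.inl rfl
  · refine Or.inr (Or.inl ⟨rfl, le_antisymm ?_ hm.1⟩)
    simpa using hn.2
  · refine Or.inr (Or.inr ⟨rfl, le_antisymm hm.2 ?_⟩)
    simpa using hn.1

theorem eq_gridCorner_of_mem_gridSide_of_mem_gridSquare (h : z ∈ gridSide S k)
    (hT : z ∈ gridSquare T) (hTS : T ≠ S) (hTk : T ≠ S + nbrOffset k) :
    z = gridCorner S k ∨ z = gridCorner S (k + 1) := by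
  have hz := gridSide_subset_gridSquare S k h
  have hside := re_eq_or_im_eq_of_mem_gridSide h
  have hre := eq_or_eq_sub_one_or_eq_add_one_of_mem_Icc hz.1 hT.1
  have him := eq_or_eq_sub_one_or_eq_add_one_of_mem_Icc hz.2 hT.2
  have hne₁ : (S.1 : ℝ) ≠ S.1 + 1 := by norm_num
  have hne₂ : (S.2 : ℝ) ≠ S.2 + 1 := by norm_num
  rw [Ne, Prod.ext_iff] at hTS hTk
  rw [eq_gridCorner_iff, eq_gridCorner_iff]
  fin_cases k <;> simp [cornerOffset, nbrOffset] at hside hTk ⊢ <;> grind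

theorem eq_gridCorner_of_mem_gridSide_of_mem_gridSide (hjk : j ≠ k) (hj : z ∈ gridSide S j)
    (hk : z ∈ gridSide S k) : z = gridCorner S k ∨ z = gridCorner S (k + 1) := by
  obtain ⟨⟨_, _⟩, _, _⟩ := mem_gridSquare.mp (gridSide_subset_gridSquare S k hk)
  have hsj := re_eq_or_im_eq_of_mem_gridSide hj
  have hsk := re_eq_or_im_eq_of_mem_gridSide hk
  have : (S.1 : ℝ) ≠ S.1 + 1 := by norm_num
  have : (S.2 : ℝ) ≠ S.2 + 1 := by norm_num
  rw [eq_gridCorner_iff, eq_gridCorner_iff]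
  fin_cases j <;> fin_cases k <;> simp [cornerOffset] at hjk hsj hsk ⊢ <;> grind

theorem abs_sub_lt_of_dist_gridCenter_lt {c : ℝ} (h : dist (gridCenter S) (gridCenter T) < c) :
    |(S.1 : ℝ) - T.1| < c ∧ |(S.2 : ℝ) - T.2| < c := by
  rw [dist_eq_norm] at h
  have hre := (abs_re_le_norm (gridCenter S - gridCenter T)).trans_lt h
  have him := (abs_im_le_norm (gridCenter S - gridCenter T)).trans_lt h
  simpa [gridCenter] using And.intro hre him

theorem exists_gridPoint_mem_of_gridDisc_inter_nonempty (h : (gridDisc S ∩ gridDisc T).Nonempty) :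
    ∃ v : ℤ × ℤ, gridPoint v ∈ gridSquare S ∧ gridPoint v ∈ gridSquare T := by
  obtain ⟨z, hS, hT⟩ := h
  have hd : dist (gridCenter S) (gridCenter T) < 2 := by
    rw [gridDisc, Metric.mem_ball] at hS hT
    linarith [dist_triangle_left (gridCenter S) (gridCenter T) z]
  obtain ⟨h₁, h₂⟩ := abs_sub_lt_of_dist_gridCenter_lt hd
  norm_cast at h₁ h₂
  rw [abs_lt] at h₁ h₂
  refine ⟨(max S.1 T.1, max S.2 T.2), gridPoint_mem_gridSquare.mpr ?_,
    gridPoint_mem_gridSquare.mpr ?_⟩ <;> simp only <;> omega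

theorem gridCenter_notMem_gridDisc (h : T ≠ S) : gridCenter T ∉ gridDisc S := by
  intro hm
  obtain ⟨h₁, h₂⟩ := abs_sub_lt_of_dist_gridCenter_lt ((Metric.mem_ball.mp hm).trans
    (by norm_num : (3 / 4 : ℝ) < 1))
  norm_cast at h₁ h₂
  rw [Int.abs_lt_one_iff] at h₁ h₂
  exact h (Prod.ext (by lia) (by lia))

end Grid

section Keyhole

open AffineMap

/-- The squares of `Q` together with the three sides of the square `S` other than side `k₀`. -/
def keyhole (Q : Finset (ℤ × ℤ)) (S : ℤ × ℤ) (k₀ : Fin 4) : Set ℂ :=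
  gridRegion Q ∪ ⋃ k ∈ (Finset.univ.erase k₀ : Finset (Fin 4)), gridSide S k

variable {Q : Finset (ℤ × ℤ)} {S T : ℤ × ℤ} {k k₀ : Fin 4} {z : ℂ}

theorem isCompact_keyhole (Q : Finset (ℤ × ℤ)) (S : ℤ × ℤ) (k₀ : Fin 4) :
    IsCompact (keyhole Q S k₀) :=
  (isCompact_gridRegion Q).union (Finset.isCompact_biUnion _ fun _ _ => isCompact_segment _ _)

theorem mem_keyhole : z ∈ keyhole Q S k₀ ↔
    (∃ T ∈ Q, z ∈ gridSquare T) ∨ ∃ k, k ≠ k₀ ∧ z ∈ gridSide S k := by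
  simp [keyhole, mem_gridRegion]

theorem notMem_keyhole_of_mem_openGridSquare (h : z ∈ openGridSquare T) (hT : T ∉ Q) :
    z ∉ keyhole Q S k₀ := by
  rw [mem_keyhole]
  rintro (⟨T', hT', hz⟩ | ⟨k, -, hz⟩)
  · exact hT (eq_of_mem_openGridSquare h hz ▸ hT')
  · exact notMem_gridSide_of_mem_openGridSquare h hz

theorem lineMap_gridCenter_mem_openGridSquare (hz : z ∈ gridSquare S) {t : ℝ} (ht : 0 < t)
    (ht₁ : t ≤ 1) : lineMap z (gridCenter S) t ∈ openGridSquare S := by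
  obtain ⟨⟨_, _⟩, _, _⟩ := mem_gridSquare.mp hz
  simp only [mem_openGridSquare, lineMap_apply, gridCenter, vsub_eq_sub, vadd_eq_add, real_smul,
    add_re, add_im, re_ofReal_mul, im_ofReal_mul, sub_re, sub_im]
  refine ⟨⟨?_, ?_⟩, ?_, ?_⟩ <;> nlinarith

theorem midpoint_gridCenter_nbr (S : ℤ × ℤ) (k : Fin 4) :
    midpoint ℝ (gridCenter S) (gridCenter (S + nbrOffset k)) =
      midpoint ℝ (gridCorner S k) (gridCorner S (k + 1)) := by
  simp only [midpoint_eq_smul_add, gridCenter, gridCorner, gridPoint]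
  fin_cases k <;> apply Complex.ext <;> simp [cornerOffset, nbrOffset] <;> ring

theorem midpoint_gridCenter_nbr_notMem_keyhole (hS : S ∉ Q) (hk₀ : S + nbrOffset k₀ ∉ Q) :
    midpoint ℝ (gridCenter S) (gridCenter (S + nbrOffset k₀)) ∉ keyhole Q S k₀ := by
  rw [midpoint_gridCenter_nbr, mem_keyhole]
  set m := midpoint ℝ (gridCorner S k₀) (gridCorner S (k₀ + 1))
  have hm : m ∈ gridSide S k₀ := midpoint_mem_segment _ _
  have hne : ¬ (m = gridCorner S k₀ ∨ m = gridCorner S (k₀ + 1)) := by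
    simp [m, midpoint_eq_left_iff, midpoint_eq_right_iff, gridCorner_ne_succ]
  rintro (⟨T, hT, hmT⟩ | ⟨k, hk, hmk⟩)
  · exact hne (eq_gridCorner_of_mem_gridSide_of_mem_gridSquare hm hmT
      (fun h => hS (h ▸ hT)) fun h => hk₀ (h ▸ hT))
  · exact hne (eq_gridCorner_of_mem_gridSide_of_mem_gridSide hk hmk hm)

theorem segment_gridCenter_subset_compl_keyhole (hz : z ∈ gridSquare T) (hT : T ∉ Q)
    (hzQ : z ∉ keyhole Q S k₀) : segment ℝ z (gridCenter T) ⊆ (keyhole Q S k₀)ᶜ := by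
  rw [segment_eq_image_lineMap]
  rintro _ ⟨t, ⟨ht₀, ht₁⟩, rfl⟩
  rcases ht₀.eq_or_lt with rfl | ht
  · rwa [lineMap_apply_zero]
  · exact notMem_keyhole_of_mem_openGridSquare (lineMap_gridCenter_mem_openGridSquare hz ht ht₁) hT

theorem exists_isPreconnected_gridCenter_nbr (hS : S ∉ Q) (hk₀ : S + nbrOffset k₀ ∉ Q) :
    ∃ C : Set ℂ, IsPreconnected C ∧ C ⊆ (keyhole Q S k₀)ᶜ ∧ gridCenter S ∈ C ∧
      gridCenter (S + nbrOffset k₀) ∈ C := by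
  set m := midpoint ℝ (gridCenter S) (gridCenter (S + nbrOffset k₀)) with hm_def
  have hm : m ∉ keyhole Q S k₀ := midpoint_gridCenter_nbr_notMem_keyhole hS hk₀
  have hmS : m ∈ gridSide S k₀ := by
    rw [hm_def, midpoint_gridCenter_nbr]
    exact midpoint_mem_segment _ _
  refine ⟨segment ℝ m (gridCenter S) ∪ segment ℝ m (gridCenter (S + nbrOffset k₀)),
    IsPreconnected.union m (left_mem_segment _ _ _) (left_mem_segment _ _ _)
      (convex_segment _ _).isPreconnected (convex_segment _ _).isPreconnected,
    union_subset ?_ ?_, Or.inl (right_mem_segment _ _ _), Or.inr (right_mem_segment _ _ _)⟩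
  · exact segment_gridCenter_subset_compl_keyhole (gridSide_subset_gridSquare _ _ hmS) hS hm
  · exact segment_gridCenter_subset_compl_keyhole (gridSide_subset_gridSquare_nbr _ _ hmS) hk₀ hm

theorem exists_isPreconnected_compl_keyhole_gridCenter (hS : S ∉ Q) (hk₀ : S + nbrOffset k₀ ∉ Q)
    (hz : z ∉ keyhole Q S k₀) :
    ∃ T ∉ insert S Q, ∃ C : Set ℂ, IsPreconnected C ∧ C ⊆ (keyhole Q S k₀)ᶜ ∧ z ∈ C ∧
      gridCenter T ∈ C := by
  set T : ℤ × ℤ := (⌊z.re⌋, ⌊z.im⌋)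
  have hT : z ∈ gridSquare T := mem_gridSquare_floor z
  have hTQ : T ∉ Q := fun h => hz (mem_keyhole.mpr (Or.inl ⟨T, h, hT⟩))
  have hsub := segment_gridCenter_subset_compl_keyhole hT hTQ hz
  have hconn : IsPreconnected (segment ℝ z (gridCenter T)) := (convex_segment _ _).isPreconnected
  by_cases hTS : T = S
  · obtain ⟨C, hC, hCQ, hSC, hnC⟩ := exists_isPreconnected_gridCenter_nbr hS hk₀
    refine ⟨S + nbrOffset k₀, ?_, segment ℝ z (gridCenter T) ∪ C,
      hconn.union _ (right_mem_segment _ _ _) (hTS ▸ hSC) hC,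
      union_subset hsub hCQ, Or.inl (left_mem_segment _ _ _), Or.inr hnC⟩
    rw [Finset.mem_insert, not_or]
    refine ⟨?_, hk₀⟩
    fin_cases k₀ <;> simp [nbrOffset]
  · exact ⟨T, by simp [hTS, hTQ], segment ℝ z (gridCenter T), hconn, hsub,
      left_mem_segment _ _ _, right_mem_segment _ _ _⟩

end Keyhole

section Solutions

/-- The functions `a`, `r`, `q` are holomorphic on `U` and `r` has no zeros there. These are the
coefficients of the equation `f' = expField a r q z s`. -/
structure HolomorphicCoeffs (a r q : ℂ → ℂ) (U : Set ℂ) : Prop where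
  shift : DifferentiableOn ℂ a U
  factor : DifferentiableOn ℂ r U
  root : DifferentiableOn ℂ q U
  factor_ne_zero : ∀ z ∈ U, r z ≠ 0

/-- The pair `(s, f)` is a holomorphic solution of `f' = expField a r q z s` on a neighbourhood
of `K`. -/
def SolNear (a r q : ℂ → ℂ) (K : Set ℂ) (s f : ℂ → ℂ) : Prop :=
  ∀ᶠ z in 𝓝ˢ K, DifferentiableAt ℂ s z ∧ HasDerivAt f (expField a r q z (s z)) z

variable {a r q s f : ℂ → ℂ} {K U V : Set ℂ}

theorem HolomorphicCoeffs.mono (h : HolomorphicCoeffs a r q U) (hVU : V ⊆ U) :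
    HolomorphicCoeffs a r q V :=
  ⟨h.shift.mono hVU, h.factor.mono hVU, h.root.mono hVU, fun z hz => h.factor_ne_zero z (hVU hz)⟩

theorem HolomorphicCoeffs.differentiableOn_expField (h : HolomorphicCoeffs a r q U)
    (hs : DifferentiableOn ℂ s U) : DifferentiableOn ℂ (fun z => expField a r q z (s z)) U :=
  LocUniv.differentiableOn_expField h.shift h.factor h.root hs

theorem SolNear.mono (h : SolNear a r q K s f) (hVK : V ⊆ K) : SolNear a r q V s f :=
  h.filter_mono (nhdsSet_mono hVK)

theorem solNear_iff_exists_isOpen : SolNear a r q K s f ↔ ∃ U, IsOpen U ∧ K ⊆ U ∧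
    DifferentiableOn ℂ s U ∧ ∀ z ∈ U, HasDerivAt f (expField a r q z (s z)) z := by
  rw [SolNear, eventually_nhdsSet_iff_exists]
  refine ⟨?_, ?_⟩
  · rintro ⟨U, hU, hKU, h⟩
    exact ⟨U, hU, hKU, fun z hz => (h z hz).1.differentiableWithinAt, fun z hz => (h z hz).2⟩
  · rintro ⟨U, hU, hKU, hs, hf⟩
    exact ⟨U, hU, hKU, fun z hz => ⟨hs.differentiableAt (hU.mem_nhds hz), hf z hz⟩⟩

end Solutions

section GridSides

/-- The integral of `h` along side number `k` of `gridSquare S`. -/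
def sideIntegral (h : ℂ → ℂ) (S : ℤ × ℤ) (k : Fin 4) : ℂ :=
  segmentIntegral h (gridCorner S k) (gridCorner S (k + 1))

variable {a r q s : ℂ → ℂ} {Q : Finset (ℤ × ℤ)} {S : ℤ × ℤ}

theorem exists_continuousOn_union_gridSide (hS : S ∉ Q) {I : Finset (Fin 4)} {k : Fin 4}
    (hk : k ∉ I) (ha : ContinuousOn a (gridSide S k)) (hr : ContinuousOn r (gridSide S k))
    (hq : ContinuousOn q (gridSide S k)) (hr0 : ∀ z ∈ gridSide S k, r z ≠ 0)
    (hq0 : ∀ z ∈ gridSide S k, q z ≠ 0)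
    (hs : ContinuousOn s (gridRegion Q ∪ ⋃ j ∈ I, gridSide S j)) {τ : ℂ}
    (hτ : S + nbrOffset k ∈ Q → sideIntegral (fun z => expField a r q z (s z)) S k = τ) :
    ∃ s' : ℂ → ℂ, ContinuousOn s' ((gridRegion Q ∪ ⋃ j ∈ I, gridSide S j) ∪ gridSide S k) ∧
      EqOn s' s (gridRegion Q ∪ ⋃ j ∈ I, gridSide S j) ∧
      sideIntegral (fun z => expField a r q z (s' z)) S k = τ := by
  by_cases hn : S + nbrOffset k ∈ Q
  · have hsub : gridSide S k ⊆ gridRegion Q := fun z hz =>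
      mem_gridRegion.mpr ⟨_, hn, gridSide_subset_gridSquare_nbr S k hz⟩
    exact ⟨s, by rwa [union_eq_left.mpr (hsub.trans subset_union_left)], fun z _ => rfl, hτ hn⟩
  · refine exists_continuousOn_union_segment ?_ hs (gridCorner_ne_succ S k) ?_ ha hr hq hr0 hq0 τ
    · exact ((isCompact_gridRegion Q).union
        (Finset.isCompact_biUnion _ fun _ _ => isCompact_segment _ _)).isClosed
    · rintro z ⟨hz | hz, hzk⟩
      · obtain ⟨T, hT, hzT⟩ := mem_gridRegion.mp hz
        exact eq_gridCorner_of_mem_gridSide_of_mem_gridSquare hzk hzT (fun h => hS (h ▸ hT))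
          fun h => hn (h ▸ hT)
      · obtain ⟨j, hj, hzj⟩ := mem_iUnion₂.mp hz
        exact eq_gridCorner_of_mem_gridSide_of_mem_gridSide (fun h => hk (h ▸ hj)) hzj hzk

theorem exists_continuousOn_union_biUnion_gridSide (hS : S ∉ Q)
    (ha : ContinuousOn a (gridSquare S)) (hr : ContinuousOn r (gridSquare S))
    (hq : ContinuousOn q (gridSquare S)) (hr0 : ∀ z ∈ gridSquare S, r z ≠ 0)
    (hq0 : ∀ z ∈ gridSquare S, q z ≠ 0) (hs : ContinuousOn s (gridRegion Q)) (τ : Fin 4 → ℂ)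
    (hτ : ∀ k, S + nbrOffset k ∈ Q → sideIntegral (fun z => expField a r q z (s z)) S k = τ k)
    (I : Finset (Fin 4)) :
    ∃ s' : ℂ → ℂ, ContinuousOn s' (gridRegion Q ∪ ⋃ k ∈ I, gridSide S k) ∧
      EqOn s' s (gridRegion Q) ∧
      ∀ k ∈ I, sideIntegral (fun z => expField a r q z (s' z)) S k = τ k := by
  induction I using Finset.induction_on with
  | empty => exact ⟨s, by simpa using hs, fun _ _ => rfl, by simp⟩
  | insert k I hk ih =>
    obtain ⟨s₁, hs₁, hs₁s, hs₁τ⟩ := ih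
    have hside := gridSide_subset_gridSquare S k
    obtain ⟨s₂, hs₂, hs₂s₁, hs₂τ⟩ := exists_continuousOn_union_gridSide hS hk (ha.mono hside)
      (hr.mono hside) (hq.mono hside) (fun z hz => hr0 z (hside hz)) (fun z hz => hq0 z (hside hz))
      hs₁ (τ := τ k) fun hn => by
        rw [← hτ k hn]
        refine segmentIntegral_congr fun z hz => ?_
        simp only [hs₁s (mem_gridRegion.mpr ⟨_, hn, gridSide_subset_gridSquare_nbr S k hz⟩)]
    refine ⟨s₂, ?_, fun z hz => (hs₂s₁ (Or.inl hz)).trans (hs₁s hz), ?_⟩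
    · rwa [Finset.set_biUnion_insert, union_comm (gridSide S k), ← union_assoc]
    · rw [Finset.forall_mem_insert]
      refine ⟨hs₂τ, fun j hj => (segmentIntegral_congr fun z hz => ?_).trans (hs₁τ j hj)⟩
      simp only [hs₂s₁ (Or.inr (mem_biUnion hj hz))]

end GridSides

section Primitives

/-- The union of the discs around the squares of `Q`, an open neighbourhood of `gridRegion Q`. -/
def gridNhd (Q : Finset (ℤ × ℤ)) : Set ℂ := ⋃ T ∈ Q, gridDisc T

variable {Q : Finset (ℤ × ℤ)} {S T : ℤ × ℤ} {h g₁ g₂ : ℂ → ℂ}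

theorem isOpen_gridDisc (T : ℤ × ℤ) : IsOpen (gridDisc T) := Metric.isOpen_ball

theorem isOpen_gridNhd (Q : Finset (ℤ × ℤ)) : IsOpen (gridNhd Q) :=
  isOpen_biUnion fun T _ => isOpen_gridDisc T

theorem gridDisc_subset_gridNhd (hT : T ∈ Q) : gridDisc T ⊆ gridNhd Q :=
  subset_biUnion_of_mem (u := gridDisc) hT

theorem gridSquare_subset_gridNhd (hT : T ∈ Q) : gridSquare T ⊆ gridNhd Q :=
  (gridSquare_subset_gridDisc T).trans (gridDisc_subset_gridNhd hT)

theorem gridRegion_subset_gridNhd (Q : Finset (ℤ × ℤ)) : gridRegion Q ⊆ gridNhd Q :=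
  iUnion₂_subset fun _ hT => gridSquare_subset_gridNhd hT

theorem forall_eq_of_forall_ne_add_one_eq {X : Type*} {c : Fin 4 → X} (k₀ : Fin 4)
    (h : ∀ k ≠ k₀, c (k + 1) = c k) (k : Fin 4) : c k = c 0 := by
  have h₀ := h 0
  have h₁ := h 1
  have h₂ := h 2
  have h₃ := h 3
  fin_cases k₀ <;> fin_cases k <;> simp at h₀ h₁ h₂ h₃ ⊢ <;> simp_all

theorem exists_hasDerivAt_gridDisc_eq (hh : DifferentiableOn ℂ h (gridDisc T)) {γ : Fin 4 → ℂ}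
    {k₀ : Fin 4} (hγ : ∀ k ≠ k₀, sideIntegral h T k = γ (k + 1) - γ k) :
    ∃ g : ℂ → ℂ, (∀ z ∈ gridDisc T, HasDerivAt g (h z) z) ∧ ∀ k, g (gridCorner T k) = γ k := by
  obtain ⟨g, hg₀, hg⟩ := hh.isExactOn_ball.with_val_at (gridCorner T 0) (γ 0)
  refine ⟨g, hg, fun k => ?_⟩
  have hconst (k : Fin 4) (hk : k ≠ k₀) :
      g (gridCorner T (k + 1)) - γ (k + 1) = g (gridCorner T k) - γ k := by
    have hside : gridSide T k ⊆ gridDisc T :=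
      (gridSide_subset_gridSquare T k).trans (gridSquare_subset_gridDisc T)
    have hint : sideIntegral h T k = g (gridCorner T (k + 1)) - g (gridCorner T k) :=
      segmentIntegral_eq_sub (fun z hz => hg z (hside hz)) (hh.continuousOn.mono hside)
    linear_combination hγ k hk - hint
  have hk := forall_eq_of_forall_ne_add_one_eq (c := fun k => g (gridCorner T k) - γ k) k₀ hconst k
  rwa [hg₀, sub_self, sub_eq_zero] at hk

theorem eqOn_gridDisc_inter_of_hasDerivAt (hg₁ : ∀ z ∈ gridDisc S, HasDerivAt g₁ (h z) z)
    (hg₂ : ∀ z ∈ gridDisc T, HasDerivAt g₂ (h z) z)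
    (hv : ∀ v, gridPoint v ∈ gridSquare S → gridPoint v ∈ gridSquare T →
      g₁ (gridPoint v) = g₂ (gridPoint v)) : EqOn g₁ g₂ (gridDisc S ∩ gridDisc T) := by
  intro z hz
  obtain ⟨v, hvS, hvT⟩ := exists_gridPoint_mem_of_gridDisc_inter_nonempty ⟨z, hz⟩
  have hconn : IsPreconnected (gridDisc S ∩ gridDisc T) :=
    ((convex_ball _ _).inter (convex_ball _ _)).isPreconnected
  refine ((isOpen_gridDisc S).inter (isOpen_gridDisc T)).eqOn_of_deriv_eq hconn ?_ ?_ ?_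
    ⟨gridSquare_subset_gridDisc S hvS, gridSquare_subset_gridDisc T hvT⟩ (hv v hvS hvT) hz
  · exact fun w hw => (hg₁ w hw.1).differentiableAt.differentiableWithinAt
  · exact fun w hw => (hg₂ w hw.2).differentiableAt.differentiableWithinAt
  · exact fun w hw => (hg₁ w hw.1).deriv.trans (hg₂ w hw.2).deriv.symm

open Classical in
theorem exists_forall_eqOn_of_forall_eqOn_inter {ι X Y : Type*} [Nonempty Y] {U : ι → Set X}
    {g : ι → X → Y} (h : ∀ i j, EqOn (g i) (g j) (U i ∩ U j)) :
    ∃ f : X → Y, ∀ i, EqOn f (g i) (U i) := by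
  refine ⟨fun x => if hx : ∃ i, x ∈ U i then g hx.choose x else Classical.arbitrary Y,
    fun i x hx => ?_⟩
  have hex : ∃ i, x ∈ U i := ⟨i, hx⟩
  simp only [dif_pos hex]
  exact h _ _ ⟨hex.choose_spec, hx⟩

theorem exists_hasDerivAt_gridNhd_eq (hh : DifferentiableOn ℂ h (gridNhd Q)) {G : ℤ × ℤ → ℂ}
    (hG : ∀ T ∈ Q, ∃ k₀, ∀ k ≠ k₀,
      sideIntegral h T k = G (T + cornerOffset (k + 1)) - G (T + cornerOffset k)) :
    ∃ f : ℂ → ℂ, (∀ z ∈ gridNhd Q, HasDerivAt f (h z) z) ∧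
      ∀ T ∈ Q, ∀ k, f (gridCorner T k) = G (T + cornerOffset k) := by
  have hloc (T : Q) : ∃ g : ℂ → ℂ, (∀ z ∈ gridDisc T, HasDerivAt g (h z) z) ∧
      ∀ k, g (gridCorner T k) = G (T + cornerOffset k) := by
    obtain ⟨k₀, hk₀⟩ := hG T T.2
    exact exists_hasDerivAt_gridDisc_eq (hh.mono (gridDisc_subset_gridNhd T.2)) hk₀
  choose g hg hgG using hloc
  have hlattice (T : Q) (v : ℤ × ℤ) (hv : gridPoint v ∈ gridSquare T) :
      g T (gridPoint v) = G v := by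
    obtain ⟨k, rfl⟩ := exists_eq_cornerOffset_of_mem_gridSquare hv
    exact hgG T k
  obtain ⟨f, hf⟩ := exists_forall_eqOn_of_forall_eqOn_inter fun S T : Q =>
    eqOn_gridDisc_inter_of_hasDerivAt (hg S) (hg T) fun v hS hT =>
      (hlattice S v hS).trans (hlattice T v hT).symm
  refine ⟨f, fun z hz => ?_, fun T hT k => ?_⟩
  · obtain ⟨T, hT, hzT⟩ := mem_iUnion₂.mp hz
    refine (hg ⟨T, hT⟩ z hzT).congr_of_eventuallyEq ?_
    filter_upwards [(isOpen_gridDisc T).mem_nhds hzT] with w hw using hf ⟨T, hT⟩ hw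
  · rw [hf ⟨T, hT⟩ (gridSquare_subset_gridDisc T (gridCorner_mem_gridSquare T k)), hgG]

end Primitives

section HolomorphicRestrict

variable {E N : Set ℂ} {a r q : ℂ → ℂ}

/-- The algebra of restrictions to `E` of functions that are holomorphic on `N`. -/
def holomorphicRestrict (E N : Set ℂ) : Subalgebra ℂ C(E, ℂ) where
  carrier := {ψ | ∃ g : ℂ → ℂ, DifferentiableOn ℂ g N ∧ ∀ z : E, ψ z = g z}
  mul_mem' := by
    rintro ψ₁ ψ₂ ⟨g₁, h₁, e₁⟩ ⟨g₂, h₂, e₂⟩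
    exact ⟨fun z => g₁ z * g₂ z, h₁.mul h₂, fun z => by simp [e₁, e₂]⟩
  add_mem' := by
    rintro ψ₁ ψ₂ ⟨g₁, h₁, e₁⟩ ⟨g₂, h₂, e₂⟩
    exact ⟨fun z => g₁ z + g₂ z, h₁.add h₂, fun z => by simp [e₁, e₂]⟩
  algebraMap_mem' c := ⟨fun _ => c, differentiableOn_const _, fun _ => rfl⟩

theorem continuous_superposition {X : Type*} [TopologicalSpace X] [LocallyCompactSpace X]
    (θ : C(X × ℂ, ℂ)) : Continuous (superposition θ) := by
  apply ContinuousMap.continuous_of_continuous_uncurry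
  change Continuous fun p : C(X, ℂ) × X => θ (p.2, p.1 p.2)
  fun_prop

theorem HolomorphicCoeffs.continuous_domRestrict (hc : HolomorphicCoeffs a r q N) (hEN : E ⊆ N) :
    Continuous (E.domRestrict a) ∧ Continuous (E.domRestrict r) ∧ Continuous (E.domRestrict q) :=
  ⟨(hc.shift.continuousOn.mono hEN).domRestrict, (hc.factor.continuousOn.mono hEN).domRestrict,
    (hc.root.continuousOn.mono hEN).domRestrict⟩

/-- The right-hand side of `f' = expField a r q z s` as a continuous function of `(z, s)`. -/
def expFieldMap (hc : HolomorphicCoeffs a r q N) (hEN : E ⊆ N) : C(E × ℂ, ℂ) where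
  toFun p := expField a r q p.1 p.2
  continuous_toFun := by
    obtain ⟨ha, hr, hq⟩ := hc.continuous_domRestrict hEN
    have he := differentiable_expSlope.continuous
    exact (ha.comp continuous_fst).add ((hr.comp continuous_fst).mul
      (continuous_snd.mul (he.comp (((hq.comp continuous_fst).pow 2).mul continuous_snd))))

theorem superposition_expFieldMap_apply (hc : HolomorphicCoeffs a r q N) (hEN : E ⊆ N)
    (w : C(E, ℂ)) (z : E) :
    superposition (expFieldMap hc hEN) w z = expField a r q z (w z) := rfl

theorem superposition_expFieldMap_mem (hc : HolomorphicCoeffs a r q N) (hEN : E ⊆ N)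
    {w : C(E, ℂ)} (hw : w ∈ holomorphicRestrict E N) :
    superposition (expFieldMap hc hEN) w ∈ holomorphicRestrict E N := by
  obtain ⟨g, hg, hwg⟩ := hw
  refine ⟨fun z => expField a r q z (g z), hc.differentiableOn_expField hg, fun z => ?_⟩
  rw [superposition_expFieldMap_apply, hwg]

theorem exists_inverse_deriv_expFieldMap [CompactSpace E] (hc : HolomorphicCoeffs a r q N)
    (hEN : E ⊆ N) {u : C(E, ℂ)} (hu : u ∈ (holomorphicRestrict E N).topologicalClosure) :
    ∃ m m' : C(E, ℂ), HasStrictFDerivAt (superposition (expFieldMap hc hEN))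
      (ContinuousLinearMap.mul ℂ C(E, ℂ) m) u ∧
      m' ∈ (holomorphicRestrict E N).topologicalClosure ∧ m * m' = 1 := by
  obtain ⟨-, hr, hq⟩ := hc.continuous_domRestrict hEN
  have hr0 (p : E × ℂ) : r p.1 ≠ 0 := hc.factor_ne_zero _ (hEN p.1.2)
  have hr' : Continuous fun p : E × ℂ => r p.1 := hr.comp continuous_fst
  have hexp : Continuous fun p : E × ℂ => q p.1 ^ 2 * p.2 :=
    ((hq.comp continuous_fst).pow 2).mul continuous_snd
  let θ' : C(E × ℂ, ℂ) := ⟨fun p => r p.1 * exp (q p.1 ^ 2 * p.2), hr'.mul hexp.cexp⟩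
  let θi : C(E × ℂ, ℂ) :=
    ⟨fun p => (r p.1)⁻¹ * exp (-(q p.1 ^ 2 * p.2)), (hr'.inv₀ hr0).mul hexp.neg.cexp⟩
  refine ⟨superposition θ' u, superposition θi u, hasStrictFDerivAt_superposition _ θ'
    (fun z => hasDerivAt_expField a r q z) u, ?_, ?_⟩
  · refine map_mem_closure (continuous_superposition θi) hu ?_
    rintro w ⟨g, hg, hwg⟩
    refine ⟨fun z => (r z)⁻¹ * exp (-(q z ^ 2 * g z)), (hc.factor.inv hc.factor_ne_zero).mul
      (((hc.root.pow 2).mul hg).neg.cexp), fun z => ?_⟩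
    simp [θi, hwg]
  · ext z
    have := hr0 (z, 0)
    simp only [ContinuousMap.mul_apply, superposition_apply, ContinuousMap.coe_mk,
      ContinuousMap.one_apply, θ', θi, exp_neg]
    field_simp [exp_ne_zero]

theorem exists_mem_holomorphicRestrict_superposition_mem [CompactSpace E]
    (hc : HolomorphicCoeffs a r q N) (hEN : E ⊆ N) {u : C(E, ℂ)}
    (hu : u ∈ (holomorphicRestrict E N).topologicalClosure) {Y : Type*} [NormedAddCommGroup Y]
    [NormedSpace ℂ Y] [FiniteDimensional ℂ Y] (Λ : C(E, ℂ) →L[ℂ] Y) (M : Submodule ℂ Y)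
    (hΛu : Λ (superposition (expFieldMap hc hEN) u) ∈ M) {O : Set C(E, ℂ)} (hO : O ∈ 𝓝 u) :
    ∃ w ∈ holomorphicRestrict E N, w ∈ O ∧ Λ (superposition (expFieldMap hc hEN) w) ∈ M := by
  obtain ⟨ε, hε, hεO⟩ := Metric.mem_nhds_iff.mp hO
  obtain ⟨m, m', hderiv, hm', hmm'⟩ := exists_inverse_deriv_expFieldMap hc hEN hu
  obtain ⟨w, hw, hwu, hwM⟩ := exists_mem_near_apply_mem hderiv
    (fun _ => superposition_expFieldMap_mem hc hEN) hu hm' hmm' Λ M hΛu hε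
  exact ⟨w, hw, hεO (by rwa [Metric.mem_ball, dist_eq_norm]), hwM⟩

end HolomorphicRestrict

section Periods

/-- The integral along a segment contained in `E`, as a continuous functional on `C(E, ℂ)`. The
parametrization of the segment is extended to a continuous map on `ℝ`. -/
def segmentIntegralCLM {E : Set ℂ} [CompactSpace E] {x y : ℂ} (h : segment ℝ x y ⊆ E) :
    C(E, ℂ) →L[ℂ] ℂ :=
  let γ : C(ℝ, E) := ⟨fun t => ⟨AffineMap.lineMap x y (projIcc (0 : ℝ) 1 zero_le_one t : ℝ),
    h (lineMap_mem_segment (by rw [uIcc_of_le zero_le_one]; exact Subtype.coe_prop _))⟩,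
      (AffineMap.lineMap_continuous.comp
        (continuous_subtype_val.comp continuous_projIcc)).subtype_mk _⟩
  LinearMap.mkContinuous
    { toFun := fun g => ∫ t in (0 : ℝ)..1, (y - x) * g (γ t)
      map_add' := fun g₁ g₂ => by
        simp only [ContinuousMap.add_apply, mul_add]
        exact intervalIntegral.integral_add (Continuous.intervalIntegrable (by fun_prop) _ _)
          (Continuous.intervalIntegrable (by fun_prop) _ _)
      map_smul' := fun c g => by
        simp only [ContinuousMap.smul_apply, smul_eq_mul, RingHom.id_apply,
          ← intervalIntegral.integral_const_mul, mul_left_comm c] }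
    ‖y - x‖ fun g => by
      have hbound := intervalIntegral.norm_integral_le_of_norm_le_const (a := 0) (b := 1)
        (C := ‖y - x‖ * ‖g‖) (f := fun t => (y - x) * g (γ t)) fun t _ => by
          rw [norm_mul]
          gcongr
          exact g.norm_coe_le_norm _
      simpa using hbound

theorem segmentIntegralCLM_apply {E : Set ℂ} [CompactSpace E] {x y : ℂ} (h : segment ℝ x y ⊆ E)
    {g : C(E, ℂ)} {t : ℂ → ℂ} (ht : ∀ z : E, g z = t z) :
    segmentIntegralCLM h g = segmentIntegral t x y := by
  refine intervalIntegral.integral_congr fun τ hτ => ?_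
  rw [uIcc_of_le zero_le_one] at hτ
  simp only [ContinuousMap.coe_mk, ht, projIcc_of_mem _ hτ]

/-- The difference operator on lattice functions, along the sides in a finite set; a side is given
by a square and the number of the side. -/
def sideDiff (J : Finset ((ℤ × ℤ) × Fin 4)) : (ℤ × ℤ → ℂ) →ₗ[ℂ] (J → ℂ) where
  toFun G i := G (i.1.1 + cornerOffset (i.1.2 + 1)) - G (i.1.1 + cornerOffset i.1.2)
  map_add' G₁ G₂ := by
    ext i
    simp only [Pi.add_apply]
    ring
  map_smul' c G := by
    ext i
    simp only [Pi.smul_apply, smul_eq_mul, RingHom.id_apply]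
    ring

theorem eventually_exists_apply_eq_norm_lt {ι Y : Type*} [NormedAddCommGroup Y] [NormedSpace ℂ Y]
    [FiniteDimensional ℂ Y] (D : (ι → ℂ) →ₗ[ℂ] Y) (V : Finset ι) {ε : ℝ} (hε : 0 < ε) :
    ∀ᶠ y in 𝓝 0, y ∈ LinearMap.range D → ∃ G, D G = y ∧ ∀ v ∈ V, ‖G v‖ < ε := by
  obtain ⟨σ, hσ⟩ := D.rangeRestrict.exists_rightInverse_of_surjective D.range_rangeRestrict
  obtain ⟨σ', hσ'⟩ := σ.exists_extend
  have hcont (v : ι) : Continuous fun y => σ' y v :=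
    (LinearMap.proj v ∘ₗ σ' : Y →ₗ[ℂ] ℂ).continuous_of_finiteDimensional
  have hsmall : ∀ᶠ y in 𝓝 0, ∀ v ∈ V, ‖σ' y v‖ < ε :=
    (Filter.eventually_all_finset V).mpr fun v _ =>
      (hcont v).norm.continuousAt.eventually_lt continuousAt_const (by simpa using hε)
  filter_upwards [hsmall] with y hy hyD
  refine ⟨σ' y, ?_, hy⟩
  have hσy : σ' y = σ ⟨y, hyD⟩ := LinearMap.congr_fun hσ' ⟨y, hyD⟩
  rw [hσy]
  exact congrArg Subtype.val (LinearMap.congr_fun hσ ⟨y, hyD⟩)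

end Periods

section Keyholes

/-- The sides contained in `keyhole Q S k₀`, namely those of the squares of `Q` and those of `S`
except side number `k₀`; a side is given by a square and the number of the side. -/
def keyholeSides (Q : Finset (ℤ × ℤ)) (S : ℤ × ℤ) (k₀ : Fin 4) : Finset ((ℤ × ℤ) × Fin 4) :=
  Q ×ˢ Finset.univ ∪ {S} ×ˢ Finset.univ.erase k₀

variable {Q : Finset (ℤ × ℤ)} {S T : ℤ × ℤ} {k₀ : Fin 4} {i : (ℤ × ℤ) × Fin 4}

theorem mem_keyholeSides : i ∈ keyholeSides Q S k₀ ↔ i.1 ∈ Q ∨ i.1 = S ∧ i.2 ≠ k₀ := by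
  simp only [keyholeSides, Finset.mem_union, Finset.mem_product, Finset.mem_univ, and_true,
    Finset.mem_singleton, Finset.mem_erase]

theorem gridSide_subset_keyhole (hi : i ∈ keyholeSides Q S k₀) :
    gridSide i.1 i.2 ⊆ keyhole Q S k₀ := by
  intro z hz
  rw [mem_keyhole]
  rcases mem_keyholeSides.mp hi with hT | ⟨hT, hk⟩
  · exact Or.inl ⟨_, hT, gridSide_subset_gridSquare _ _ hz⟩
  · exact Or.inr ⟨_, hk, hT ▸ hz⟩

theorem gridRegion_subset_keyhole (Q : Finset (ℤ × ℤ)) (S : ℤ × ℤ) (k₀ : Fin 4) :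
    gridRegion Q ⊆ keyhole Q S k₀ :=
  subset_union_left

theorem keyhole_subset_gridNhd_insert (Q : Finset (ℤ × ℤ)) (S : ℤ × ℤ) (k₀ : Fin 4) :
    keyhole Q S k₀ ⊆ gridNhd (insert S Q) := by
  intro z hz
  rcases mem_keyhole.mp hz with ⟨T, hT, hz⟩ | ⟨k, -, hz⟩
  · exact gridSquare_subset_gridNhd (Finset.mem_insert_of_mem hT) hz
  · exact gridSquare_subset_gridNhd (Finset.mem_insert_self S Q) (gridSide_subset_gridSquare S k hz)

theorem volume_keyhole_diff (Q : Finset (ℤ × ℤ)) (S : ℤ × ℤ) (k₀ : Fin 4) :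
    volume (keyhole Q S k₀ \ gridRegion Q) = 0 := by
  refine measure_mono_null (t := ⋃ k, gridSide S k) ?_ (measure_iUnion_null (volume_gridSide S))
  rintro z ⟨hz, hzQ⟩
  rcases mem_keyhole.mp hz with hz | ⟨k, -, hzk⟩
  · exact absurd (mem_gridRegion.mpr hz) hzQ
  · exact mem_iUnion.mpr ⟨k, hzk⟩

instance compactSpace_keyhole (Q : Finset (ℤ × ℤ)) (S : ℤ × ℤ) (k₀ : Fin 4) :
    CompactSpace (keyhole Q S k₀) :=
  isCompact_iff_compactSpace.mp (isCompact_keyhole Q S k₀)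

theorem cauchyKernel_mem_topologicalClosure_holomorphicRestrict (hS : S ∉ Q)
    (hk₀ : S + nbrOffset k₀ ∉ Q) (ζ : ↥(keyhole Q S k₀)ᶜ) : cauchyKernel (keyhole Q S k₀) ζ ∈
      (holomorphicRestrict (keyhole Q S k₀) (gridNhd (insert S Q))).topologicalClosure := by
  set X := holomorphicRestrict (keyhole Q S k₀) (gridNhd (insert S Q))
  obtain ⟨T, hT, C, hC, hCE, hζ, hTC⟩ := exists_isPreconnected_compl_keyhole_gridCenter hS hk₀ ζ.2
  have hcenter : ∀ z ∈ gridNhd (insert S Q), z - gridCenter T ≠ 0 := fun z hz h0 => by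
    obtain ⟨T', hT', hz'⟩ := mem_iUnion₂.mp hz
    rw [sub_eq_zero.mp h0] at hz'
    exact gridCenter_notMem_gridDisc (fun h : T = T' => hT (h ▸ hT')) hz'
  exact cauchyKernel_mem_of_isPreconnected X.topologicalClosure X.isClosed_topologicalClosure hC
    hCE (ζ₀ := ⟨gridCenter T, hCE hTC⟩) hTC hζ (X.le_topologicalClosure
      ⟨fun z => (z - gridCenter T)⁻¹, DifferentiableOn.inv (by fun_prop) hcenter, fun _ => rfl⟩)

end Keyholes

section Insertion

variable {a r q s f : ℂ → ℂ} {E K N : Set ℂ} {Q : Finset (ℤ × ℤ)} {S T : ℤ × ℤ} {k₀ : Fin 4}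

theorem SolNear.segmentIntegral_eq_sub (h : SolNear a r q K s f)
    (hc : HolomorphicCoeffs a r q N) (hKN : K ⊆ N) {x y : ℂ} (hxy : segment ℝ x y ⊆ K) :
    segmentIntegral (fun z => expField a r q z (s z)) x y = f y - f x := by
  obtain ⟨U, -, hKU, hs, hf⟩ := solNear_iff_exists_isOpen.mp h
  have hfield : DifferentiableOn ℂ (fun z => expField a r q z (s z)) (U ∩ N) :=
    (hc.mono inter_subset_right).differentiableOn_expField (hs.mono inter_subset_left)
  exact LocUniv.segmentIntegral_eq_sub (fun z hz => hf z (hKU (hxy hz)))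
    (hfield.continuousOn.mono fun z hz => ⟨hKU (hxy hz), hKN (hxy hz)⟩)

theorem SolNear.exists_continuousOn_keyhole (h : SolNear a r q (gridRegion Q) s f)
    (hc : HolomorphicCoeffs a r q (gridNhd (insert S Q))) (hS : S ∉ Q)
    (hq0 : ∀ z ∈ gridSquare S, q z ≠ 0) (k₀ : Fin 4) :
    ∃ u : ℂ → ℂ, ContinuousOn u (keyhole Q S k₀) ∧ EqOn u s (gridRegion Q) ∧
      ∀ i ∈ keyholeSides Q S k₀, sideIntegral (fun z => expField a r q z (u z)) i.1 i.2 =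
        f (gridCorner i.1 (i.2 + 1)) - f (gridCorner i.1 i.2) := by
  have hSN : gridSquare S ⊆ gridNhd (insert S Q) :=
    gridSquare_subset_gridNhd (Finset.mem_insert_self S Q)
  have hQN : gridRegion Q ⊆ gridNhd (insert S Q) :=
    (gridRegion_subset_keyhole Q S k₀).trans (keyhole_subset_gridNhd_insert Q S k₀)
  have hcS := hc.mono hSN
  obtain ⟨U, -, hQU, hs, -⟩ := solNear_iff_exists_isOpen.mp h
  obtain ⟨u, hu, hus, huS⟩ := exists_continuousOn_union_biUnion_gridSide hS
    hcS.shift.continuousOn hcS.factor.continuousOn hcS.root.continuousOn hcS.factor_ne_zero hq0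
    (hs.continuousOn.mono hQU) (fun k => f (gridCorner S (k + 1)) - f (gridCorner S k))
    (fun k hk => h.segmentIntegral_eq_sub hc hQN fun z hz =>
      mem_gridRegion.mpr ⟨_, hk, gridSide_subset_gridSquare_nbr S k hz⟩) (Finset.univ.erase k₀)
  refine ⟨u, hu, hus, ?_⟩
  rintro ⟨T, k⟩ hi
  rcases mem_keyholeSides.mp hi with hT | ⟨rfl, hk⟩
  · have hside : gridSide T k ⊆ gridRegion Q := fun z hz =>
      mem_gridRegion.mpr ⟨T, hT, gridSide_subset_gridSquare T k hz⟩
    rw [← h.segmentIntegral_eq_sub hc hQN hside]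
    exact segmentIntegral_congr fun z hz => by simp only [hus (hside hz)]
  · exact huS k (Finset.mem_erase.mpr ⟨hk, Finset.mem_univ k⟩)

theorem exists_mem_holomorphicRestrict_sideIntegral_eq [CompactSpace E]
    (hc : HolomorphicCoeffs a r q N) (hEN : E ⊆ N) {u : C(E, ℂ)} {u₀ : ℂ → ℂ}
    (hu₀ : ∀ z : E, u z = u₀ z) (hu : u ∈ (holomorphicRestrict E N).topologicalClosure)
    {J : Finset ((ℤ × ℤ) × Fin 4)} (hJ : ∀ i ∈ J, gridSide i.1 i.2 ⊆ E) {F : ℤ × ℤ → ℂ}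
    (hF : ∀ i ∈ J, sideIntegral (fun z => expField a r q z (u₀ z)) i.1 i.2 =
      F (i.1 + cornerOffset (i.2 + 1)) - F (i.1 + cornerOffset i.2))
    (V : Finset (ℤ × ℤ)) {ε : ℝ} (hε : 0 < ε) :
    ∃ (g : ℂ → ℂ) (G : ℤ × ℤ → ℂ), DifferentiableOn ℂ g N ∧ (∀ v ∈ V, ‖G v - F v‖ < ε) ∧
      (∀ z ∈ E, ‖g z - u₀ z‖ < ε ∧ ‖expField a r q z (g z) - expField a r q z (u₀ z)‖ < ε) ∧
      ∀ i ∈ J, sideIntegral (fun z => expField a r q z (g z)) i.1 i.2 =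
        G (i.1 + cornerOffset (i.2 + 1)) - G (i.1 + cornerOffset i.2) := by
  set Θ := superposition (expFieldMap hc hEN)
  have hΘ : Continuous Θ := continuous_superposition _
  let Λ : C(E, ℂ) →L[ℂ] (J → ℂ) :=
    ContinuousLinearMap.pi fun i => segmentIntegralCLM (hJ i.1 i.2)
  have hΛ {w : C(E, ℂ)} {t : ℂ → ℂ} (hwt : ∀ z : E, w z = t z) (i : J) :
      Λ (Θ w) i = sideIntegral (fun z => expField a r q z (t z)) i.1.1 i.1.2 :=
    segmentIntegralCLM_apply (hJ i.1 i.2) fun z => by rw [← hwt]; rfl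
  have hΛu : Λ (Θ u) = sideDiff J F := funext fun i => (hΛ hu₀ i).trans (hF i.1 i.2)
  have hΛu_mem : Λ (Θ u) ∈ LinearMap.range (sideDiff J) := hΛu ▸ LinearMap.mem_range_self _ F
  have hcorr : Tendsto (fun w => Λ (Θ w) - Λ (Θ u)) (𝓝 u) (𝓝 0) := by
    rw [← sub_self (Λ (Θ u))]
    exact ((Λ.continuous.comp hΘ).sub continuous_const).tendsto u
  obtain ⟨w, ⟨g, hg, hwg⟩, ⟨hw, hΘw, hw_corr⟩, hw_range⟩ :=
    exists_mem_holomorphicRestrict_superposition_mem hc hEN hu Λ _ hΛu_mem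
      (inter_mem (Metric.ball_mem_nhds u hε) (inter_mem (hΘ.continuousAt.preimage_mem_nhds
        (Metric.ball_mem_nhds (Θ u) hε))
          (hcorr.eventually (eventually_exists_apply_eq_norm_lt (sideDiff J) V hε))))
  obtain ⟨G, hG, hGV⟩ := hw_corr (Submodule.sub_mem _ hw_range hΛu_mem)
  refine ⟨g, F + G, hg, fun v hv => ?_, fun z hz => ⟨?_, ?_⟩, fun i hi => ?_⟩
  · simpa using hGV v hv
  · rw [← hwg ⟨z, hz⟩, ← hu₀ ⟨z, hz⟩, ← dist_eq_norm]
    exact (ContinuousMap.dist_apply_le_dist _).trans_lt hw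
  · rw [← hwg ⟨z, hz⟩, ← hu₀ ⟨z, hz⟩, ← dist_eq_norm]
    exact (ContinuousMap.dist_apply_le_dist (f := Θ w) (g := Θ u) ⟨z, hz⟩).trans_lt hΘw
  · have hsum : sideDiff J (F + G) = Λ (Θ w) := by rw [map_add, hG, hΛu, add_sub_cancel]
    exact (hΛ hwg ⟨i, hi⟩).symm.trans (congrFun hsum ⟨i, hi⟩).symm

theorem norm_le_norm_add_of_mem_gridSquare {g g' : ℂ → ℂ} {C : ℝ}
    (hg : ∀ z ∈ gridSquare T, HasDerivAt g (g' z) z) (hg' : ∀ z ∈ gridSquare T, ‖g' z‖ ≤ C)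
    {z w : ℂ} (hz : z ∈ gridSquare T) (hw : w ∈ gridSquare T) : ‖g z‖ ≤ ‖g w‖ + C * 2 := by
  have hC : 0 ≤ C := (norm_nonneg _).trans (hg' z hz)
  have hmean : ‖g z - g w‖ ≤ C * ‖z - w‖ :=
    (convex_gridSquare T).norm_image_sub_le_of_norm_hasDerivWithin_le
      (fun x hx => (hg x hx).hasDerivWithinAt) hg' hw hz
  calc ‖g z‖ ≤ ‖g w‖ + ‖g z - g w‖ := norm_le_norm_add_norm_sub' _ _
    _ ≤ ‖g w‖ + C * 2 := by
      gcongr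
      exact hmean.trans (mul_le_mul_of_nonneg_left (norm_sub_le_two_of_mem_gridSquare hz hw) hC)

theorem SolNear.exists_insert (h : SolNear a r q (gridRegion Q) s f)
    (hc : HolomorphicCoeffs a r q (gridNhd (insert S Q))) (hS : S ∉ Q)
    (hk₀ : S + nbrOffset k₀ ∉ Q) (hq0 : ∀ z ∈ gridSquare S, q z ≠ 0) {ε : ℝ} (hε : 0 < ε) :
    ∃ s' f' : ℂ → ℂ, SolNear a r q (gridRegion (insert S Q)) s' f' ∧
      ∀ z ∈ gridRegion Q, ‖s' z - s z‖ < ε ∧ ‖f' z - f z‖ < ε := by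
  obtain ⟨U, hU, hQU, hs, hf⟩ := solNear_iff_exists_isOpen.mp h
  have hQE := gridRegion_subset_keyhole Q S k₀
  have hEN := keyhole_subset_gridNhd_insert Q S k₀
  obtain ⟨u₀, hu₀, hus, huF⟩ := h.exists_continuousOn_keyhole hc hS hq0 k₀
  let u : C(keyhole Q S k₀, ℂ) := ⟨_, hu₀.domRestrict⟩
  set X := holomorphicRestrict (keyhole Q S k₀) (gridNhd (insert S Q))
  have hu : u ∈ X.topologicalClosure :=
    mem_of_eqOn_differentiableOn (isCompact_gridRegion Q) hQE hU hQU hs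
      (volume_keyhole_diff Q S k₀) X.topologicalClosure.toSubmodule X.isClosed_topologicalClosure
      (cauchyKernel_mem_topologicalClosure_holomorphicRestrict hS hk₀) u fun z hz => hus hz
  obtain ⟨g, G, hg, hGF, hgu, hgG⟩ := exists_mem_holomorphicRestrict_sideIntegral_eq hc hEN
    (fun _ => rfl) hu (fun i => gridSide_subset_keyhole) (F := fun v => f (gridPoint v)) huF Q
    (ε := ε / 8) (by positivity)
  obtain ⟨f', hf', hf'G⟩ := exists_hasDerivAt_gridNhd_eq (hc.differentiableOn_expField hg)
    fun T hT => ⟨k₀, fun k hk => hgG (T, k) <| mem_keyholeSides.mpr <|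
      (Finset.mem_insert.mp hT).symm.imp_right fun hTS => ⟨hTS, hk⟩⟩
  refine ⟨g, f', solNear_iff_exists_isOpen.mpr
    ⟨_, isOpen_gridNhd _, gridRegion_subset_gridNhd _, hg, hf'⟩, fun z hz => ⟨?_, ?_⟩⟩
  · rw [← hus hz]
    linarith [(hgu z (hQE hz)).1]
  · obtain ⟨T, hT, hzT⟩ := mem_gridRegion.mp hz
    have hTQ : gridSquare T ⊆ gridRegion Q := fun w hw => mem_gridRegion.mpr ⟨T, hT, hw⟩
    have hmean := norm_le_norm_add_of_mem_gridSquare (C := ε / 8)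
      (fun w hw => (hf' w (hEN (hQE (hTQ hw)))).sub (hf w (hQU (hTQ hw))))
      (fun w hw => by
        rw [← hus (hTQ hw)]
        exact (hgu w (hQE (hTQ hw))).2.le) hzT (gridCorner_mem_gridSquare T 0)
    have hcorner : ‖f' (gridCorner T 0) - f (gridCorner T 0)‖ < ε / 8 := by
      rw [hf'G T (Finset.mem_insert_of_mem hT)]
      simpa [gridCorner, cornerOffset, Prod.mk_zero_zero] using hGF T hT
    simp only [Pi.sub_apply] at hmean
    linarith

end Insertion

section Escape

/-- The square `S` can be joined to a square outside `Q` by a chain of adjacent squares that, up to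
its last member, avoids the squares in `B`. -/
inductive CanEscape (B : Set (ℤ × ℤ)) (Q : Finset (ℤ × ℤ)) : ℤ × ℤ → Prop
  | out {S : ℤ × ℤ} : S ∉ Q → CanEscape B Q S
  | step {S : ℤ × ℤ} {k : Fin 4} : S ∉ B → CanEscape B Q (S + nbrOffset k) → CanEscape B Q S

variable {B B' : Set (ℤ × ℤ)} {Q Q' : Finset (ℤ × ℤ)} {S T : ℤ × ℤ} {z : ℂ}

theorem CanEscape.anti (h : CanEscape B Q S) (hQ : Q' ⊆ Q) : CanEscape B Q' S := by
  induction h with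
  | out h => exact .out fun h' => h (hQ h')
  | step h _ ih => exact .step h ih

theorem CanEscape.notMem_of_mem (h : CanEscape B Q S) (hS : S ∈ Q) : S ∉ B := by
  cases h with
  | out h => exact absurd hS h
  | step h _ => exact h

theorem CanEscape.of_forall_not_canEscape (h : CanEscape B Q S)
    (hB' : ∀ T ∈ B', ¬ CanEscape B Q T) : CanEscape B' Q S := by
  induction h with
  | out h => exact .out h
  | step h h' ih => exact .step (fun hS => hB' _ hS (.step h h')) ih

theorem CanEscape.exists_nbrOffset_notMem (h : CanEscape B Q S) (hS : S ∈ Q) :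
    ∃ T ∈ Q, T ∉ B ∧ ∃ k, T + nbrOffset k ∉ Q := by
  induction h with
  | out h => exact absurd hS h
  | @step S k h _ ih =>
    by_cases hn : S + nbrOffset k ∈ Q
    · exact ih hn
    · exact ⟨S, hS, h, k, hn⟩

theorem eq_or_exists_nbrOffset_of_mem_gridSquare (hS : z ∈ gridSquare S) (hT : z ∈ gridSquare T)
    (hST : S.1 = T.1 ∨ S.2 = T.2) : S = T ∨ ∃ k, T + nbrOffset k = S := by
  obtain ⟨⟨_, _⟩, _, _⟩ := mem_gridSquare.mp hS
  obtain ⟨⟨_, _⟩, _, _⟩ := mem_gridSquare.mp hT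
  have h₁ : (S.1 : ℝ) ≤ T.1 + 1 := by linarith
  have h₂ : (T.1 : ℝ) ≤ S.1 + 1 := by linarith
  have h₃ : (S.2 : ℝ) ≤ T.2 + 1 := by linarith
  have h₄ : (T.2 : ℝ) ≤ S.2 + 1 := by linarith
  norm_cast at h₁ h₂ h₃ h₄
  simp only [Fin.exists_fin_succ, Prod.ext_iff, nbrOffset, Prod.fst_add, Prod.snd_add]
  simp
  omega

theorem CanEscape.of_mem_gridSquare (h : CanEscape B Q S) (hS : z ∈ gridSquare S)
    (hT : z ∈ gridSquare T) (hB : ∀ T, z ∈ gridSquare T → T ∉ B) : CanEscape B Q T := by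
  have adjacent {S T : ℤ × ℤ} (h : CanEscape B Q S) (hS : z ∈ gridSquare S)
      (hT : z ∈ gridSquare T) (hST : S.1 = T.1 ∨ S.2 = T.2) : CanEscape B Q T := by
    rcases eq_or_exists_nbrOffset_of_mem_gridSquare hS hT hST with rfl | ⟨k, rfl⟩
    · exact h
    · exact .step (hB T hT) h
  have hST : z ∈ gridSquare (S.1, T.2) := ⟨hS.1, hT.2⟩
  exact adjacent (adjacent h hS hST (Or.inl rfl)) hST hT (Or.inr rfl)

theorem finite_gridSquare_inter {C : Set ℂ} (hC : Bornology.IsBounded C) :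
    {T : ℤ × ℤ | (gridSquare T ∩ C).Nonempty}.Finite := by
  obtain ⟨R, hR⟩ := hC.subset_closedBall (0 : ℂ)
  refine ((finite_Icc (-⌈R⌉ - 1) (⌈R⌉ + 1)).prod (finite_Icc (-⌈R⌉ - 1) (⌈R⌉ + 1))).subset ?_
  rintro T ⟨z, hz, hzC⟩
  obtain ⟨⟨_, _⟩, _, _⟩ := mem_gridSquare.mp hz
  have hzR : ‖z‖ ≤ ⌈R⌉ := (mem_closedBall_zero_iff.mp (hR hzC)).trans (Int.le_ceil R)
  obtain ⟨_, _⟩ := abs_le.mp ((abs_re_le_norm z).trans hzR)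
  obtain ⟨_, _⟩ := abs_le.mp ((abs_im_le_norm z).trans hzR)
  have h₁ : (-⌈R⌉ - 1 : ℝ) ≤ T.1 := by linarith
  have h₂ : (T.1 : ℝ) ≤ ⌈R⌉ + 1 := by linarith
  have h₃ : (-⌈R⌉ - 1 : ℝ) ≤ T.2 := by linarith
  have h₄ : (T.2 : ℝ) ≤ ⌈R⌉ + 1 := by linarith
  exact ⟨⟨mod_cast h₁, mod_cast h₂⟩, ⟨mod_cast h₃, mod_cast h₄⟩⟩

theorem isClosed_biUnion_gridSquare (I : Set (ℤ × ℤ)) : IsClosed (⋃ S ∈ I, gridSquare S) := by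
  have hfinite : LocallyFinite gridSquare := fun z =>
    ⟨_, Metric.ball_mem_nhds z one_pos, finite_gridSquare_inter Metric.isBounded_ball⟩
  rw [biUnion_eq_iUnion]
  exact (hfinite.comp_injective Subtype.val_injective).isClosed_iUnion fun S =>
    (isCompact_gridSquare S).isClosed

theorem CanEscape.of_isPreconnected (h : CanEscape B Q S) {P : Set ℂ} (hP : IsPreconnected P)
    (hPB : ∀ z ∈ P, ∀ T, z ∈ gridSquare T → T ∉ B) {x y : ℂ} (hx : x ∈ P) (hy : y ∈ P)
    (hxS : x ∈ gridSquare S) (hyT : y ∈ gridSquare T) : CanEscape B Q T := by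
  by_contra hT
  obtain ⟨w, hwP, hw, hw'⟩ := isPreconnected_closed_iff.mp hP
    (⋃ S ∈ {S | CanEscape B Q S}, gridSquare S) (⋃ S ∈ {S | ¬ CanEscape B Q S}, gridSquare S)
    (isClosed_biUnion_gridSquare _) (isClosed_biUnion_gridSquare _)
    (fun w _ => by
      by_cases hw : CanEscape B Q (⌊w.re⌋, ⌊w.im⌋)
      · exact Or.inl (mem_biUnion hw (mem_gridSquare_floor w))
      · exact Or.inr (mem_biUnion hw (mem_gridSquare_floor w)))
    ⟨x, hx, mem_biUnion (x := S) h hxS⟩ ⟨y, hy, mem_biUnion (x := T) hT hyT⟩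
  obtain ⟨S₁, hS₁, hwS₁⟩ := mem_iUnion₂.mp hw
  obtain ⟨S₂, hS₂, hwS₂⟩ := mem_iUnion₂.mp hw'
  exact hS₂ (hS₁.of_mem_gridSquare hwS₁ hwS₂ (hPB w hwP))

end Escape

section Regions

variable {a r q s f : ℂ → ℂ} {P Q : Finset (ℤ × ℤ)}

theorem gridRegion_mono (h : P ⊆ Q) : gridRegion P ⊆ gridRegion Q :=
  biUnion_subset_biUnion_left h

theorem gridNhd_mono (h : P ⊆ Q) : gridNhd P ⊆ gridNhd Q :=
  biUnion_subset_biUnion_left h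

theorem SolNear.exists_gridRegion (h : SolNear a r q (gridRegion P) s f) (hPQ : P ⊆ Q)
    (hesc : ∀ S ∈ Q, S ∉ P → CanEscape P Q S) (hc : HolomorphicCoeffs a r q (gridNhd Q))
    (hq0 : ∀ S ∈ Q, S ∉ P → ∀ z ∈ gridSquare S, q z ≠ 0) {ε : ℝ} (hε : 0 < ε) :
    ∃ s' f' : ℂ → ℂ, SolNear a r q (gridRegion Q) s' f' ∧
      ∀ z ∈ gridRegion P, ‖s' z - s z‖ < ε ∧ ‖f' z - f z‖ < ε := by
  induction Q using Finset.strongInduction generalizing ε with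
  | H Q ih =>
    rcases hPQ.eq_or_ssubset with rfl | hssub
    · exact ⟨s, f, h, fun z _ => by simpa using hε⟩
    obtain ⟨S, hSQ, hSP⟩ := Finset.exists_of_ssubset hssub
    obtain ⟨T, hTQ, hTP, k, hk⟩ := (hesc S hSQ hSP).exists_nbrOffset_notMem hSQ
    rw [Finset.mem_coe] at hTP
    have hsub : Q.erase T ⊆ Q := Finset.erase_subset T Q
    have hP : P ⊆ Q.erase T := Finset.subset_erase.mpr ⟨hPQ, hTP⟩
    obtain ⟨s₁, f₁, h₁, hsf₁⟩ := ih _ (Finset.erase_ssubset hTQ) hP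
      (fun S hS hSP => (hesc S (hsub hS) hSP).anti hsub) (hc.mono (gridNhd_mono hsub))
      (fun S hS => hq0 S (hsub hS)) (half_pos hε)
    have hins : insert T (Q.erase T) = Q := Finset.insert_erase hTQ
    obtain ⟨s₂, f₂, h₂, hsf₂⟩ := h₁.exists_insert (hins.symm ▸ hc) (Finset.notMem_erase T Q)
      (fun hmem => hk (hsub hmem)) (hq0 T hTQ hTP) (half_pos hε)
    refine ⟨s₂, f₂, hins ▸ h₂, fun z hz => ?_⟩
    obtain ⟨hs₁, hf₁⟩ := hsf₁ z hz
    obtain ⟨hs₂, hf₂⟩ := hsf₂ z (gridRegion_mono hP hz)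
    exact ⟨(norm_sub_le_norm_sub_add_norm_sub _ (s₁ z) _).trans_lt (by linarith),
      (norm_sub_le_norm_sub_add_norm_sub _ (f₁ z) _).trans_lt (by linarith)⟩

end Regions

section CompactSets

open Metric

variable {a r q s f : ℂ → ℂ} {K L C U Ω : Set ℂ}

theorem exists_eventually_joinedIn_compl_cthickening {X : Type*} [NormedAddCommGroup X]
    [NormedSpace ℝ X] {K : Set X} {z p : X} (hK : IsClosed K) (hzp : JoinedIn Kᶜ z p) :
    ∃ δ > 0, ∀ᶠ w in 𝓝 z, JoinedIn (cthickening δ K)ᶜ w p := by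
  obtain ⟨γ, hγ⟩ := hzp
  have hdisj : Disjoint (range γ) K :=
    disjoint_left.mpr fun x ⟨t, ht⟩ hx => hγ t (ht ▸ hx)
  obtain ⟨δ, hδ, hδγ⟩ := hdisj.exists_cthickenings (isCompact_range γ.continuous) hK
  have hγδ : cthickening δ (range γ) ⊆ (cthickening δ K)ᶜ := hδγ.subset_compl_right
  refine ⟨δ, hδ, ?_⟩
  filter_upwards [closedBall_mem_nhds z hδ] with w hw
  have hz : z ∈ range γ := ⟨0, γ.source⟩
  have hball : closedBall z δ ⊆ (cthickening δ K)ᶜ :=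
    (closedBall_subset_cthickening hz δ).trans hγδ
  have hwz : JoinedIn (cthickening δ K)ᶜ w z := .of_segment_subset <|
    ((convex_closedBall z δ).segment_subset hw (mem_closedBall_self hδ.le)).trans hball
  have hzp' : JoinedIn (cthickening δ K)ᶜ z p :=
    ⟨γ, fun t => hγδ (self_subset_cthickening _ (mem_range_self t))⟩
  exact hwz.trans hzp'

theorem IsRungeIn.exists_joinedIn_notMem (hKΩ : IsRungeIn K Ω) (hK : IsClosed K)
    (hC : IsCompact C) (hCΩ : C ⊆ Ω) {z : ℂ} (hz : z ∉ K) : ∃ p ∉ C, JoinedIn Kᶜ z p := by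
  have hconn : IsConnected (connectedComponentIn Kᶜ z) :=
    isConnected_connectedComponentIn_iff.mpr hz
  have hpath : IsPathConnected (connectedComponentIn Kᶜ z) :=
    hK.isOpen_compl.connectedComponentIn.isConnected_iff_isPathConnected.mp hconn
  obtain ⟨p, hp, hpC⟩ : ∃ p ∈ connectedComponentIn Kᶜ z, p ∉ C := by
    rcases hKΩ z hz with ⟨p, hp, hpΩ⟩ | hunbounded
    · exact ⟨p, hp, fun h => hpΩ (hCΩ h)⟩
    · exact not_subset.mp fun h => hunbounded (hC.isBounded.subset h)
  exact ⟨p, hpC, (hpath.joinedIn z (mem_connectedComponentIn hz) p hp).mono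
    (connectedComponentIn_subset _ _)⟩

theorem IsRungeIn.exists_forall_joinedIn_notMem (hKΩ : IsRungeIn K Ω) (hK : IsClosed K)
    (hC : IsCompact C) (hCΩ : C ⊆ Ω) {Z : Set ℂ} (hZ : IsCompact Z) (hZK : Disjoint Z K) :
    ∃ δ > 0, ∀ z ∈ Z, ∃ p ∉ C, JoinedIn (cthickening δ K)ᶜ z p := by
  refine hZ.induction_on ⟨1, one_pos, by simp⟩ ?_ ?_ fun z hz => ?_
  · rintro s t hst ⟨δ, hδ, h⟩
    exact ⟨δ, hδ, fun z hz => h z (hst hz)⟩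
  · have mono {δ δ' : ℝ} (hδ : δ' ≤ δ) {z : ℂ} :
        (∃ p ∉ C, JoinedIn (cthickening δ K)ᶜ z p) → ∃ p ∉ C, JoinedIn (cthickening δ' K)ᶜ z p :=
      fun ⟨p, hp, hzp⟩ => ⟨p, hp, hzp.mono (compl_subset_compl.mpr (cthickening_mono hδ K))⟩
    rintro s t ⟨δ, hδ, hs⟩ ⟨δ', hδ', ht⟩
    refine ⟨min δ δ', lt_min hδ hδ', fun z hz => hz.elim ?_ ?_⟩
    · exact fun hz => mono (min_le_left δ δ') (hs z hz)
    · exact fun hz => mono (min_le_right δ δ') (ht z hz)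
  · obtain ⟨p, hpC, hzp⟩ := hKΩ.exists_joinedIn_notMem hK hC hCΩ (hZK.notMem_of_mem_left hz)
    obtain ⟨δ, hδ, hδz⟩ := exists_eventually_joinedIn_compl_cthickening hK hzp
    exact ⟨_, mem_nhdsWithin_of_mem_nhds hδz, δ, hδ, fun w hw => ⟨p, hpC, hw⟩⟩

theorem gridDisc_subset_cthickening {T : ℤ × ℤ} (hT : (gridSquare T ∩ C).Nonempty) :
    gridDisc T ⊆ cthickening 2 C := by
  obtain ⟨y, hy, hyC⟩ := hT
  intro z hz
  have hyT := mem_ball.mp (gridSquare_subset_gridDisc T hy)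
  refine mem_cthickening_of_dist_le z y 2 C hyC ?_
  linarith [dist_triangle_right z y (gridCenter T), mem_ball.mp hz]

theorem mem_cthickening_of_mem_gridSquare {T : ℤ × ℤ} (hT : (gridSquare T ∩ C).Nonempty) {z : ℂ}
    (hz : z ∈ gridSquare T) : z ∈ cthickening 2 C :=
  gridDisc_subset_cthickening hT (gridSquare_subset_gridDisc T hz)

theorem canEscape_of_joinedIn {Q : Finset (ℤ × ℤ)} {T : ℤ × ℤ} {z p : ℂ} (hz : z ∈ gridSquare T)
    (hp : ∀ S, p ∈ gridSquare S → S ∉ Q) (hzp : JoinedIn (cthickening 2 K)ᶜ z p) :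
    CanEscape {S | (gridSquare S ∩ K).Nonempty} Q T := by
  obtain ⟨γ, hγ⟩ := hzp
  refine (CanEscape.out (hp _ (mem_gridSquare_floor p))).of_isPreconnected
    (isPreconnected_range γ.continuous) ?_ ⟨1, γ.target⟩ ⟨0, γ.source⟩ (mem_gridSquare_floor p) hz
  rintro _ ⟨t, rfl⟩ S ht hS
  exact hγ t (mem_cthickening_of_mem_gridSquare hS ht)

open Classical in
theorem SolNear.exists_of_cthickening (h : SolNear a r q U s f) (hc : HolomorphicCoeffs a r q Ω)
    (hq0 : ∀ z ∈ Ω, q z = 0 → z ∈ K) (hC : Bornology.IsBounded C) (hKC : K ⊆ C)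
    (hCΩ : cthickening 2 C ⊆ Ω) (hesc : ∀ z ∈ cthickening 2 C \ U,
      ∃ p ∉ cthickening 2 C, JoinedIn (cthickening 2 K)ᶜ z p) {ε : ℝ} (hε : 0 < ε) :
    ∃ s' f' : ℂ → ℂ, SolNear a r q C s' f' ∧ ∀ z ∈ K, ‖s' z - s z‖ < ε ∧ ‖f' z - f z‖ < ε := by
  set Q : Finset (ℤ × ℤ) := (finite_gridSquare_inter hC).toFinset
  have hQ {T : ℤ × ℤ} : T ∈ Q ↔ (gridSquare T ∩ C).Nonempty := by simp [Q]
  set B : Set (ℤ × ℤ) := {T | (gridSquare T ∩ K).Nonempty}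
  set P : Finset (ℤ × ℤ) := Q.filter fun T => ¬ CanEscape B Q T
  have hBP {T : ℤ × ℤ} (hT : T ∈ B) : T ∈ P := by
    have hTQ : T ∈ Q := hQ.mpr (hT.mono (inter_subset_inter_right _ hKC))
    exact Finset.mem_filter.mpr ⟨hTQ, fun hesc => hesc.notMem_of_mem hTQ hT⟩
  have hKP : K ⊆ gridRegion P := fun z hz => mem_gridRegion.mpr
    ⟨_, hBP ⟨z, mem_gridSquare_floor z, hz⟩, mem_gridSquare_floor z⟩
  have hCQ : C ⊆ gridRegion Q := fun z hz => mem_gridRegion.mpr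
    ⟨_, hQ.mpr ⟨z, mem_gridSquare_floor z, hz⟩, mem_gridSquare_floor z⟩
  have hQΩ : gridNhd Q ⊆ Ω := iUnion₂_subset fun T hT =>
    (gridDisc_subset_cthickening (hQ.mp hT)).trans hCΩ
  have hPU : gridRegion P ⊆ U := fun z hz => by
    obtain ⟨T, hT, hzT⟩ := mem_gridRegion.mp hz
    obtain ⟨hTQ, hT⟩ := Finset.mem_filter.mp hT
    by_contra hzU
    obtain ⟨p, hp, hzp⟩ := hesc z ⟨mem_cthickening_of_mem_gridSquare (hQ.mp hTQ) hzT, hzU⟩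
    exact hT (canEscape_of_joinedIn hzT
      (fun S hpS hS => hp (mem_cthickening_of_mem_gridSquare (hQ.mp hS) hpS)) hzp)
  obtain ⟨s', f', h', hsf⟩ := SolNear.exists_gridRegion (h.mono hPU) (Finset.filter_subset _ Q)
    (fun S hS hSP => by
      have hSesc : CanEscape B Q S := by
        by_contra hSesc
        exact hSP (Finset.mem_filter.mpr ⟨hS, hSesc⟩)
      exact hSesc.of_forall_not_canEscape fun T hT => (Finset.mem_filter.mp hT).2)
    (hc.mono hQΩ) (fun S hS hSP z hz hqz => hSP (hBP
      ⟨z, hz, hq0 z (hQΩ (gridSquare_subset_gridNhd hS hz)) hqz⟩)) hε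
  exact ⟨s', f', h'.mono hCQ, fun z hz => hsf z (hKP hz)⟩

theorem HolomorphicCoeffs.comp_mul (h : HolomorphicCoeffs a r q Ω) {c : ℂ} (hc : c ≠ 0) :
    HolomorphicCoeffs (fun z => c * a (c * z)) (fun z => c * r (c * z)) (fun z => q (c * z))
      ((c * ·) ⁻¹' Ω) := by
  have hmul : DifferentiableOn ℂ (c * ·) ((c * ·) ⁻¹' Ω) := by fun_prop
  have hmaps : MapsTo (c * ·) ((c * ·) ⁻¹' Ω) Ω := mapsTo_preimage _ Ω
  exact ⟨(h.shift.comp hmul hmaps).const_mul c, (h.factor.comp hmul hmaps).const_mul c,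
    h.root.comp hmul hmaps, fun z hz => mul_ne_zero hc (h.factor_ne_zero _ hz)⟩

theorem SolNear.comp_mul (h : SolNear a r q K s f) (c : ℂ) (hL : MapsTo (c * ·) L K) :
    SolNear (fun z => c * a (c * z)) (fun z => c * r (c * z)) (fun z => q (c * z)) L
      (fun z => s (c * z)) (fun z => f (c * z)) := by
  have hmul (z : ℂ) : HasDerivAt (c * ·) c z := by simpa using (hasDerivAt_id' z).const_mul c
  have hcont : Continuous (c * · : ℂ → ℂ) := by fun_prop
  filter_upwards [(hcont.tendsto_nhdsSet hL).eventually h] with z hz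
  refine ⟨hz.1.comp z (hmul z).differentiableAt, ?_⟩
  rw [show expField (fun z => c * a (c * z)) (fun z => c * r (c * z)) (fun z => q (c * z)) z
      (s (c * z)) = expField a r q (c * z) (s (c * z)) * c by simp only [expField]; ring]
  exact hz.2.comp z (hmul z)

open scoped Pointwise in
theorem mul_mem_cthickening_iff {δ ρ : ℝ} (hδ : 0 < δ) {z : ℂ} :
    (δ : ℂ) * z ∈ cthickening (δ * ρ) C ↔ z ∈ cthickening ρ (((δ : ℂ) * ·) ⁻¹' C) := by
  have hδ0 : (δ : ℂ) ≠ 0 := ofReal_ne_zero.mpr hδ.ne'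
  have hC : C = (δ : ℂ) • (((δ : ℂ) * ·) ⁻¹' C) := by
    rw [show (((δ : ℂ) * ·) ⁻¹' C) = (δ : ℂ)⁻¹ • C from preimage_smul₀ hδ0 C,
      smul_inv_smul₀ hδ0]
  have hnorm : ((‖(δ : ℂ)‖₊ : NNReal) : ENNReal) = ENNReal.ofReal δ := by
    rw [← enorm_eq_nnnorm, ← ofReal_norm, norm_real, Real.norm_of_nonneg hδ.le]
  rw [mem_cthickening_iff, mem_cthickening_iff]
  nth_rw 1 [hC]
  rw [← smul_eq_mul, infEDist_smul₀ hδ0, ENNReal.smul_def, smul_eq_mul, hnorm,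
    ENNReal.ofReal_mul hδ.le,
    ENNReal.mul_le_mul_iff_right (ENNReal.ofReal_pos.mpr hδ).ne' ENNReal.ofReal_ne_top]

theorem SolNear.exists_of_cthickening_of_pos (h : SolNear a r q U s f)
    (hc : HolomorphicCoeffs a r q Ω) (hq0 : ∀ z ∈ Ω, q z = 0 → z ∈ K) (hC : IsCompact C)
    (hKC : K ⊆ C) {ρ : ℝ} (hρ : 0 < ρ) (hCΩ : cthickening ρ C ⊆ Ω)
    (hesc : ∀ z ∈ cthickening ρ C \ U, ∃ p ∉ cthickening ρ C, JoinedIn (cthickening ρ K)ᶜ z p)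
    {ε : ℝ} (hε : 0 < ε) :
    ∃ s' f' : ℂ → ℂ, SolNear a r q C s' f' ∧ ∀ z ∈ K, ‖s' z - s z‖ < ε ∧ ‖f' z - f z‖ < ε := by
  obtain ⟨δ, hδ, rfl⟩ : ∃ δ > 0, δ * 2 = ρ := ⟨ρ / 2, half_pos hρ, div_mul_cancel₀ ρ two_ne_zero⟩
  have hδ0 : (δ : ℂ) ≠ 0 := ofReal_ne_zero.mpr hδ.ne'
  obtain ⟨s', f', h', hsf⟩ := SolNear.exists_of_cthickening
    (K := ((δ : ℂ) * ·) ⁻¹' K) (C := ((δ : ℂ) * ·) ⁻¹' C)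
    (h.comp_mul δ (mapsTo_preimage _ U)) (hc.comp_mul hδ0) (fun z hz => hq0 _ hz)
    ((Homeomorph.mulLeft₀ (δ : ℂ) hδ0).isCompact_preimage.mpr hC).isBounded (preimage_mono hKC)
    (fun z hz => hCΩ ((mul_mem_cthickening_iff hδ).mpr hz)) (fun z hz => by
      obtain ⟨p, hp, hzp⟩ := hesc _ ⟨(mul_mem_cthickening_iff hδ).mpr hz.1, hz.2⟩
      refine ⟨(δ : ℂ)⁻¹ * p, fun h => hp ?_, ?_⟩
      · simpa only [mul_inv_cancel_left₀ hδ0] using (mul_mem_cthickening_iff hδ).mpr h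
      · have hzp' := hzp.map (continuous_const_mul (δ : ℂ)⁻¹)
        rw [inv_mul_cancel_left₀ hδ0] at hzp'
        refine hzp'.mono (image_subset_iff.mpr fun w hw hwK => hw ?_)
        simpa only [mul_inv_cancel_left₀ hδ0] using (mul_mem_cthickening_iff hδ).mpr hwK) hε
  have hmaps {L : Set ℂ} : MapsTo ((δ : ℂ)⁻¹ * ·) L (((δ : ℂ) * ·) ⁻¹' L) := fun z hz => by
    simpa only [mem_preimage, mul_inv_cancel_left₀ hδ0] using hz
  refine ⟨fun z => s' ((δ : ℂ)⁻¹ * z), fun z => f' ((δ : ℂ)⁻¹ * z), ?_, fun z hz => ?_⟩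
  · simpa only [mul_inv_cancel_left₀ hδ0, inv_mul_cancel_left₀ hδ0] using
      h'.comp_mul (δ : ℂ)⁻¹ hmaps
  · simpa only [mul_inv_cancel_left₀ hδ0] using hsf _ (hmaps hz)

theorem SolNear.exists_of_isRungeIn (h : SolNear a r q K s f) (hc : HolomorphicCoeffs a r q Ω)
    (hΩ : IsOpen Ω) (hq0 : ∀ z ∈ Ω, q z = 0 → z ∈ K) (hK : IsCompact K) (hKΩ : IsRungeIn K Ω)
    (hC : IsCompact C) (hKC : K ⊆ C) (hCΩ : C ⊆ Ω) {ε : ℝ} (hε : 0 < ε) :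
    ∃ s' f' : ℂ → ℂ, SolNear a r q C s' f' ∧ ∀ z ∈ K, ‖s' z - s z‖ < ε ∧ ‖f' z - f z‖ < ε := by
  obtain ⟨U, hU, hKU, hsol⟩ := eventually_nhdsSet_iff_exists.mp h
  obtain ⟨ρ, hρ, hρΩ⟩ := hC.exists_cthickening_subset_open hΩ hCΩ
  obtain ⟨δ, hδ, hesc⟩ := hKΩ.exists_forall_joinedIn_notMem hK.isClosed hC.cthickening hρΩ
    (hC.cthickening.diff hU) (disjoint_sdiff_left.mono_right hKU)
  have hCρ : cthickening (min ρ δ) C ⊆ cthickening ρ C := cthickening_mono (min_le_left ρ δ) C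
  refine SolNear.exists_of_cthickening_of_pos (U := U)
    (by filter_upwards [hU.mem_nhdsSet_self] using hsol) hc hq0 hC hKC (lt_min hρ hδ)
    (hCρ.trans hρΩ) (fun z hz => ?_) hε
  obtain ⟨p, hp, hzp⟩ := hesc z ⟨hCρ hz.1, hz.2⟩
  exact ⟨p, fun h => hp (hCρ h),
    hzp.mono (compl_subset_compl.mpr (cthickening_mono (min_le_right ρ δ) K))⟩

end CompactSets

section Exhaustion

open Metric

variable {Ω K : Set ℂ} {t t' : ℝ}

/-- The compact exhaustion of a plane open set `Ω` by distance to its complement and to infinity,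
indexed by a parameter `t > 0` going to infinity. -/
def exhaustion (Ω : Set ℂ) (t : ℝ) : Set ℂ := closedBall 0 t \ thickening t⁻¹ Ωᶜ

theorem isCompact_exhaustion (Ω : Set ℂ) (t : ℝ) : IsCompact (exhaustion Ω t) :=
  (isCompact_closedBall 0 t).diff isOpen_thickening

theorem exhaustion_subset (ht : 0 < t) : exhaustion Ω t ⊆ Ω := fun _ hz =>
  by_contra fun hzΩ => hz.2 (self_subset_thickening (inv_pos.mpr ht) _ hzΩ)

theorem exhaustion_mono (ht : 0 < t) (h : t ≤ t') : exhaustion Ω t ⊆ exhaustion Ω t' :=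
  sdiff_subset_sdiff (closedBall_subset_closedBall h) (thickening_mono (inv_anti₀ ht h) _)

theorem exists_subset_exhaustion (hΩ : IsOpen Ω) (hK : IsCompact K) (hKΩ : K ⊆ Ω) :
    ∃ t > 0, K ⊆ exhaustion Ω t := by
  obtain ⟨δ, hδ, hδΩ⟩ := (disjoint_compl_right_iff_subset.mpr hKΩ).exists_thickenings hK
    hΩ.isClosed_compl
  obtain ⟨R, hR⟩ := hK.isBounded.subset_closedBall (0 : ℂ)
  refine ⟨max R δ⁻¹, lt_max_of_lt_right (inv_pos.mpr hδ), fun z hz =>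
    ⟨closedBall_subset_closedBall (le_max_left _ _) (hR hz), fun hz' => ?_⟩⟩
  exact hδΩ.notMem_of_mem_left (self_subset_thickening hδ K hz)
    (thickening_mono (inv_le_of_inv_le₀ hδ (le_max_right _ _)) _ hz')

theorem exists_exhaustion_mem_nhds (hΩ : IsOpen Ω) (t : ℝ) {z : ℂ} (hz : z ∈ Ω) :
    ∃ n : ℕ, exhaustion Ω (t + n) ∈ 𝓝 z := by
  obtain ⟨ρ, hρ, hρΩ⟩ := nhds_basis_closedBall.mem_iff.mp (hΩ.mem_nhds hz)
  obtain ⟨t', ht', hsub⟩ := exists_subset_exhaustion hΩ (isCompact_closedBall z ρ) hρΩ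
  obtain ⟨n, hn⟩ := exists_nat_ge (t' - t)
  exact ⟨n, mem_of_superset (closedBall_mem_nhds z hρ)
    (hsub.trans (exhaustion_mono ht' (sub_le_iff_le_add'.mp hn)))⟩

theorem not_isBounded_ray {b : ℂ} (hb : b ≠ 0) :
    ¬ Bornology.IsBounded ((fun x : ℝ => (x : ℂ) * b) '' Ici 1) := by
  intro hbdd
  obtain ⟨R, hR⟩ := hbdd.exists_norm_le
  have hb0 : 0 < ‖b‖ := norm_pos_iff.mpr hb
  have hmem : (1 : ℝ) ≤ 1 + |R| / ‖b‖ := le_add_of_nonneg_right (by positivity)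
  have hle := hR _ (mem_image_of_mem _ hmem)
  rw [norm_mul, norm_real, Real.norm_of_nonneg (by positivity), add_mul, one_mul,
    div_mul_cancel₀ _ hb0.ne'] at hle
  linarith [le_abs_self R]

theorem isRungeIn_exhaustion (ht : 0 < t) : IsRungeIn (exhaustion Ω t) Ω := by
  refine .of_forall_exists_isPreconnected fun b hb => ?_
  by_cases hbt : b ∈ closedBall 0 t
  · obtain ⟨p, hp, hbp⟩ := mem_thickening_iff.mp (not_not.mp fun h => hb ⟨hbt, h⟩)
    exact ⟨ball p t⁻¹, (convex_ball p _).isPreconnected, hbp,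
      fun z hz hzC => hzC.2 (mem_thickening_iff.mpr ⟨p, hp, hz⟩),
      Or.inl ⟨p, mem_ball_self (inv_pos.mpr ht), hp⟩⟩
  · rw [mem_closedBall_zero_iff, not_le] at hbt
    refine ⟨(fun x : ℝ => (x : ℂ) * b) '' Ici 1, isPreconnected_Ici.image _ (by fun_prop),
      ⟨1, self_mem_Ici, by simp⟩, ?_, Or.inr (not_isBounded_ray (norm_pos_iff.mp (ht.trans hbt)))⟩
    rintro _ ⟨x, hx, rfl⟩ hxC
    have hxt := mem_closedBall_zero_iff.mp hxC.1
    rw [norm_mul, norm_real, Real.norm_eq_abs] at hxt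
    exact hxt.not_gt (hbt.trans_le
      (le_mul_of_one_le_left (norm_nonneg b) ((mem_Ici.mp hx).trans (le_abs_self x))))

end Exhaustion

section Limits

variable {a r q s f : ℂ → ℂ} {K Ω U : Set ℂ} {ε : ℝ}

theorem exists_forall_norm_sub_le_div_two_pow {X E : Type*} [NormedAddCommGroup E]
    [CompleteSpace E] {C : ℕ → Set X} (hC : Monotone C) {F : ℕ → X → E} {D : ℝ}
    (h : ∀ n, ∀ x ∈ C n, ‖F (n + 1) x - F n x‖ < D / 2 / 2 ^ n) :
    ∃ g : X → E, ∀ n, ∀ x ∈ C n, ‖F n x - g x‖ ≤ D / 2 ^ n := by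
  refine ⟨fun x => limUnder atTop fun n => F n x, fun n x hx => ?_⟩
  have hstep (k : ℕ) : dist (F (n + k) x) (F (n + k + 1) x) ≤ D / 2 ^ n / 2 / 2 ^ k := by
    rw [dist_comm, dist_eq_norm]
    refine (h (n + k) x (hC (Nat.le_add_right n k) hx)).le.trans (le_of_eq ?_)
    rw [pow_add]
    field_simp
  obtain ⟨y, hy⟩ := cauchySeq_tendsto_of_complete (cauchySeq_of_le_geometric_two hstep)
  have hlim : Tendsto (fun k => F k x) atTop (𝓝 y) :=
    (tendsto_add_atTop_iff_nat n).mp (hy.congr fun k => by rw [add_comm])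
  simp only [hlim.limUnder_eq]
  rw [← dist_eq_norm]
  exact dist_le_of_le_geometric_two_of_tendsto₀ hstep hy

theorem tendstoUniformlyOn_of_norm_sub_le_div_two_pow {X E : Type*} [SeminormedAddCommGroup E]
    {C : ℕ → Set X} (hC : Monotone C) {F : ℕ → X → E} {g : X → E} {D : ℝ}
    (h : ∀ n, ∀ x ∈ C n, ‖F n x - g x‖ ≤ D / 2 ^ n) (N : ℕ) :
    TendstoUniformlyOn F g atTop (C N) := by
  have hlim : Tendsto (fun n : ℕ => D / 2 ^ n) atTop (𝓝 0) :=
    tendsto_const_nhds.div_atTop (tendsto_pow_atTop_atTop_of_one_lt one_lt_two)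
  rw [Metric.tendstoUniformlyOn_iff]
  intro ε hε
  filter_upwards [hlim.eventually_lt_const hε, eventually_ge_atTop N] with n hn hNn x hx
  rw [dist_comm, dist_eq_norm]
  exact (h n x (hC hNn hx)).trans_lt hn

theorem SolNear.of_tendstoLocallyUniformlyOn {ι : Type*} {l : Filter ι} [l.NeBot]
    {S F : ι → ℂ → ℂ} (hU : IsOpen U) (h : ∀ᶠ n in l, SolNear a r q U (S n) (F n))
    (hs : TendstoLocallyUniformlyOn S s l U) (hf : TendstoLocallyUniformlyOn F f l U) :
    SolNear a r q U s f := by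
  have hsol : ∀ᶠ n in l, ∀ z ∈ U,
      DifferentiableAt ℂ (S n) z ∧ HasDerivAt (F n) (expField a r q z (S n z)) z :=
    h.mono fun n hn => hn.self_of_nhdsSet
  have hsd : DifferentiableOn ℂ s U := hs.differentiableOn
    (hsol.mono fun n hn z hz => (hn z hz).1.differentiableWithinAt) hU
  have hFd : ∀ᶠ n in l, DifferentiableOn ℂ (F n) U :=
    hsol.mono fun n hn z hz => (hn z hz).2.differentiableAt.differentiableWithinAt
  have hfd : DifferentiableOn ℂ f U := hf.differentiableOn hFd hU
  refine solNear_iff_exists_isOpen.mpr ⟨U, hU, subset_rfl, hsd, fun z hz => ?_⟩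
  have hcont : Continuous (expField a r q z) :=
    continuous_iff_continuousAt.mpr fun x => (hasDerivAt_expField a r q z x).continuousAt
  have hderiv : deriv f z = expField a r q z (s z) := by
    refine tendsto_nhds_unique (((hf.deriv hFd hU).tendsto_at hz).congr' ?_)
      ((hcont.tendsto (s z)).comp (hs.tendsto_at hz))
    exact hsol.mono fun n hn => (hn z hz).2.deriv
  exact hderiv ▸ (hfd.differentiableAt (hU.mem_nhds hz)).hasDerivAt

theorem exists_seq_of_forall_exists {α : Type*} {P : ℕ → α → Prop} {R : ℕ → α → α → Prop} {x : α}
    (hx : P 0 x) (step : ∀ n y, P n y → ∃ y', P (n + 1) y' ∧ R n y y') :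
    ∃ u : ℕ → α, u 0 = x ∧ (∀ n, P n (u n)) ∧ ∀ n, R n (u n) (u (n + 1)) := by
  have : Nonempty α := ⟨x⟩
  choose! next hP hR using step
  let u : ℕ → α := fun n => Nat.rec x next n
  have hu (n : ℕ) : P n (u n) := by
    induction n with
    | zero => exact hx
    | succ n ih => exact hP n (u n) ih
  exact ⟨u, rfl, hu, fun n => hR n (u n) (hu n)⟩

theorem SolNear.exists_seq {C : ℕ → Set ℂ} (h : SolNear a r q (C 0) s f)
    (hc : HolomorphicCoeffs a r q Ω) (hΩ : IsOpen Ω) (hq0 : ∀ z ∈ Ω, q z = 0 → z ∈ C 0)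
    (hC : ∀ n, IsCompact (C n)) (hCΩ : ∀ n, C n ⊆ Ω) (hCR : ∀ n, IsRungeIn (C n) Ω)
    (hmono : Monotone C) (hε : 0 < ε) :
    ∃ S F : ℕ → ℂ → ℂ, F 0 = f ∧ (∀ n, SolNear a r q (C n) (S n) (F n)) ∧
      ∀ n, ∀ z ∈ C n, ‖S (n + 1) z - S n z‖ < ε / 2 / 2 ^ n ∧
        ‖F (n + 1) z - F n z‖ < ε / 2 / 2 ^ n := by
  obtain ⟨u, hu0, hu, hstep⟩ := exists_seq_of_forall_exists
    (P := fun n (p : (ℂ → ℂ) × (ℂ → ℂ)) => SolNear a r q (C n) p.1 p.2)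
    (R := fun n p p' => ∀ z ∈ C n, ‖p'.1 z - p.1 z‖ < ε / 2 / 2 ^ n ∧
      ‖p'.2 z - p.2 z‖ < ε / 2 / 2 ^ n) (x := (s, f)) h fun n p hp => by
        obtain ⟨s', f', h', hsf⟩ := hp.exists_of_isRungeIn hc hΩ
          (fun z hz hqz => hmono n.zero_le (hq0 z hz hqz)) (hC n) (hCR n) (hC (n + 1))
          (hmono n.le_succ) (hCΩ (n + 1)) (ε := ε / 2 / 2 ^ n) (by positivity)
        exact ⟨(s', f'), h', hsf⟩
  exact ⟨fun n => (u n).1, fun n => (u n).2, congrArg Prod.snd hu0, hu, hstep⟩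

theorem SolNear.exists_solNear_norm_sub_le {C : ℕ → Set ℂ} (h : SolNear a r q (C 0) s f)
    (hc : HolomorphicCoeffs a r q Ω) (hΩ : IsOpen Ω) (hq0 : ∀ z ∈ Ω, q z = 0 → z ∈ C 0)
    (hC : ∀ n, IsCompact (C n)) (hCΩ : ∀ n, C n ⊆ Ω) (hCR : ∀ n, IsRungeIn (C n) Ω)
    (hmono : Monotone C) (hexh : ∀ z ∈ Ω, ∃ n, C n ∈ 𝓝 z) (hε : 0 < ε) :
    ∃ s' g : ℂ → ℂ, SolNear a r q Ω s' g ∧ ∀ z ∈ C 0, ‖g z - f z‖ ≤ ε := by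
  obtain ⟨S, F, rfl, hsol, hSF⟩ := h.exists_seq hc hΩ hq0 hC hCΩ hCR hmono hε
  obtain ⟨s', hs'⟩ := exists_forall_norm_sub_le_div_two_pow hmono fun n z hz => (hSF n z hz).1
  obtain ⟨g, hg⟩ := exists_forall_norm_sub_le_div_two_pow hmono fun n z hz => (hSF n z hz).2
  refine ⟨s', g, eventually_nhdsSet_iff_forall.mpr fun z hz => ?_, fun z hz => ?_⟩
  · obtain ⟨N, hN⟩ := hexh z hz
    have hlim {G : ℕ → ℂ → ℂ} {G' : ℂ → ℂ} (hG : ∀ n, ∀ z ∈ C n, ‖G n z - G' z‖ ≤ ε / 2 ^ n) :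
        TendstoLocallyUniformlyOn G G' atTop (interior (C N)) :=
      ((tendstoUniformlyOn_of_norm_sub_le_div_two_pow hmono hG N).mono
        interior_subset).tendstoLocallyUniformlyOn
    have hev : ∀ᶠ n in atTop, SolNear a r q (interior (C N)) (S n) (F n) := by
      filter_upwards [eventually_ge_atTop N] with n hn
      exact (hsol n).mono (interior_subset.trans (hmono hn))
    exact eventually_nhdsSet_iff_forall.mp
      (SolNear.of_tendstoLocallyUniformlyOn isOpen_interior hev (hlim hs') (hlim hg)) z
      (mem_interior_iff_mem_nhds.mpr hN)
  · simpa only [pow_zero, div_one, norm_sub_rev] using hg 0 z hz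

theorem SolNear.exists_solNear_norm_sub_lt (h : SolNear a r q K s f)
    (hc : HolomorphicCoeffs a r q Ω) (hΩ : IsOpen Ω) (hq0 : ∀ z ∈ Ω, q z = 0 → z ∈ K)
    (hK : IsCompact K) (hKΩ : K ⊆ Ω) (hKR : IsRungeIn K Ω) (hε : 0 < ε) :
    ∃ s' g : ℂ → ℂ, SolNear a r q Ω s' g ∧ ∀ z ∈ K, ‖g z - f z‖ < ε := by
  obtain ⟨t, ht, hKt⟩ := exists_subset_exhaustion hΩ hK hKΩ
  have htn (n : ℕ) : 0 < t + n := by positivity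
  have hKC : K ⊆ exhaustion Ω (t + (0 : ℕ)) := by simpa only [Nat.cast_zero, add_zero] using hKt
  obtain ⟨s₀, f₀, h₀, hsf₀⟩ := h.exists_of_isRungeIn hc hΩ hq0 hK hKR
    (isCompact_exhaustion Ω _) hKC (exhaustion_subset (htn 0)) (half_pos hε)
  obtain ⟨s', g, hsg, hg⟩ := SolNear.exists_solNear_norm_sub_le
    (C := fun n : ℕ => exhaustion Ω (t + n)) h₀ hc hΩ (fun z hz hqz => hKC (hq0 z hz hqz))
    (fun _ => isCompact_exhaustion Ω _) (fun n => exhaustion_subset (htn n))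
    (fun n => isRungeIn_exhaustion (htn n))
    (fun m n hmn => exhaustion_mono (htn m) (by gcongr))
    (fun z hz => exists_exhaustion_mem_nhds hΩ t hz) (half_pos hε)
  refine ⟨s', g, hsg, fun z hz => ?_⟩
  calc ‖g z - f z‖ ≤ ‖g z - f₀ z‖ + ‖f₀ z - f z‖ := norm_sub_le_norm_sub_add_norm_sub _ _ _
    _ < ε / 2 + ε / 2 := add_lt_add_of_le_of_lt (hg z (hKC hz)) (hsf₀ z hz).2
    _ = ε := add_halves ε

end Limits

section Holomorphic

variable {K Ω : Set ℂ} {ε : ℝ}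

theorem closure_connectedComponentIn_compl_subset {X : Type*} [TopologicalSpace X] (K : Set X)
    (b : X) : closure (connectedComponentIn Kᶜ b) ⊆ connectedComponentIn Kᶜ b ∪ K := by
  by_cases hb : b ∈ Kᶜ
  · intro z hz
    by_contra! hzKb
    obtain ⟨hzb, hzK⟩ := not_or.mp hzKb
    refine hzb (IsPreconnected.subset_connectedComponentIn
      (isPreconnected_connectedComponentIn.subset_closure (subset_insert z _)
        (insert_subset hz subset_closure))
      (mem_insert_of_mem z (mem_connectedComponentIn hb)) ?_ (mem_insert z _))
    exact insert_subset hzK (connectedComponentIn_subset _ _)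
  · simp [connectedComponentIn_eq_empty hb]

theorem isRungeIn_of_forall_not_relCompactIn (hKΩ : K ⊆ Ω)
    (h : ∀ z ∈ Ω \ K, ¬ RelCompactIn (connectedComponentIn (Ω \ K) z) Ω) : IsRungeIn K Ω := by
  intro b hb
  by_contra! hbΩ
  obtain ⟨hempty, hbdd⟩ := hbΩ
  have hsub : connectedComponentIn Kᶜ b ⊆ Ω :=
    disjoint_compl_right_iff_subset.mp (disjoint_iff_inter_eq_empty.mpr hempty)
  have hbmem : b ∈ connectedComponentIn Kᶜ b := mem_connectedComponentIn hb
  have heq : connectedComponentIn (Ω \ K) b = connectedComponentIn Kᶜ b :=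
    (connectedComponentIn_mono b (sdiff_subset_compl _ _)).antisymm
      (isPreconnected_connectedComponentIn.subset_connectedComponentIn hbmem
        fun z hz => ⟨hsub hz, connectedComponentIn_subset _ _ hz⟩)
  refine h b ⟨hsub hbmem, hb⟩ ?_
  rw [heq]
  exact ⟨hbdd.isCompact_closure,
    (closure_connectedComponentIn_compl_subset K b).trans (union_subset hsub hKΩ)⟩

theorem isRungeIn_univ_of_isPreconnected_compl (hK : IsCompact K) (h : IsPreconnected Kᶜ) :
    IsRungeIn K univ := by
  refine .of_forall_exists_isPreconnected fun b hb => ⟨Kᶜ, h, hb, subset_rfl, Or.inr fun hbdd => ?_⟩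
  have huniv := hK.isBounded.union hbdd
  rw [union_compl_self] at huniv
  exact NormedSpace.unbounded_univ ℂ ℂ huniv

theorem expField_self_one (r : ℂ → ℂ) (z s : ℂ) :
    expField r r (fun _ => 1) z s = r z * exp s := by
  rw [expField_of_ne_zero r r one_ne_zero]
  simp only [one_pow, one_mul, div_one]
  ring

theorem exists_mem_hlu_norm_sub_lt (hΩ : IsOpen Ω) (hK : IsCompact K) (hKΩ : K ⊆ Ω)
    (hKR : IsRungeIn K Ω) {f : ℂ → ℂ} (hf : f ∈ HLU K) (hε : 0 < ε) :
    ∃ g ∈ HLU Ω, ∀ z ∈ K, ‖g z - f z‖ < ε := by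
  obtain ⟨U, hU, hKU, hfU, hf0⟩ := hf
  have hKU' : U ∈ 𝓝ˢ K := hU.mem_nhdsSet.mpr hKU
  have hdf : ∀ᶠ z in 𝓝ˢ K, DifferentiableAt ℂ (deriv f) z := by
    filter_upwards [hKU'] with z hz using (hfU.deriv hU).differentiableAt (hU.mem_nhds hz)
  obtain ⟨R, u, hR, hR0, hu⟩ :=
    hasExpFactorization_of_forall_ne_zero hK hKR hdf fun z hz => hf0 z (hKU hz)
  have hsol : SolNear R R (fun _ => 1) K u f := by
    filter_upwards [hKU', hu] with z hz hzu
    rw [expField_self_one, ← hzu.2]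
    exact ⟨hzu.1, (hfU.differentiableAt (hU.mem_nhds hz)).hasDerivAt⟩
  obtain ⟨s, g, hsg, hg⟩ := hsol.exists_solNear_norm_sub_lt
    ⟨hR, hR, differentiableOn_const _, hR0⟩ hΩ (fun z _ h => absurd h one_ne_zero) hK hKΩ hKR hε
  have hgd {z : ℂ} (hz : z ∈ Ω) : HasDerivAt g (R z * exp (s z)) z :=
    expField_self_one R z (s z) ▸ (hsg.self_of_nhdsSet z hz).2
  refine ⟨g, ⟨Ω, hΩ, subset_rfl,
    fun z hz => (hgd hz).differentiableAt.differentiableWithinAt, fun z hz => ?_⟩, hg⟩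
  rw [(hgd hz).deriv]
  exact mul_ne_zero (hR0 z hz) (exp_ne_zero _)

end Holomorphic

section RootProduct

variable {P : Finset ℂ} {U : Set ℂ} {u : ℂ → ℂ}

/-- The monic polynomial function with simple zeros exactly at the points of `P`. -/
def rootProduct (P : Finset ℂ) (z : ℂ) : ℂ := ∏ p ∈ P, (z - p)

theorem differentiable_rootProduct (P : Finset ℂ) : Differentiable ℂ (rootProduct P) := by
  unfold rootProduct
  fun_prop

theorem rootProduct_eq_zero_iff {z : ℂ} : rootProduct P z = 0 ↔ z ∈ P := by
  simp [rootProduct, Finset.prod_eq_zero_iff, sub_eq_zero]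

theorem deriv_rootProduct_ne_zero {p : ℂ} (hp : p ∈ P) : deriv (rootProduct P) p ≠ 0 := by
  have hsplit : rootProduct P = fun z => (z - p) * rootProduct (P.erase p) z :=
    funext fun z => (Finset.mul_prod_erase P (fun x => z - x) hp).symm
  have hderiv : HasDerivAt (rootProduct P) (rootProduct (P.erase p) p) p := by
    rw [hsplit]
    simpa using ((hasDerivAt_id' p).sub_const p).fun_mul
      (differentiable_rootProduct (P.erase p) p).hasDerivAt
  rw [hderiv.deriv, Ne, rootProduct_eq_zero_iff]
  exact Finset.notMem_erase p P

theorem exists_eq_add_rootProduct_mul (hU : IsOpen U) (hP : ∀ p ∈ P, p ∈ U)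
    (hu : DifferentiableOn ℂ u U) : ∃ v w : ℂ → ℂ, Differentiable ℂ v ∧ DifferentiableOn ℂ w U ∧
      ∀ z, u z = v z + rootProduct P z * w z := by
  induction P using Finset.induction_on generalizing u with
  | empty => exact ⟨0, u, differentiable_const _, hu, fun z => by simp [rootProduct]⟩
  | insert p P hp ih =>
    obtain ⟨v, w, hv, hw, h⟩ := ih (fun p' hp' => hP p' (Finset.mem_insert_of_mem hp'))
      ((differentiableOn_dslope (hU.mem_nhds (hP p (Finset.mem_insert_self p P)))).mpr hu)
    refine ⟨fun z => u p + (z - p) * v z, w, by fun_prop, hw, fun z => ?_⟩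
    have hslope := sub_smul_dslope u p z
    rw [smul_eq_mul, h z] at hslope
    rw [rootProduct, Finset.prod_insert hp, ← rootProduct]
    linear_combination -hslope

theorem exists_eq_add_rootProduct_sq_mul (hU : IsOpen U) (hP : ∀ p ∈ P, p ∈ U)
    (hu : DifferentiableOn ℂ u U) : ∃ v w : ℂ → ℂ, Differentiable ℂ v ∧ DifferentiableOn ℂ w U ∧
      ∀ z, u z = v z + rootProduct P z ^ 2 * w z := by
  obtain ⟨v₀, w₀, hv₀, hw₀, h₀⟩ := exists_eq_add_rootProduct_mul hU hP hu
  obtain ⟨v₁, w₁, hv₁, hw₁, h₁⟩ := exists_eq_add_rootProduct_mul hU hP hw₀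
  refine ⟨fun z => v₀ z + rootProduct P z * v₁ z, w₁,
    hv₀.add ((differentiable_rootProduct P).mul hv₁), hw₁, fun z => ?_⟩
  rw [h₀, h₁]
  ring

theorem exists_differentiable_eq_mul {F Q τ : ℂ → ℂ} (hU : IsOpen U) (hF : Differentiable ℂ F)
    (hQ : Differentiable ℂ Q) (hQU : ∀ z, Q z = 0 → z ∈ U) (hτ : DifferentiableOn ℂ τ U)
    (h : ∀ z ∈ U, F z = Q z * τ z) :
    ∃ t : ℂ → ℂ, Differentiable ℂ t ∧ (∀ z, F z = Q z * t z) ∧ EqOn t τ U := by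
  classical
  set t : ℂ → ℂ := fun z => if Q z = 0 then τ z else F z / Q z with ht
  have htU : EqOn t τ U := fun z hz => by
    by_cases hQz : Q z = 0
    · exact if_pos hQz
    · simp only [ht, if_neg hQz, h z hz, mul_div_cancel_left₀ _ hQz]
  refine ⟨t, fun z => ?_, fun z => ?_, htU⟩
  · by_cases hz : z ∈ U
    · exact (hτ.differentiableAt (hU.mem_nhds hz)).congr_of_eventuallyEq
        (htU.eventuallyEq_of_mem (hU.mem_nhds hz))
    · have hQz : Q z ≠ 0 := mt (hQU z) hz
      refine ((hF z).fun_div (hQ z) hQz).congr_of_eventuallyEq ?_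
      filter_upwards [(hQ z).continuousAt.eventually_ne hQz] with w hw using if_neg hw
  · by_cases hQz : Q z = 0
    · rw [htU (hQU z hQz), h z (hQU z hQz)]
    · simp only [ht, if_neg hQz, mul_div_cancel₀ _ hQz]

end RootProduct

section Wronskian

variable {P : Finset ℂ} {K U : Set ℂ} {q φ ψ f r ρ : ℂ → ℂ} {z : ℂ} {ε : ℝ}

/-- The numerator `q φ' - q' φ` of the derivative of `φ / q`. -/
def wronskian (q φ : ℂ → ℂ) (z : ℂ) : ℂ := q z * deriv φ z - deriv q z * φ z

theorem wronskian_congr (h : φ =ᶠ[𝓝 z] ψ) : wronskian q φ z = wronskian q ψ z := by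
  rw [wronskian, wronskian, h.deriv_eq, h.self_of_nhds]

theorem wronskian_of_eq_zero (h : q z = 0) : wronskian q φ z = -(deriv q z * φ z) := by
  rw [wronskian, h, zero_mul, zero_sub]

theorem wronskian_add_mul {f' : ℂ} (hφ : DifferentiableAt ℂ φ z) (hq : DifferentiableAt ℂ q z)
    (hf : HasDerivAt f f' z) :
    wronskian q (fun w => φ w + q w * f w) z = wronskian q φ z + q z ^ 2 * f' := by
  rw [wronskian, (hφ.hasDerivAt.fun_add (hq.hasDerivAt.fun_mul hf)).deriv, wronskian]
  ring

theorem wronskian_mul {f' : ℂ} (hq : DifferentiableAt ℂ q z) (hf : HasDerivAt f f' z) :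
    wronskian q (fun w => q w * f w) z = q z ^ 2 * f' := by
  rw [wronskian, (hq.hasDerivAt.fun_mul hf).deriv]
  ring

theorem differentiable_wronskian (hq : Differentiable ℂ q) (hφ : Differentiable ℂ φ) :
    Differentiable ℂ (wronskian q φ) :=
  (hq.mul hφ.deriv).sub (hq.deriv.mul hφ)

theorem differentiableOn_wronskian (hU : IsOpen U) (hq : DifferentiableOn ℂ q U)
    (hφ : DifferentiableOn ℂ φ U) : DifferentiableOn ℂ (wronskian q φ) U :=
  (hq.mul (hφ.deriv hU)).sub ((hq.deriv hU).mul hφ)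

theorem exists_wronskian_rootProduct_eq (hU : IsOpen U) (hP : ∀ p ∈ P, p ∈ U)
    (hφ : DifferentiableOn ℂ φ U) (hr : Differentiable ℂ r) (hρ : DifferentiableOn ℂ ρ U)
    (hW : ∀ z ∈ U, wronskian (rootProduct P) φ z = r z + rootProduct P z ^ 2 * ρ z) :
    ∃ Φ f : ℂ → ℂ, Differentiable ℂ Φ ∧ (∀ z, wronskian (rootProduct P) Φ z = r z) ∧
      (∀ z, φ z = Φ z + rootProduct P z * f z) ∧ ∀ z ∈ U, HasDerivAt f (ρ z) z := by
  set q := rootProduct P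
  have hq : Differentiable ℂ q := differentiable_rootProduct P
  obtain ⟨Φ₀, w, hΦ₀, hw, hφw⟩ := exists_eq_add_rootProduct_sq_mul hU hP hφ
  have hqw : DifferentiableOn ℂ (fun z => q z * w z) U := hq.differentiableOn.mul hw
  have hderiv {z : ℂ} (hz : z ∈ U) :
      HasDerivAt (fun z => q z * w z) (deriv (fun z => q z * w z) z) z :=
    (hqw.differentiableAt (hU.mem_nhds hz)).hasDerivAt
  have hφ_eq : φ = fun z => Φ₀ z + q z * (q z * w z) := funext fun z => by
    rw [hφw z]
    ring
  obtain ⟨t, ht, htF, htU⟩ := exists_differentiable_eq_mul hU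
    (F := fun z => r z - wronskian q Φ₀ z) (Q := fun z => q z ^ 2)
    (hr.sub (differentiable_wronskian hq hΦ₀)) (hq.pow 2)
    (fun z hz => hP z (rootProduct_eq_zero_iff.mp (pow_eq_zero_iff two_ne_zero |>.mp hz)))
    ((hqw.deriv hU).sub hρ) fun z hz => by
      have hWz := hW z hz
      rw [hφ_eq, wronskian_add_mul (hΦ₀ z) (hq z) (hderiv hz)] at hWz
      simp only [Pi.sub_apply]
      linear_combination -hWz
  obtain ⟨T, hT⟩ := ht.isExactOn_univ
  have hT (z : ℂ) : HasDerivAt T (t z) z := hT z (mem_univ z)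
  refine ⟨fun z => Φ₀ z + q z * T z, fun z => q z * w z - T z,
    hΦ₀.add (hq.mul fun z => (hT z).differentiableAt), fun z => ?_, fun z => ?_, fun z hz => ?_⟩
  · rw [wronskian_add_mul (hΦ₀ z) (hq z) (hT z), ← htF z, add_sub_cancel]
  · rw [hφ_eq]
    ring
  · refine ((hderiv hz).fun_sub (hT z)).congr_deriv ?_
    rw [htU hz, Pi.sub_apply, sub_sub_cancel]

theorem add_sq_mul_expField (r q : ℂ → ℂ) (z s : ℂ) :
    r z + q z ^ 2 * expField 0 r q z s = r z * exp (q z ^ 2 * s) := by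
  rw [expField, Pi.zero_apply, zero_add]
  linear_combination r z * mul_expSlope (q z ^ 2 * s)

theorem exists_wronskian_rootProduct_eq_mul_exp (hK : IsCompact K) (hKR : IsRungeIn K univ)
    (hU : IsOpen U) (hKU : K ⊆ U) (hPK : ∀ p ∈ P, p ∈ K) (hφ : DifferentiableOn ℂ φ U)
    (hW : ∀ z ∈ K, wronskian (rootProduct P) φ z ≠ 0) :
    ∃ r s : ℂ → ℂ, Differentiable ℂ r ∧ (∀ z, r z ≠ 0) ∧ ∀ᶠ z in 𝓝ˢ K, DifferentiableAt ℂ s z ∧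
      wronskian (rootProduct P) φ z = r z * exp (rootProduct P z ^ 2 * s z) := by
  have hWd : ∀ᶠ z in 𝓝ˢ K, DifferentiableAt ℂ (wronskian (rootProduct P) φ) z := by
    filter_upwards [hU.mem_nhdsSet.mpr hKU] with z hz
    exact (differentiableOn_wronskian hU (differentiable_rootProduct P).differentiableOn
      hφ).differentiableAt (hU.mem_nhds hz)
  obtain ⟨R, u, hR, hR0, hu⟩ := hasExpFactorization_of_forall_ne_zero hK hKR hWd hW
  obtain ⟨V, hV, hKV, hVu⟩ := eventually_nhdsSet_iff_exists.mp hu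
  obtain ⟨v, s, hv, hs, hus⟩ := exists_eq_add_rootProduct_sq_mul hV (fun p hp => hKV (hPK p hp))
    fun z hz => (hVu z hz).1.differentiableWithinAt
  refine ⟨fun z => R z * exp (v z), s, (differentiableOn_univ.mp hR).mul hv.cexp,
    fun z => mul_ne_zero (hR0 z (mem_univ z)) (exp_ne_zero _), ?_⟩
  filter_upwards [hV.mem_nhdsSet.mpr hKV] with z hz
  refine ⟨hs.differentiableAt (hV.mem_nhds hz), ?_⟩
  rw [(hVu z hz).2, hus z, exp_add, mul_assoc]

theorem exists_differentiable_wronskian_rootProduct_ne_zero (hK : IsCompact K)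
    (hKR : IsRungeIn K univ) (hU : IsOpen U) (hKU : K ⊆ U) (hPK : ∀ p ∈ P, p ∈ K)
    (hφ : DifferentiableOn ℂ φ U) (hW : ∀ z ∈ K, wronskian (rootProduct P) φ z ≠ 0)
    (hε : 0 < ε) :
    ∃ ψ : ℂ → ℂ, Differentiable ℂ ψ ∧ (∀ z, wronskian (rootProduct P) ψ z ≠ 0) ∧
      ∀ z ∈ K, ∃ d, ψ z - φ z = rootProduct P z * d ∧ ‖d‖ < ε := by
  have hq := differentiable_rootProduct P
  obtain ⟨r, s, hr, hr0, hs⟩ :=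
    exists_wronskian_rootProduct_eq_mul_exp hK hKR hU hKU hPK hφ hW
  obtain ⟨V, hV, hKV, hVs⟩ :=
    eventually_nhdsSet_iff_exists.mp (hs.and (hU.mem_nhdsSet.mpr hKU))
  have hsd : DifferentiableOn ℂ s V := fun z hz => (hVs z hz).1.1.differentiableWithinAt
  have hcoeffs {Ω : Set ℂ} : HolomorphicCoeffs 0 r (rootProduct P) Ω :=
    ⟨differentiableOn_const _, hr.differentiableOn, hq.differentiableOn, fun z _ => hr0 z⟩
  obtain ⟨Φ, f, hΦ, hWΦ, hφf, hf⟩ := exists_wronskian_rootProduct_eq hV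
    (fun p hp => hKV (hPK p hp)) (hφ.mono fun z hz => (hVs z hz).2) hr
    (hcoeffs.differentiableOn_expField hsd) fun z hz => by
      rw [add_sq_mul_expField, (hVs z hz).1.2]
  have hsol : SolNear 0 r (rootProduct P) K s f :=
    solNear_iff_exists_isOpen.mpr ⟨V, hV, hKV, hsd, hf⟩
  obtain ⟨s', g, hsg, hg⟩ := hsol.exists_solNear_norm_sub_lt hcoeffs isOpen_univ
    (fun z _ hz => hPK z (rootProduct_eq_zero_iff.mp hz)) hK (subset_univ K) hKR hε
  have hgd (z : ℂ) : HasDerivAt g (expField 0 r (rootProduct P) z (s' z)) z :=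
    (hsg.self_of_nhdsSet z (mem_univ z)).2
  refine ⟨fun z => Φ z + rootProduct P z * g z,
    hΦ.add (hq.mul fun z => (hgd z).differentiableAt), fun z => ?_,
    fun z hz => ⟨g z - f z, ?_, hg z hz⟩⟩
  · rw [wronskian_add_mul (hΦ z) (hq z) (hgd z), hWΦ, add_sq_mul_expField]
    exact mul_ne_zero (hr0 z) (exp_ne_zero _)
  · rw [hφf z]
    ring

end Wronskian

section SphereDiv

variable {f : ℂ → Sphere} {ψ q : ℂ → ℂ} {U : Set ℂ} {z : ℂ}

theorem chordal_coe_le_norm_sub (z w : ℂ) : chordal (z : Sphere) (w : Sphere) ≤ ‖z - w‖ := by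
  have h (x : ℂ) : 1 ≤ √(1 + ‖x‖ ^ 2) := Real.one_le_sqrt.mpr (by simp)
  exact div_le_self (norm_nonneg _) (one_le_mul_of_one_le_of_one_le (h z) (h w))

theorem coe_finitePart (h : f z ≠ OnePoint.infty) : (finitePart f z : Sphere) = f z := by
  obtain ⟨x, hx⟩ := OnePoint.ne_infty_iff_exists.mp h
  simp only [finitePart, ← hx]
  rfl

theorem continuousAt_finitePart (hf : ContinuousAt f z) (h : f z ≠ OnePoint.infty) :
    ContinuousAt (finitePart f) z := by
  refine (OnePoint.isOpenEmbedding_coe (X := ℂ)).isInducing.continuousAt_iff.mpr (hf.congr ?_)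
  filter_upwards [hf.eventually_ne h] with w hw using (coe_finitePart hw).symm

theorem tendsto_coe_nhds_infty_iff {α : Type*} {l : Filter α} {g : α → ℂ} :
    Tendsto (fun x => (g x : Sphere)) l (𝓝 OnePoint.infty) ↔
      Tendsto g l (Bornology.cobounded ℂ) := by
  rw [Metric.cobounded_eq_cocompact, ← coclosedCompact_eq_cocompact,
    ← OnePoint.comap_coe_nhds_infty, tendsto_comap_iff]
  rfl

theorem tendsto_finitePart_cobounded (hf : ContinuousAt f z) (h : f z = OnePoint.infty)
    (hne : ∀ᶠ w in 𝓝[≠] z, f w ≠ OnePoint.infty) :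
    Tendsto (finitePart f) (𝓝[≠] z) (Bornology.cobounded ℂ) := by
  rw [← tendsto_coe_nhds_infty_iff, ← h]
  refine (hf.tendsto.mono_left nhdsWithin_le_nhds).congr' ?_
  filter_upwards [hne] with w hw using (coe_finitePart hw).symm

/-- The quotient `ψ / q` as a map into the Riemann sphere. Its value is `∞` at every zero of `q`,
whether or not `ψ` vanishes there. -/
def sphereDiv (ψ q : ℂ → ℂ) (z : ℂ) : Sphere :=
  open Classical in if q z = 0 then OnePoint.infty else ((ψ z / q z : ℂ) : Sphere)

theorem sphereDiv_of_eq_zero (h : q z = 0) : sphereDiv ψ q z = OnePoint.infty := if_pos h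

theorem sphereDiv_of_ne_zero (h : q z ≠ 0) : sphereDiv ψ q z = ((ψ z / q z : ℂ) : Sphere) :=
  if_neg h

theorem sphereDiv_eq_infty_iff : sphereDiv ψ q z = OnePoint.infty ↔ q z = 0 := by
  refine ⟨fun h => ?_, sphereDiv_of_eq_zero⟩
  by_contra hq
  exact OnePoint.coe_ne_infty _ ((sphereDiv_of_ne_zero hq).symm.trans h)

theorem finitePart_sphereDiv (ψ q : ℂ → ℂ) : finitePart (sphereDiv ψ q) = ψ / q := by
  funext z
  by_cases h : q z = 0
  · simp only [finitePart, sphereDiv_of_eq_zero h, Pi.div_apply, h, div_zero]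
    rfl
  · simp only [finitePart, sphereDiv_of_ne_zero h, Pi.div_apply]
    rfl

theorem eventually_ne_zero_of_wronskian_ne_zero (hq : DifferentiableAt ℂ q z)
    (hW : wronskian q ψ z ≠ 0) : ∀ᶠ w in 𝓝[≠] z, q w ≠ 0 := by
  by_cases h : q z = 0
  · rw [wronskian_of_eq_zero h] at hW
    exact hq.hasDerivAt.eventually_ne (left_ne_zero_of_mul (neg_ne_zero.mp hW))
  · exact (hq.continuousAt.eventually_ne h).filter_mono nhdsWithin_le_nhds

theorem continuousAt_sphereDiv_of_ne_zero (hψ : ContinuousAt ψ z) (hq : ContinuousAt q z)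
    (h : q z ≠ 0) : ContinuousAt (sphereDiv ψ q) z := by
  refine (OnePoint.continuous_coe.continuousAt.comp (hψ.div hq h)).congr ?_
  filter_upwards [hq.eventually_ne h] with w hw using (sphereDiv_of_ne_zero hw).symm

theorem continuousAt_sphereDiv_of_eq_zero (hψ : ContinuousAt ψ z) (hq : ContinuousAt q z)
    (h : q z = 0) (hψ0 : ψ z ≠ 0) (hne : ∀ᶠ w in 𝓝[≠] z, q w ≠ 0) :
    ContinuousAt (sphereDiv ψ q) z := by
  have hinv : Tendsto (fun w => q w / ψ w) (𝓝[≠] z) (𝓝[≠] 0) := by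
    refine tendsto_nhdsWithin_iff.mpr ⟨?_, ?_⟩
    · have hlim := (hq.div hψ hψ0).tendsto
      rw [Pi.div_apply, h, zero_div] at hlim
      exact hlim.mono_left nhdsWithin_le_nhds
    · filter_upwards [hne, (hψ.eventually_ne hψ0).filter_mono nhdsWithin_le_nhds] with w hqw hψw
        using div_ne_zero hqw hψw
  have hlim : Tendsto (fun w => ψ w / q w) (𝓝[≠] z) (Bornology.cobounded ℂ) :=
    (tendsto_inv₀_nhdsNE_zero.comp hinv).congr fun w => inv_div _ _
  rw [continuousAt_iff_punctured_nhds, sphereDiv_of_eq_zero h]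
  refine (tendsto_coe_nhds_infty_iff.mpr hlim).congr' ?_
  filter_upwards [hne] with w hw using (sphereDiv_of_ne_zero hw).symm

theorem meromorphicOrderAt_eq_one (hq : AnalyticAt ℂ q z) (h : q z = 0) (hd : deriv q z ≠ 0) :
    meromorphicOrderAt q z = ((1 : ℤ) : WithTop ℤ) := by
  rw [hq.meromorphicOrderAt_eq, hq.analyticOrderAt_eq_one_of_zero_deriv_ne_zero h hd]
  rfl

theorem meromorphicOrderAt_eq_zero_iff (hψ : AnalyticAt ℂ ψ z) :
    meromorphicOrderAt ψ z = 0 ↔ ψ z ≠ 0 :=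
  hψ.meromorphicNFAt.meromorphicOrderAt_eq_zero_iff

theorem meromorphicOrderAt_div_eq_neg_one (hψ : AnalyticAt ℂ ψ z) (hq : AnalyticAt ℂ q z)
    (h : q z = 0) (hW : wronskian q ψ z ≠ 0) :
    meromorphicOrderAt (ψ / q) z = ((-1 : ℤ) : WithTop ℤ) := by
  rw [wronskian_of_eq_zero h, neg_ne_zero, mul_ne_zero_iff] at hW
  rw [meromorphicOrderAt_div hψ.meromorphicAt hq.meromorphicAt,
    meromorphicOrderAt_eq_one hq h hW.1, (meromorphicOrderAt_eq_zero_iff hψ).mpr hW.2]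
  rfl

theorem deriv_div_eq_wronskian_div (hψ : DifferentiableAt ℂ ψ z) (hq : DifferentiableAt ℂ q z)
    (h : q z ≠ 0) : deriv (ψ / q) z = wronskian q ψ z / q z ^ 2 := by
  rw [deriv_div hψ hq h, wronskian]
  ring

theorem meroLocUnivOn_sphereDiv (hψ : AnalyticOnNhd ℂ ψ U) (hq : AnalyticOnNhd ℂ q U)
    (hW : ∀ z ∈ U, wronskian q ψ z ≠ 0) : MeroLocUnivOn (sphereDiv ψ q) U := by
  have hne {z : ℂ} (hz : z ∈ U) : ∀ᶠ w in 𝓝[≠] z, q w ≠ 0 :=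
    eventually_ne_zero_of_wronskian_ne_zero (hq z hz).differentiableAt (hW z hz)
  refine ⟨fun z hz => ⟨?_, ?_, ?_⟩, fun z hz hinf => ?_, fun z hz hfin => ?_⟩
  · filter_upwards [hne hz] with w hw using mt sphereDiv_eq_infty_iff.mp hw
  · rw [finitePart_sphereDiv]
    exact (hψ z hz).meromorphicAt.div (hq z hz).meromorphicAt
  · by_cases h : q z = 0
    · have hWz := hW z hz
      rw [wronskian_of_eq_zero h] at hWz
      exact continuousAt_sphereDiv_of_eq_zero (hψ z hz).continuousAt (hq z hz).continuousAt h
        (right_ne_zero_of_mul (neg_ne_zero.mp hWz)) (hne hz)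
    · exact continuousAt_sphereDiv_of_ne_zero (hψ z hz).continuousAt (hq z hz).continuousAt h
  · rw [finitePart_sphereDiv]
    exact (meromorphicOrderAt_div_eq_neg_one (hψ z hz) (hq z hz)
      (sphereDiv_eq_infty_iff.mp hinf) (hW z hz)).ge
  · have h : q z ≠ 0 := mt sphereDiv_eq_infty_iff.mpr hfin
    rw [finitePart_sphereDiv, deriv_div_eq_wronskian_div (hψ z hz).differentiableAt
      (hq z hz).differentiableAt h]
    exact div_ne_zero (hW z hz) (pow_ne_zero 2 h)

end SphereDiv

section Meromorphic

variable {f : ℂ → Sphere} {K U : Set ℂ} {P : Finset ℂ} {z : ℂ} {ε : ℝ}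

theorem MeroLocUnivOn.mono {V : Set ℂ} (hf : MeroLocUnivOn f U) (hVU : V ⊆ U) :
    MeroLocUnivOn f V :=
  ⟨fun z hz => hf.1 z (hVU hz), fun z hz => hf.2.1 z (hVU hz), fun z hz => hf.2.2 z (hVU hz)⟩

theorem MeroOn.finite_setOf_eq_infty (hf : MeroOn f K) (hK : IsCompact K) :
    {z ∈ K | f z = OnePoint.infty}.Finite := by
  by_contra h
  obtain ⟨z, hz, hacc⟩ := Set.Infinite.exists_accPt_of_subset_isCompact h hK (sep_subset _ _)
  rw [accPt_iff_frequently_nhdsNE] at hacc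
  exact hacc ((hf z hz).1.mono fun w hw hw' => hw hw'.2)

theorem MeroOn.isOpen_setOf_eq_infty_imp (hf : MeroOn f U) (hU : IsOpen U) (S : Set ℂ) :
    IsOpen {z ∈ U | f z = OnePoint.infty → z ∈ S} := by
  refine isOpen_iff_mem_nhds.mpr fun z ⟨hz, hzS⟩ => ?_
  obtain ⟨hne, -, hcont⟩ := hf z hz
  by_cases h : f z = OnePoint.infty
  · filter_upwards [hU.mem_nhds hz, eventually_nhdsWithin_iff.mp hne] with w hw hwne
    refine ⟨hw, fun hwf => ?_⟩
    by_cases hwz : w = z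
    · exact hwz ▸ hzS h
    · exact absurd hwf (hwne hwz)
  · filter_upwards [hU.mem_nhds hz, hcont.eventually_ne h] with w hw hwf
    exact ⟨hw, fun h => absurd h hwf⟩

theorem exists_finset_poles_of_mem_mlu (hK : IsCompact K) (hf : f ∈ MLU K) :
    ∃ (U : Set ℂ) (P : Finset ℂ), IsOpen U ∧ K ⊆ U ∧ (∀ p ∈ P, p ∈ K) ∧ MeroLocUnivOn f U ∧
      ∀ z ∈ U, f z = OnePoint.infty ↔ z ∈ P := by
  obtain ⟨U, hU, hKU, hfU⟩ := hf
  have hfin := (hfU.mono hKU).1.finite_setOf_eq_infty hK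
  have hmem (z : ℂ) : z ∈ hfin.toFinset ↔ z ∈ K ∧ f z = OnePoint.infty := hfin.mem_toFinset
  exact ⟨{z ∈ U | f z = OnePoint.infty → z ∈ (hfin.toFinset : Set ℂ)}, hfin.toFinset,
    hfU.1.isOpen_setOf_eq_infty_imp hU _,
    fun z hz => ⟨hKU hz, fun h => (hmem z).mpr ⟨hz, h⟩⟩, fun p hp => ((hmem p).mp hp).1,
    hfU.mono (sep_subset _ _), fun z hz => ⟨hz.2, fun h => ((hmem z).mp h).2⟩⟩

theorem MeroLocUnivOn.meromorphicOrderAt_eq_neg_one (hf : MeroLocUnivOn f U) (hz : z ∈ U)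
    (h : f z = OnePoint.infty) :
    meromorphicOrderAt (finitePart f) z = ((-1 : ℤ) : WithTop ℤ) := by
  obtain ⟨hne, hmer, hcont⟩ := hf.1 z hz
  have hge := hf.2.1 z hz h
  have hlt := (tendsto_cobounded_iff_meromorphicOrderAt_neg hmer).mp
    (tendsto_finitePart_cobounded hcont h hne)
  obtain ⟨n, hn⟩ := WithTop.ne_top_iff_exists.mp (hlt.trans_le le_top).ne
  rw [← hn] at hge hlt ⊢
  have hge' : -1 ≤ n := WithTop.coe_le_coe.mp hge
  have hlt' : n < 0 := WithTop.coe_lt_coe.mp hlt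
  rw [show n = -1 by omega]

theorem MeroLocUnivOn.differentiableAt_finitePart (hf : MeroLocUnivOn f U) (hz : z ∈ U)
    (h : f z ≠ OnePoint.infty) : DifferentiableAt ℂ (finitePart f) z :=
  ((hf.1 z hz).2.1.analyticAt (continuousAt_finitePart (hf.1 z hz).2.2 h)).differentiableAt

theorem exists_analyticOnNhd_eventuallyEq_nhdsNE {h : ℂ → ℂ} (hh : MeromorphicOn h U)
    (hord : ∀ z ∈ U, 0 ≤ meromorphicOrderAt h z) :
    ∃ φ : ℂ → ℂ, AnalyticOnNhd ℂ φ U ∧ ∀ z ∈ U, φ =ᶠ[𝓝[≠] z] h := by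
  refine ⟨toMeromorphicNFOn h U, fun z hz => ?_, fun z hz =>
    hh.toMeromorphicNFOn_eq_self_on_nhdsNE hz⟩
  refine (meromorphicNFOn_toMeromorphicNFOn h U hz).meromorphicOrderAt_nonneg_iff_analyticAt.mp ?_
  rw [meromorphicOrderAt_toMeromorphicNFOn hh hz]
  exact hord z hz

theorem MeroLocUnivOn.meromorphicOrderAt_rootProduct_mul (hf : MeroLocUnivOn f U) (hz : z ∈ U)
    (hfz : f z = OnePoint.infty) (hzP : z ∈ P) :
    meromorphicOrderAt (rootProduct P * finitePart f) z = 0 := by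
  have hq := (differentiable_rootProduct P).analyticAt z
  rw [meromorphicOrderAt_mul hq.meromorphicAt (hf.1 z hz).2.1,
    meromorphicOrderAt_eq_one hq (rootProduct_eq_zero_iff.mpr hzP) (deriv_rootProduct_ne_zero hzP),
    hf.meromorphicOrderAt_eq_neg_one hz hfz]
  rfl

theorem MeroLocUnivOn.exists_numerator (hf : MeroLocUnivOn f U)
    (hfP : ∀ z ∈ U, f z = OnePoint.infty ↔ z ∈ P) :
    ∃ φ : ℂ → ℂ, AnalyticOnNhd ℂ φ U ∧ (∀ z ∈ U, z ∈ P → φ z ≠ 0) ∧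
      ∀ z ∈ U, z ∉ P → φ =ᶠ[𝓝 z] fun w => rootProduct P w * finitePart f w := by
  have hq : Differentiable ℂ (rootProduct P) := differentiable_rootProduct P
  have hmer : MeromorphicOn (rootProduct P * finitePart f) U := fun z hz =>
    (hq.analyticAt z).meromorphicAt.mul (hf.1 z hz).2.1
  have hcont {z : ℂ} (hz : z ∈ U) (hzP : z ∉ P) :
      ContinuousAt (rootProduct P * finitePart f) z :=
    (hq z).continuousAt.mul
      (hf.differentiableAt_finitePart hz (mt (hfP z hz).mp hzP)).continuousAt
  have hpole {z : ℂ} (hz : z ∈ U) (hzP : z ∈ P) :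
      meromorphicOrderAt (rootProduct P * finitePart f) z = 0 :=
    hf.meromorphicOrderAt_rootProduct_mul hz ((hfP z hz).mpr hzP) hzP
  obtain ⟨φ, hφ, hφh⟩ := exists_analyticOnNhd_eventuallyEq_nhdsNE hmer fun z hz => by
    by_cases hzP : z ∈ P
    · exact (hpole hz hzP).ge
    · exact ((hmer z hz).analyticAt (hcont hz hzP)).meromorphicOrderAt_nonneg
  refine ⟨φ, hφ, fun z hz hzP => ?_, fun z hz hzP => ?_⟩
  · rw [← meromorphicOrderAt_eq_zero_iff (hφ z hz), meromorphicOrderAt_congr (hφh z hz),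
      hpole hz hzP]
  · exact ((hφ z hz).continuousAt.eventuallyEq_nhds_iff_eventuallyEq_nhdsNE
      (hcont hz hzP)).mp (hφh z hz)

theorem MeroLocUnivOn.exists_eq_sphereDiv (hf : MeroLocUnivOn f U)
    (hfP : ∀ z ∈ U, f z = OnePoint.infty ↔ z ∈ P) :
    ∃ φ : ℂ → ℂ, AnalyticOnNhd ℂ φ U ∧ (∀ z ∈ U, wronskian (rootProduct P) φ z ≠ 0) ∧
      ∀ z ∈ U, f z = sphereDiv φ (rootProduct P) z := by
  obtain ⟨φ, hφ, hφP, hφf⟩ := hf.exists_numerator hfP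
  refine ⟨φ, hφ, fun z hz => ?_, fun z hz => ?_⟩ <;> by_cases hzP : z ∈ P
  · rw [wronskian_of_eq_zero (rootProduct_eq_zero_iff.mpr hzP)]
    exact neg_ne_zero.mpr (mul_ne_zero (deriv_rootProduct_ne_zero hzP) (hφP z hz hzP))
  · have hfz : f z ≠ OnePoint.infty := mt (hfP z hz).mp hzP
    rw [wronskian_congr (hφf z hz hzP), wronskian_mul (differentiable_rootProduct P z)
      (hf.differentiableAt_finitePart hz hfz).hasDerivAt]
    exact mul_ne_zero (pow_ne_zero 2 (mt rootProduct_eq_zero_iff.mp hzP)) (hf.2.2 z hz hfz)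
  · rw [sphereDiv_of_eq_zero (rootProduct_eq_zero_iff.mpr hzP), (hfP z hz).mpr hzP]
  · have hqz : rootProduct P z ≠ 0 := mt rootProduct_eq_zero_iff.mp hzP
    rw [sphereDiv_of_ne_zero hqz, (hφf z hz hzP).self_of_nhds, mul_div_cancel_left₀ _ hqz,
      coe_finitePart (mt (hfP z hz).mp hzP)]

theorem exists_mem_mlu_chordal_lt (hK : IsCompact K) (hKR : IsRungeIn K univ) (hf : f ∈ MLU K)
    (hε : 0 < ε) : ∃ g ∈ MLU univ, ∀ z ∈ K, chordal (g z) (f z) < ε := by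
  obtain ⟨U, P, hU, hKU, hPK, hfU, hfP⟩ := exists_finset_poles_of_mem_mlu hK hf
  obtain ⟨φ, hφ, hW, hfφ⟩ := hfU.exists_eq_sphereDiv hfP
  obtain ⟨ψ, hψ, hWψ, hψφ⟩ := exists_differentiable_wronskian_rootProduct_ne_zero hK hKR hU hKU hPK
    hφ.differentiableOn (fun z hz => hW z (hKU hz)) hε
  refine ⟨sphereDiv ψ (rootProduct P), ⟨univ, isOpen_univ, subset_rfl, meroLocUnivOn_sphereDiv
    (fun z _ => hψ.analyticAt z) (fun z _ => (differentiable_rootProduct P).analyticAt z)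
    fun z _ => hWψ z⟩, fun z hz => ?_⟩
  rw [hfφ z (hKU hz)]
  by_cases h : rootProduct P z = 0
  · rw [sphereDiv_of_eq_zero h, sphereDiv_of_eq_zero h]
    exact hε
  · obtain ⟨d, hd, hdε⟩ := hψφ z hz
    rw [sphereDiv_of_ne_zero h, sphereDiv_of_ne_zero h]
    refine (chordal_coe_le_norm_sub _ _).trans_lt ?_
    rwa [← sub_div, hd, mul_div_cancel_left₀ _ h]

end Meromorphic

end LocUniv

end

theorem mainTheorem1_general (Ω K : Set ℂ) (hΩ : IsOpen Ω) (hK : IsCompact K) (hKΩ : K ⊆ Ω)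
    (hcomp : ∀ z ∈ Ω \ K, ¬ LocUniv.RelCompactIn (connectedComponentIn (Ω \ K) z) Ω) :
    (∀ f ∈ LocUniv.HLU K, ∀ ε > (0 : ℝ), ∃ g ∈ LocUniv.HLU Ω,
      ∀ z ∈ K, ‖g z - f z‖ < ε) ∧
    (IsConnected Kᶜ → ∀ f ∈ LocUniv.MLU K, ∀ ε > (0 : ℝ), ∃ g ∈ LocUniv.MLU Set.univ,
      ∀ z ∈ K, LocUniv.chordal (g z) (f z) < ε) := by
  have hKR : LocUniv.IsRungeIn K Ω := LocUniv.isRungeIn_of_forall_not_relCompactIn hKΩ hcomp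
  refine ⟨fun f hf ε hε => LocUniv.exists_mem_hlu_norm_sub_lt hΩ hK hKΩ hKR hf hε,
    fun hc f hf ε hε => ?_⟩
  have hKR_univ : LocUniv.IsRungeIn K univ :=
    LocUniv.isRungeIn_univ_of_isPreconnected_compl hK hc.isPreconnected
  exact LocUniv.exists_mem_mlu_chordal_lt hK hKR_univ hf hε

theorem mainTheorem1 (Ω K : Set ℂ) (hΩ : IsOpen Ω) (hΩc : IsConnected Ω)
    (hK : IsCompact K) (hKΩ : K ⊆ Ω)
    (hcomp : ∀ z ∈ Ω \ K, ¬ LocUniv.RelCompactIn (connectedComponentIn (Ω \ K) z) Ω) :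
    (∀ f ∈ LocUniv.HLU K, ∀ ε > (0 : ℝ), ∃ g ∈ LocUniv.HLU Ω,
      ∀ z ∈ K, ‖g z - f z‖ < ε) ∧
    (IsConnected Kᶜ → ∀ f ∈ LocUniv.MLU K, ∀ ε > (0 : ℝ), ∃ g ∈ LocUniv.MLU Set.univ,
      ∀ z ∈ K, LocUniv.chordal (g z) (f z) < ε) :=
  mainTheorem1_general Ω K hΩ hK hKΩ hcomp
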